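/- **Setting.** Let $\Omega=(0,1)^d$ and let $\Omega_N$ be the uniform grid of $2^{Nd}$ open cubic cells of side $2^{-N}$. For $n,k\ge 0$ let $V_n^k$ be the space of functions on $(0,1]$ that are polynomials of degree at most $k$ on each cell $(2^{-n}j,2^{-n}(j+1)]$, $0\le j<2^n$. Let $W_0^k=V_0^k$, and for $n\ge1$ let $W_n^k$ be the $L^2(0,1)$-orthogonal complement of $V_{n-1}^k$ in $V_n^k$. Put $\mathbf V_N^k=V_N^k\otimes\cdots\otimes V_N^k$ ($d$ factors) and $$\hat{\mathbf V}_N^k=\bigoplus_{\mathbf l\in\mathbb N_0^d,\ |\mathbf l|_1\le N}W_{l_1}^k\otimes\cdots\otimes W_{l_d}^k .$$ Let $P_n^k$, $\mathbf P_N^k$ and $\mathbf P$ be the $L^2$-orthogonal projections onto $V_n^k$, $\mathbf V_N^k$ and $\hat{\mathbf V}_N^k$. Let $$|v|_{H^m(U)}=\Big(\sum_{|\alpha|_1=m}\|\partial^\alpha v\|_{L^2(U)}^2\Big)^{1/2}$$ (the $L^2(U)$ norm if $m=0$), and let $|v|_{H^m(\Omega_N)}$ be the square root of the sum of $|v|_{H^m(I)}^2$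 over all cells $I$ of $\Omega_N$. Let $\mathcal H^{m}(\Omega)$ be the space of functions all of whose weak derivatives $\partial^\alpha v$ with $\alpha_i\le m$ for every $i$ lie in $L^2(\Omega)$, and let $$|v|_{\mathcal H^{m}(\Omega)}=\max_{\emptyset\ne L\subset\{1,\dots,d\}}\Big\|\Big(\prod_{i\in L}\partial_{x_i}^{m}\Big)v\Big\|_{L^2(\Omega)} .$$ **Lemma.** Let $k\ge1$ and $1\le q\le k$. There are constants $c_{k,s,q}>0$ and $\bar{\bar c}_{k,s,q}>0$ ($s=0,1$), depending only on $k,s,q$, such that the following hold for $s=0,1$ and every integer $p\ge q$ (so that $1\le q\le\min\{p,k\}$). 1. For all $v\in H^{p+1}(0,1)$, all $n\ge0$ and every cell $I$ of the $n$-th level grid of $(0,1)$, $$|P_n^kv-v|_{H^s(I)}\le c_{k,s,q}\,2^{-n(q+1-s)}\,|v|_{H^{q+1}(I)}.$$ 2. For all $d\ge2$, $N\ge1$ and $v\in H^{p+1}(\Omega)$, $$|\mathbf P_N^kv-v|_{H^s(\Omega_N)}\le\bar{\bar c}_{k,s,q}\,2^{-N(q+1-s)}\,|v|_{H^{q+1}(\Omega)}.$$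 3. For all $d\ge2$, $N\ge1$ and $v\in\mathcal H^{p+1}(\Omega)$, $$|\mathbf Pv-v|_{H^s(\Omega_N)}\le\Big(\bar{\bar c}_{k,s,q}+B_s(k,q,d)\,\kappa_s(k,q,N)^d\Big)\,2^{-N(q+1-s)}\,|v|_{\mathcal H^{q+1}(\Omega)} .$$ Here $B_s,\kappa_s>0$ are $$\kappa_0=(N+1)C_{k,q},\quad \kappa_1=2C_{k,q},\quad B_0=2^{-(q+1)},\quad B_1=\tfrac12\,d^{3/2}\sqrt{\bar c_{k,q}}\;C_{k,q}^{-2},$$ with $\tilde c_{k,s,q}=c_{k,s,q}\,(1+2^{-(q+1-s)})$, $\hat c_{k,0}=1$, $\hat c_{k,1}=\sqrt{12}\,k^2$, $C_{k,q}=\max(\tilde c_{k,0,q},\hat c_{k,0})$ and $\bar c_{k,q}=\max(\tilde c_{k,1,q}^2\hat c_{k,0}^2,\ \tilde c_{k,0,q}^2\hat c_{k,1}^2)$. Consequently, for every $d\ge2$ there is $K=K(k,q,d)>0$ such that for all $p\ge q$, $v\in\mathcal H^{p+1}(\Omega)$ and $N\ge1$, $$\|\mathbf Pv-v\|_{L^2(\Omega)}\le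 K N^d2^{-N(q+1)}|v|_{\mathcal H^{q+1}(\Omega)}\quad\text{and}\quad |\mathbf Pv-v|_{H^1(\Omega_N)}\le K2^{-Nq}|v|_{\mathcal H^{q+1}(\Omega)} .$$ -/

import Mathlib

open scoped ContDiff ENNReal
open MeasureTheory

noncomputable section

namespace SparseDG

/-! ### Domains and grids -/

/-- The open unit cube `Ω = (0,1)^d`. -/
def cube (d : ℕ) : Set (Fin d → ℝ) := {x | ∀ i, x i ∈ Set.Ioo (0 : ℝ) 1}

/-- The elementary cell with index `j` of the uniform grid `Ω_N` of mesh size `2^{-N}`. -/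
def cell {d : ℕ} (N : ℕ) (j : Fin d → Fin (2 ^ N)) : Set (Fin d → ℝ) :=
  {x | ∀ i, x i ∈ Set.Ioo (((j i : ℕ) : ℝ) / 2 ^ N) ((((j i : ℕ) : ℝ) + 1) / 2 ^ N)}

/-- The Hilbert space `L²(Ω)`. -/
abbrev L2 (d : ℕ) : Type := Lp ℝ 2 (volume.restrict (cube d))

/-! ### Weak derivatives and Sobolev (semi-)norms -/

/-- The classical partial derivative in the `i`-th coordinate direction. -/
def pderiv {d : ℕ} (i : Fin d) (φ : (Fin d → ℝ) → ℝ) : (Fin d → ℝ) → ℝ :=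
  fun x => fderiv ℝ φ x (Pi.single i 1)

/-- The classical mixed derivative `∂^α φ`. -/
def mderiv {d : ℕ} (α : Fin d → ℕ) (φ : (Fin d → ℝ) → ℝ) : (Fin d → ℝ) → ℝ :=
  (List.finRange d).foldr (fun i ψ => (pderiv i)^[α i] ψ) φ

/-- Test functions: `φ ∈ C_c^∞(U)`. -/
def IsTestFunction {d : ℕ} (U : Set (Fin d → ℝ)) (φ : (Fin d → ℝ) → ℝ) : Prop :=
  ContDiff ℝ ∞ φ ∧ HasCompactSupport φ ∧ tsupport φ ⊆ U

/-- `g ∈ L²(U)` is the weak derivative `∂^α v` of `v ∈ L²(U)` on the open set `U`. -/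
def HasWeakDeriv {d : ℕ} (U : Set (Fin d → ℝ)) (α : Fin d → ℕ)
    (v g : (Fin d → ℝ) → ℝ) : Prop :=
  MemLp v 2 (volume.restrict U) ∧ MemLp g 2 (volume.restrict U) ∧
    ∀ φ, IsTestFunction U φ →
      ∫ x in U, v x * mderiv α φ x = (-1) ^ (∑ i, α i) * ∫ x in U, g x * φ x

/-- `‖∂^α v‖_{L²(U)} ∈ [0,∞]`, which is `∞` if `v` has no weak derivative `∂^α v` in `L²(U)`
(the weak derivative is unique almost everywhere, so the infimum is over one value). -/
def derivNorm {d : ℕ} (U : Set (Fin d → ℝ)) (α : Fin d → ℕ) (v : (Fin d → ℝ) → ℝ) : ℝ≥0∞ :=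
  ⨅ (g : (Fin d → ℝ) → ℝ) (_ : HasWeakDeriv U α v g), eLpNorm g 2 (volume.restrict U)

/-- The Sobolev semi-norm `|v|_{H^m(U)} = (∑_{|α|₁ = m} ‖∂^α v‖²_{L²(U)})^{1/2} ∈ [0,∞]`;
for `m = 0` it is the `L²(U)` norm. -/
def sobolevSeminorm {d : ℕ} (U : Set (Fin d → ℝ)) (m : ℕ) (v : (Fin d → ℝ) → ℝ) : ℝ≥0∞ :=
  (∑ α ∈ Finset.piAntidiag (Finset.univ : Finset (Fin d)) m, derivNorm U α v ^ 2) ^ (1 / 2 : ℝ)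

/-- The broken Sobolev semi-norm `|v|_{H^m(Ω_N)}`. -/
def brokenSeminorm {d : ℕ} (N m : ℕ) (v : (Fin d → ℝ) → ℝ) : ℝ≥0∞ :=
  (∑ j : Fin d → Fin (2 ^ N), sobolevSeminorm (cell N j) m v ^ 2) ^ (1 / 2 : ℝ)

/-- `|v|_{ℋ^m(U)}`: the maximum, over all nonempty `L ⊆ {1,…,d}`, of
`‖(∏_{i ∈ L} ∂_i^m) v‖_{L²(U)}`. -/
def mixedSeminorm {d : ℕ} (U : Set (Fin d → ℝ)) (m : ℕ) (v : (Fin d → ℝ) → ℝ) : ℝ≥0∞ :=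
  ⨆ (L : Finset (Fin d)) (_ : L.Nonempty), derivNorm U (fun i => if i ∈ L then m else 0) v

/-- `v ∈ H^m(U)`. -/
def MemSobolev {d : ℕ} (U : Set (Fin d → ℝ)) (m : ℕ) (v : (Fin d → ℝ) → ℝ) : Prop :=
  ∀ α : Fin d → ℕ, ∑ i, α i ≤ m → ∃ g, HasWeakDeriv U α v g

/-- `v ∈ ℋ^m(U)`: all mixed weak derivatives of order at most `m` in each direction
exist in `L²(U)`. -/
def MemMixedSobolev {d : ℕ} (U : Set (Fin d → ℝ)) (m : ℕ) (v : (Fin d → ℝ) → ℝ) : Prop :=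
  ∀ α : Fin d → ℕ, (∀ i, α i ≤ m) → ∃ g, HasWeakDeriv U α v g

/-! ### Piecewise polynomial spaces -/

/-- `V_n^k`: functions on `(0,1]` (extended by `0`) that agree with a polynomial of degree at most
`k` on each cell `(2^{-n} j, 2^{-n}(j+1)]`, `0 ≤ j < 2^n`. -/
def V (k n : ℕ) : Submodule ℝ (ℝ → ℝ) where
  carrier := {f | (∀ x, x ∉ Set.Ioc (0 : ℝ) 1 → f x = 0) ∧
    ∀ j : Fin (2 ^ n), ∃ p : Polynomial ℝ, p.natDegree ≤ k ∧
      ∀ x ∈ Set.Ioc (((j : ℕ) : ℝ) / 2 ^ n) ((((j : ℕ) : ℝ) + 1) / 2 ^ n), f x = p.eval x}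
  zero_mem' := ⟨fun _ _ => rfl, fun _ => ⟨0, by simp, fun _ _ => by simp⟩⟩
  add_mem' := by
    rintro f g ⟨hf0, hf⟩ ⟨hg0, hg⟩
    refine ⟨fun x hx => by simp [hf0 x hx, hg0 x hx], fun j => ?_⟩
    obtain ⟨p, hp, hp'⟩ := hf j
    obtain ⟨r, hr, hr'⟩ := hg j
    exact ⟨p + r, (Polynomial.natDegree_add_le _ _).trans (max_le hp hr),
      fun x hx => by simp [hp' x hx, hr' x hx]⟩
  smul_mem' := by
    rintro a f ⟨hf0, hf⟩
    refine ⟨fun x hx => by simp [hf0 x hx], fun j => ?_⟩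
    obtain ⟨p, hp, hp'⟩ := hf j
    exact ⟨a • p, (Polynomial.natDegree_smul_le _ _).trans hp, fun x hx => by simp [hp' x hx]⟩

/-- The multiwavelet space `W_n^k`: `W_0^k = V_0^k`, and `W_{n+1}^k` is the `L²(0,1)`-orthogonal
complement of `V_n^k` in `V_{n+1}^k`. -/
def W (k : ℕ) : ℕ → Set (ℝ → ℝ)
  | 0 => {f | f ∈ V k 0}
  | n + 1 => {f | f ∈ V k (n + 1) ∧ ∀ g ∈ V k n, ∫ x in Set.Ioc (0 : ℝ) 1, f x * g x = 0}

/-- The tensor product of one-dimensional spaces `A i`: the linear span of the products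
`x ↦ ∏ i, f i (x i)` with `f i ∈ A i`. -/
def tensorSpace {d : ℕ} (A : Fin d → Set (ℝ → ℝ)) : Submodule ℝ ((Fin d → ℝ) → ℝ) :=
  Submodule.span ℝ {F | ∃ f : Fin d → ℝ → ℝ, (∀ i, f i ∈ A i) ∧ F = fun x => ∏ i, f i (x i)}

/-- The full tensor-product space of piecewise polynomials on `Ω_N` of degree at most `k` in
each variable. -/
def fullSpace (d k N : ℕ) : Submodule ℝ ((Fin d → ℝ) → ℝ) :=
  tensorSpace fun _ => {f | f ∈ V k N}

/-- The sparse space: the sum of the increment spaces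
`W_{l_1}^k ⊗ ⋯ ⊗ W_{l_d}^k` over all `l ∈ ℕ^d` with `|l|₁ ≤ N`. -/
def sparseSpace (d k N : ℕ) : Submodule ℝ ((Fin d → ℝ) → ℝ) :=
  ⨆ l ∈ {l : Fin d → ℕ | ∑ i, l i ≤ N}, tensorSpace fun i => W k (l i)

/-- The subspace of `L²(Ω)` of the classes of functions in `S`. -/
def toL2 {d : ℕ} (S : Submodule ℝ ((Fin d → ℝ) → ℝ)) : Submodule ℝ (L2 d) where
  carrier := {f | ∃ g ∈ S, f =ᵐ[volume.restrict (cube d)] g}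
  zero_mem' := ⟨0, S.zero_mem, Lp.coeFn_zero _ _ _⟩
  add_mem' := by
    rintro f g ⟨f', hf', hf⟩ ⟨g', hg', hg⟩
    exact ⟨f' + g', S.add_mem hf' hg', (Lp.coeFn_add f g).trans (hf.add hg)⟩
  smul_mem' := by
    rintro a f ⟨f', hf', hf⟩
    exact ⟨a • f', S.smul_mem a hf', (Lp.coeFn_smul a f).trans (hf.const_smul a)⟩

/-! ### Finite-dimensionality, so that the `L²` projections exist -/

theorem exists_cell (n : ℕ) {x : ℝ} (hx : x ∈ Set.Ioc (0 : ℝ) 1) :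
    ∃ j : Fin (2 ^ n),
      x ∈ Set.Ioc (((j : ℕ) : ℝ) / 2 ^ n) ((((j : ℕ) : ℝ) + 1) / 2 ^ n) := by
  have h2 : (0 : ℝ) < 2 ^ n := by positivity
  have hpos : 0 < ⌈x * 2 ^ n⌉₊ := Nat.ceil_pos.2 (mul_pos hx.1 h2)
  have hle : ⌈x * 2 ^ n⌉₊ ≤ 2 ^ n := by
    apply Nat.ceil_le.2
    push_cast
    nlinarith [hx.2]
  obtain ⟨m, hm⟩ := Nat.exists_eq_succ_of_ne_zero hpos.ne'
  refine ⟨⟨m, by omega⟩, ?_, ?_⟩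
  · rw [div_lt_iff₀ h2]
    exact Nat.lt_ceil.1 (hm ▸ Nat.lt_succ_self m)
  · rw [le_div_iff₀ h2]
    have := Nat.le_ceil (x * 2 ^ n)
    rw [hm] at this
    exact_mod_cast this

instance finite_V (k n : ℕ) : Module.Finite ℝ (V k n) := by
  classical
  let b : Fin (2 ^ n) × Fin (k + 1) → ℝ → ℝ := fun a =>
    Set.indicator (Set.Ioc (((a.1 : ℕ) : ℝ) / 2 ^ n) ((((a.1 : ℕ) : ℝ) + 1) / 2 ^ n))
      (fun x => x ^ (a.2 : ℕ))
  have hle : V k n ≤ Submodule.span ℝ (Set.range b) := by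
    rintro f ⟨hf0, hf⟩
    choose p hp hpf using hf
    have hsum : f = ∑ j : Fin (2 ^ n), ∑ i : Fin (k + 1), (p j).coeff i • b (j, i) := by
      funext x
      simp only [Finset.sum_apply, Pi.smul_apply, smul_eq_mul]
      have h2 : (0 : ℝ) < 2 ^ n := by positivity
      by_cases hx : x ∈ Set.Ioc (0 : ℝ) 1
      · obtain ⟨j, hj⟩ := exists_cell n hx
        rw [Finset.sum_eq_single j]
        · rw [hpf j x hj, Polynomial.eval_eq_sum_range' (Nat.lt_succ_of_le (hp j)),
            Finset.sum_range]
          exact Finset.sum_congr rfl fun i _ => by simp only [b]; rw [Set.indicator_of_mem hj]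
        · intro j' _ hne
          refine Finset.sum_eq_zero fun i _ => ?_
          have : x ∉ Set.Ioc (((j' : ℕ) : ℝ) / 2 ^ n) ((((j' : ℕ) : ℝ) + 1) / 2 ^ n) := by
            intro hj'
            apply hne
            rw [Set.mem_Ioc, div_lt_iff₀ h2, le_div_iff₀ h2] at hj hj'
            have h1 : ((j' : ℕ) : ℝ) < (j : ℕ) + 1 := by linarith
            have h3 : ((j : ℕ) : ℝ) < (j' : ℕ) + 1 := by linarith
            have h1' : (j' : ℕ) < (j : ℕ) + 1 := by exact_mod_cast h1
            have h3' : (j : ℕ) < (j' : ℕ) + 1 := by exact_mod_cast h3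
            exact Fin.ext (by omega)
          simp only [b]
          rw [Set.indicator_of_notMem this, mul_zero]
        · simp
      · rw [hf0 x hx]
        symm
        refine Finset.sum_eq_zero fun j _ => Finset.sum_eq_zero fun i _ => ?_
        have : x ∉ Set.Ioc (((j : ℕ) : ℝ) / 2 ^ n) ((((j : ℕ) : ℝ) + 1) / 2 ^ n) := by
          intro hj
          apply hx
          rw [Set.mem_Ioc, div_lt_iff₀ h2, le_div_iff₀ h2] at hj
          have hj0 : (0 : ℝ) ≤ (j : ℕ) := Nat.cast_nonneg _
          have hj1 : ((j : ℕ) : ℝ) + 1 ≤ 2 ^ n := by exact_mod_cast j.2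
          exact ⟨by nlinarith, by nlinarith⟩
        simp only [b]
        rw [Set.indicator_of_notMem this, mul_zero]
    rw [hsum]
    exact Submodule.sum_mem _ fun j _ => Submodule.sum_mem _ fun i _ =>
      Submodule.smul_mem _ _ (Submodule.subset_span ⟨(j, i), rfl⟩)
  have : Module.Finite ℝ (Submodule.span ℝ (Set.range b)) :=
    Module.Finite.span_of_finite ℝ (Set.finite_range b)
  exact Submodule.finiteDimensional_of_le hle

theorem finite_tensorSpace {d : ℕ} (A : Fin d → Set (ℝ → ℝ)) (k : ℕ) (l : Fin d → ℕ)
    (hA : ∀ i, A i ⊆ {f | f ∈ V k (l i)}) : Module.Finite ℝ (tensorSpace A) := by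
  let M : MultilinearMap ℝ (fun i : Fin d => V k (l i)) ((Fin d → ℝ) → ℝ) :=
    (MultilinearMap.mkPiAlgebra ℝ (Fin d) ((Fin d → ℝ) → ℝ)).compLinearMap
      (fun i => (LinearMap.funLeft ℝ ℝ (fun x : Fin d → ℝ => x i)) ∘ₗ (V k (l i)).subtype)
  have hle : tensorSpace A ≤ LinearMap.range (PiTensorProduct.lift M) := by
    refine Submodule.span_le.2 ?_
    rintro F ⟨f, hf, rfl⟩
    refine ⟨PiTensorProduct.tprod ℝ fun i => ⟨f i, hA i (hf i)⟩, ?_⟩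
    rw [PiTensorProduct.lift.tprod]
    funext x
    simp [M, LinearMap.funLeft_apply]
  exact Submodule.finiteDimensional_of_le hle

theorem W_subset_V (k n : ℕ) : W k n ⊆ {f | f ∈ V k n} := by
  cases n with
  | zero => exact fun f hf => hf
  | succ n => exact fun f hf => hf.1

instance finite_fullSpace (d k N : ℕ) : Module.Finite ℝ (fullSpace d k N) :=
  finite_tensorSpace _ k (fun _ => N) fun _ => subset_rfl

instance finite_sparseSpace (d k N : ℕ) : Module.Finite ℝ (sparseSpace d k N) := by
  have hfin : Finite {l : Fin d → ℕ // l ∈ {l : Fin d → ℕ | ∑ i, l i ≤ N}} := by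
    refine Set.Finite.subset (Set.finite_Iic (fun _ : Fin d => N)) fun l hl i => ?_
    exact (Finset.single_le_sum (fun j _ => Nat.zero_le (l j)) (Finset.mem_univ i)).trans hl
  have hW : ∀ l : {l : Fin d → ℕ // l ∈ {l : Fin d → ℕ | ∑ i, l i ≤ N}},
      Module.Finite ℝ (tensorSpace fun i => W k (l.1 i)) := fun l =>
    finite_tensorSpace _ k l.1 fun i => W_subset_V k _
  rw [sparseSpace, iSup_subtype']
  exact Submodule.finite_iSup _

instance finite_toL2 {d : ℕ} (S : Submodule ℝ ((Fin d → ℝ) → ℝ)) [Module.Finite ℝ S] :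
    FiniteDimensional ℝ (toL2 S) := by
  let T : Submodule ℝ S :=
    { carrier := {g | MemLp (g : (Fin d → ℝ) → ℝ) 2 (volume.restrict (cube d))}
      zero_mem' := MemLp.zero
      add_mem' := fun hf hg => MemLp.add hf hg
      smul_mem' := fun a _ hf => MemLp.const_smul hf a }
  let Φ : T →ₗ[ℝ] L2 d :=
    { toFun := fun g => MemLp.toLp _ g.2
      map_add' := fun _ _ => rfl
      map_smul' := fun _ _ => rfl }
  have hle : toL2 S ≤ LinearMap.range Φ := by
    rintro f ⟨g, hg, hfg⟩
    have hg2 : MemLp g 2 (volume.restrict (cube d)) := (memLp_congr_ae hfg).1 (Lp.memLp f)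
    exact ⟨⟨⟨g, hg⟩, hg2⟩, Lp.ext ((MemLp.coeFn_toLp hg2).trans hfg.symm)⟩
  exact Submodule.finiteDimensional_of_le hle

/-! ### The `L²` projections -/

/-- The `L²(Ω)`-orthogonal projection `𝐏_N^k` onto the full space on `Ω_N`
(for `d = 1` this is the projection `P_N^k` onto `V_N^k`). -/
def fullProj (d k N : ℕ) : L2 d →L[ℝ] L2 d := (toL2 (fullSpace d k N)).starProjection

/-- The `L²(Ω)`-orthogonal projection `𝐏` onto the sparse space. -/
def sparseProj (d k N : ℕ) : L2 d →L[ℝ] L2 d := (toL2 (sparseSpace d k N)).starProjection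

/-! ### The constants -/

/-- `c̃_{k,s,q} = c_{k,s,q} (1 + 2^{-(q+1-s)})`; here `c s` stands for `c_{k,s,q}`. -/
def cTilde (c : ℕ → ℝ) (q s : ℕ) : ℝ := c s * (1 + (2 : ℝ) ^ (-((q : ℤ) + 1 - s)))

/-- `ĉ_{k,0} = 1` and `ĉ_{k,1} = √12 k²`. -/
def cHat (k s : ℕ) : ℝ := if s = 0 then 1 else √12 * (k : ℝ) ^ 2

/-- `C_{k,q} = max(c̃_{k,0,q}, ĉ_{k,0})`. -/
def bigC (c : ℕ → ℝ) (k q : ℕ) : ℝ := max (cTilde c q 0) (cHat k 0)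

/-- `c̄_{k,q} = max(c̃_{k,1,q}² ĉ_{k,0}², c̃_{k,0,q}² ĉ_{k,1}²)`. -/
def cBar (c : ℕ → ℝ) (k q : ℕ) : ℝ :=
  max (cTilde c q 1 ^ 2 * cHat k 0 ^ 2) (cTilde c q 0 ^ 2 * cHat k 1 ^ 2)

/-- `κ_0 = (N+1) C_{k,q}` and `κ_1 = 2 C_{k,q}`. -/
def kappa (c : ℕ → ℝ) (k q N s : ℕ) : ℝ :=
  if s = 0 then ((N : ℝ) + 1) * bigC c k q else 2 * bigC c k q

/-- `B_0 = 2^{-(q+1)}` and `B_1 = d^{3/2} √c̄_{k,q} C_{k,q}^{-2} / 2`. -/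
def B (c : ℕ → ℝ) (k q d s : ℕ) : ℝ :=
  if s = 0 then (2 : ℝ) ^ (-((q : ℤ) + 1))
  else (d : ℝ) ^ (3 / 2 : ℝ) * √(cBar c k q) * bigC c k q ^ (-2 : ℤ) / 2

/-- The rate `2^{-n(q+1-s)}`. -/
def rate (n q s : ℕ) : ℝ := (2 : ℝ) ^ (-((n : ℤ) * ((q : ℤ) + 1 - s)))

end SparseDG

end

/-!
All estimates are identities between bounded operators on `L²(0,1)`, carried over to `L²(Ω)` by
letting an operator act on one variable. Since `L²(Ω)` is, for every coordinate `i`, a Hilbert sum of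
copies of `L²(0,1)` spanned by product functions (`isHilbertSum_slot`), an operator `A` on `L²(0,1)`
has a copy `lift i A` of at most the same norm, and tuples of operators have a tensor product `tmap`.
The full projection is `tmap` of the piecewise polynomial projections `P_N` (`fullProj_eq`), the
sparse one is the sum over `|l|₁ ≤ N` of `tmap` of the differences `P_{l_i} - P_{l_i - 1}`
(`sparseProj_eq`); the two differ by the terms with `|l|₁ > N` and `l_i ≤ N`.

*Representation of the error.* In one variable, `(1 - P_n) f` is orthogonal to the piecewise
polynomials of degree less than `a ≤ k + 1`, so by the lemma of du Bois-Reymond it is, in the closed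
graph sense, the `a`-th derivative of a limit of test functions (`errPrim_mem_testGraph`). Testing a
weak derivative `∂^α v` against products of such functions moves the derivatives onto `v`:
`tmap_one_sub_pwProj` expresses the projection error of `v` in all variables with `α_i ≠ 0` as a
tensor product of operators of norm at most `2^{-n_i α_i}`, applied to `∂^α v`. No approximation of
`v` by smooth functions is needed.

*Derivatives.* On each cell the one-dimensional operators that occur map smooth functions to smooth
functions, so their derivatives are bounded operators as well, and `hasWeakDeriv_lift` turns this
into weak derivatives on the cells of `Ω_N`. Differentiating the projection costs a factor
`‖polDeriv k‖ 2^n`.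

*Full space.* By orthogonality, `‖v - 𝐏_N v‖²` is at most the sum of the squared one-dimensional
errors (`norm_sub_partialProj_sq_le`), which gives a constant independent of `d`. For `∂_j`, the
error in the variables other than `x_j` is first freed from its piecewise mean in `x_j`, which the
derivative does not see; this gains a factor `2^{-N}`, so that the inverse estimate costs nothing, and
only derivatives of the orders `(q + 1) e_j` and `e_j + q e_i` appear.

*Sparse space.* An increment of level `l` has norm at most a constant times `2^{-(q+1)|l|₁}` times the
mixed semi-norm (`HasMixedBound.norm_tmap_pwDiff_le`). There are at most `(N + 1)^d` missing levels,
which gives the case `s = 0`; for `s = 1` the derivative in `x_j` costs `2^{l_j}`, and the sum over the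
missing levels converges without a power of `N` (`sum_levels_le`).
-/


open scoped ContDiff ENNReal
open MeasureTheory

noncomputable section

namespace SparseDG

/-! ### Product functions and operators acting on a single coordinate -/

/-- Lebesgue measure on the open unit interval. -/
abbrev unitMeasure : Measure ℝ := volume.restrict (Set.Ioo (0 : ℝ) 1)

/-- The Hilbert space `L²(0,1)`. -/
abbrev H : Type := Lp ℝ 2 unitMeasure

instance : IsProbabilityMeasure unitMeasure := ⟨by simp⟩

theorem restrict_cube (d : ℕ) :
    (volume.restrict (cube d) : Measure (Fin d → ℝ)) = Measure.pi fun _ => unitMeasure := by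
  have : cube d = Set.pi Set.univ fun _ => Set.Ioo (0 : ℝ) 1 := by
    ext x; simp [cube]
  rw [this, volume_pi, Measure.restrict_pi_pi]

instance (d : ℕ) : IsProbabilityMeasure (volume.restrict (cube d) : Measure (Fin d → ℝ)) := by
  rw [restrict_cube]; infer_instance

theorem memLp_prod {d : ℕ} {f : Fin d → ℝ → ℝ} (hf : ∀ i, MemLp (f i) 2 unitMeasure) :
    MemLp (fun x : Fin d → ℝ => ∏ i, f i (x i)) 2 (volume.restrict (cube d)) := by
  rw [restrict_cube]
  have hm : AEStronglyMeasurable (fun x : Fin d → ℝ => ∏ i, f i (x i))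
      (Measure.pi fun _ => unitMeasure) :=
    Finset.aestronglyMeasurable_fun_prod _ fun i _ =>
      (hf i).1.comp_quasiMeasurePreserving
        (Measure.quasiMeasurePreserving_eval (fun _ : Fin d => unitMeasure) i)
  rw [memLp_two_iff_integrable_sq hm]
  simp_rw [← Finset.prod_pow]
  exact Integrable.fintype_prod fun i => (memLp_two_iff_integrable_sq (hf i).1).1 (hf i)

theorem prod_ae_eq {d : ℕ} {f g : Fin d → ℝ → ℝ} (h : ∀ i, f i =ᵐ[unitMeasure] g i) :
    (fun x : Fin d → ℝ => ∏ i, f i (x i)) =ᵐ[volume.restrict (cube d)]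
      fun x => ∏ i, g i (x i) := by
  rw [restrict_cube]
  have : ∀ i, ∀ᵐ x : Fin d → ℝ ∂(Measure.pi fun _ => unitMeasure), f i (x i) = g i (x i) := fun i =>
    (Measure.quasiMeasurePreserving_eval (fun _ : Fin d => unitMeasure) i).ae (h i)
  filter_upwards [ae_all_iff.2 this] with x hx
  exact Finset.prod_congr rfl fun i _ => hx i

/-- The class in `L²(Ω)` of the product function `x ↦ ∏ i, f i (x i)`. -/
def tens {d : ℕ} (f : Fin d → H) : L2 d :=
  MemLp.toLp (fun x => ∏ i, f i (x i)) (memLp_prod fun i => Lp.memLp (f i))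

theorem tens_ae {d : ℕ} (f : Fin d → H) {g : Fin d → ℝ → ℝ} (h : ∀ i, f i =ᵐ[unitMeasure] g i) :
    tens f =ᵐ[volume.restrict (cube d)] fun x => ∏ i, g i (x i) :=
  (MemLp.coeFn_toLp _).trans (prod_ae_eq h)

theorem inner_tens {d : ℕ} (f g : Fin d → H) :
    inner ℝ (tens f) (tens g) = ∏ i, inner ℝ (f i) (g i) := by
  have h : ∀ i, inner ℝ (f i) (g i) = ∫ x, f i x * g i x ∂unitMeasure := fun i => by
    rw [L2.inner_def]; exact integral_congr_ae (ae_of_all _ fun x => by simp [mul_comm])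
  simp_rw [h]
  rw [← integral_fintype_prod_eq_prod (fun i x => f i x * g i x), ← restrict_cube, L2.inner_def]
  apply integral_congr_ae
  filter_upwards [tens_ae f fun i => ae_eq_rfl, tens_ae g fun i => ae_eq_rfl] with x h1 h2
  simp [h1, h2, Finset.prod_mul_distrib, mul_comm]

theorem norm_tens {d : ℕ} (f : Fin d → H) : ‖tens f‖ = ∏ i, ‖f i‖ := by
  have h : ‖tens f‖ ^ 2 = (∏ i, ‖f i‖) ^ 2 := by
    rw [← real_inner_self_eq_norm_sq, inner_tens, ← Finset.prod_pow]
    exact Finset.prod_congr rfl fun i _ => real_inner_self_eq_norm_sq _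
  exact (pow_left_inj₀ (norm_nonneg _) (Finset.prod_nonneg fun _ _ => norm_nonneg _)
    two_ne_zero).1 h

/-- Product functions are total in `L²(Ω)`: the integrals over boxes determine a function. -/
theorem eq_zero_of_inner_tens {d : ℕ} {u : L2 d} (h : ∀ f, inner ℝ (tens f) u = 0) : u = 0 := by
  have hu : Integrable u (volume.restrict (cube d)) := (Lp.memLp u).integrable one_le_two
  have hbox : ∀ s : Fin d → Set ℝ, (∀ i, MeasurableSet (s i)) →
      ∫ x in Set.pi Set.univ s, u x ∂(volume.restrict (cube d)) = 0 := by
    intro s hs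
    have h1 := h fun i => indicatorConstLp 2 (hs i) (measure_ne_top _ _) (1 : ℝ)
    rw [L2.inner_def] at h1
    rw [← integral_indicator (MeasurableSet.univ_pi hs), ← h1]
    apply integral_congr_ae
    filter_upwards [tens_ae _ fun i => indicatorConstLp_coeFn (hs := hs i)
      (hμs := measure_ne_top unitMeasure _) (c := (1 : ℝ))] with x hx
    rw [hx]
    by_cases hxs : x ∈ Set.pi Set.univ s
    · rw [Set.indicator_of_mem hxs]
      have : ∀ i, (s i).indicator (fun _ => (1 : ℝ)) (x i) = 1 := fun i =>
        Set.indicator_of_mem (hxs i (Set.mem_univ i)) _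
      simp [this]
    · rw [Set.indicator_of_notMem hxs]
      obtain ⟨i, hi⟩ : ∃ i, x i ∉ s i := by simpa [Set.mem_pi] using hxs
      rw [Finset.prod_eq_zero (Finset.mem_univ i) (Set.indicator_of_notMem hi _)]
      simp
  have hall : ∀ s, MeasurableSet s → ∫ x in s, u x ∂(volume.restrict (cube d)) = 0 := by
    refine MeasurableSpace.induction_on_inter
      (C := fun s _ => ∫ x in s, u x ∂(volume.restrict (cube d)) = 0)
      generateFrom_pi.symm isPiSystem_pi ?_ ?_ ?_ ?_
    · simp
    · rintro _ ⟨s, hs, rfl⟩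
      exact hbox s fun i => hs i (Set.mem_univ i)
    · intro t ht iht
      have huniv : ∫ x, u x ∂(volume.restrict (cube d)) = 0 := by
        have := hbox (fun _ => Set.univ) fun _ => MeasurableSet.univ
        rwa [Set.pi_univ, Measure.restrict_univ] at this
      have := integral_add_compl ht hu
      rwa [iht, huniv, zero_add] at this
    · intro f hd hm ih
      rw [integral_iUnion hm hd hu.integrableOn]
      simp [ih]
  have := hu.ae_eq_zero_of_forall_setIntegral_eq_zero fun s hs _ => hall s hs
  exact Lp.ext (this.trans (Lp.coeFn_zero _ _ _).symm)

theorem ext_inner_tens {d : ℕ} {u w : L2 d}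
    (h : ∀ f, inner ℝ (tens f) u = inner ℝ (tens f) w) : u = w :=
  sub_eq_zero.1 (eq_zero_of_inner_tens fun f => by rw [inner_sub_right, h, sub_self])

/-- The map `tens`, as a continuous multilinear map. -/
def tensM (d : ℕ) : ContinuousMultilinearMap ℝ (fun _ : Fin d => H) (L2 d) :=
  MultilinearMap.mkContinuous
    { toFun := tens
      map_update_add' := by
        intro inst f i a b
        obtain rfl := Subsingleton.elim inst (instDecidableEqFin d)
        refine ext_inner_tens fun g => ?_
        simp only [inner_add_right, inner_tens]
        have := ((MultilinearMap.mkPiAlgebra ℝ (Fin d) ℝ).compLinearMap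
          fun j => (innerSL ℝ (g j)).toLinearMap).map_update_add f i a b
        simpa only [MultilinearMap.compLinearMap_apply, MultilinearMap.mkPiAlgebra_apply,
          ContinuousLinearMap.coe_coe, innerSL_apply_apply] using this
      map_update_smul' := by
        intro inst f i c a
        obtain rfl := Subsingleton.elim inst (instDecidableEqFin d)
        refine ext_inner_tens fun g => ?_
        simp only [inner_smul_right, inner_tens]
        have := ((MultilinearMap.mkPiAlgebra ℝ (Fin d) ℝ).compLinearMap
          fun j => (innerSL ℝ (g j)).toLinearMap).map_update_smul f i c a
        simpa only [smul_eq_mul, MultilinearMap.compLinearMap_apply, MultilinearMap.mkPiAlgebra_apply,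
          ContinuousLinearMap.coe_coe, innerSL_apply_apply] using this }
    1 fun f => by rw [one_mul]; exact (norm_tens f).le

theorem continuous_tens (d : ℕ) : Continuous (tens : (Fin d → H) → L2 d) := (tensM d).cont

theorem dense_span_tens (d : ℕ) :
    (Submodule.span ℝ (Set.range (tens : (Fin d → H) → L2 d))).topologicalClosure = ⊤ := by
  rw [Submodule.topologicalClosure_eq_top_iff, Submodule.eq_bot_iff]
  intro u hu
  exact eq_zero_of_inner_tens fun f => hu _ (Submodule.subset_span ⟨f, rfl⟩)

theorem clm_ext_tens {d : ℕ} {E : Type*} [NormedAddCommGroup E] [NormedSpace ℝ E]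
    {A A' : L2 d →L[ℝ] E} (h : ∀ f, A (tens f) = A' (tens f)) : A = A' :=
  ContinuousLinearMap.ext_on (s := Set.range tens)
    (by rw [dense_iff_closure_eq, ← Submodule.topologicalClosure_coe, dense_span_tens]; rfl)
    (by rintro _ ⟨f, rfl⟩; exact h f)

/-- Two continuous multilinear maps agree if they agree on tuples that are taken, outside the
coordinates in `s`, from a total set. -/
theorem multilinear_eq_of_total {d : ℕ} {E : Type*} [NormedAddCommGroup E] [NormedSpace ℝ E]
    (M M' : ContinuousMultilinearMap ℝ (fun _ : Fin d => H) E) (D : Set H)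
    (hD : Dense (Submodule.span ℝ D : Set H)) (s : Finset (Fin d))
    (h : ∀ f : Fin d → H, (∀ i ∉ s, f i ∈ D) → M f = M' f) : M = M' := by
  -- The coordinates in which an arbitrary entry is allowed are enlarged one at a time.
  suffices hs : ∀ t : Finset (Fin d), ∀ f : Fin d → H, (∀ i ∉ s ∪ t, f i ∈ D) → M f = M' f from
    ContinuousMultilinearMap.ext fun f => hs Finset.univ f (by simp)
  intro t
  induction t using Finset.induction_on with
  | empty => simpa using h
  | insert a t ha ih =>
    intro f hf
    have h1 : M.toContinuousLinearMap f a = M'.toContinuousLinearMap f a := by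
      refine ContinuousLinearMap.ext_on (s := D) hD fun x hx => ?_
      refine ih _ fun i hi => ?_
      rcases eq_or_ne i a with rfl | hia
      · simpa using hx
      · rw [Function.update_of_ne hia]
        exact hf i (by simp_all)
    simpa using congrArg (fun φ => φ (f a)) h1

theorem exists_hilbertBasis_H : ∃ (w : Set H) (b : HilbertBasis w ℝ H), ⇑b = ((↑) : w → H) :=
  exists_hilbertBasis ℝ H

/-- The index set of a Hilbert basis of `L²(0,1)`. -/
def basisSet : Set H := exists_hilbertBasis_H.choose

theorem orthonormal_basisSet : Orthonormal ℝ ((↑) : basisSet → H) := by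
  obtain ⟨b, hb⟩ := exists_hilbertBasis_H.choose_spec
  exact hb ▸ b.orthonormal

theorem dense_span_basisSet : Dense (Submodule.span ℝ basisSet : Set H) := by
  obtain ⟨b, hb⟩ := exists_hilbertBasis_H.choose_spec
  have := b.dense_span
  rw [hb, Subtype.range_coe] at this
  rwa [dense_iff_closure_eq, ← Submodule.topologicalClosure_coe, ← Submodule.top_coe (R := ℝ),
    SetLike.coe_set_eq]

/-- The tuple with `f` in the `i`-th place and the basis vectors `b` elsewhere. -/
def slot {d : ℕ} (i : Fin d) (b : {j // j ≠ i} → basisSet) (f : H) : Fin d → H :=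
  Function.update (fun j => if h : j ≠ i then (b ⟨j, h⟩ : H) else 0) i f

theorem slot_self {d : ℕ} (i : Fin d) (b : {j // j ≠ i} → basisSet) (f : H) :
    slot i b f i = f := by simp [slot]

theorem slot_of_ne {d : ℕ} (i : Fin d) (b : {j // j ≠ i} → basisSet) (f : H) {j : Fin d}
    (h : j ≠ i) : slot i b f j = b ⟨j, h⟩ := by simp [slot, h]

/-- The isometric copy of `L²(0,1)` in `L²(Ω)` obtained by filling all places but the `i`-th
by basis vectors. -/
def slotIsometry {d : ℕ} (i : Fin d) (b : {j // j ≠ i} → basisSet) : H →ₗᵢ[ℝ] L2 d where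
  toLinearMap := ((tensM d).toContinuousLinearMap
    (fun j => if h : j ≠ i then (b ⟨j, h⟩ : H) else 0) i).toLinearMap
  norm_map' f := by
    change ‖tens (slot i b f)‖ = ‖f‖
    rw [norm_tens, Finset.prod_eq_single i, slot_self]
    · intro j _ hj
      rw [slot_of_ne i b f hj]
      exact orthonormal_basisSet.1 _
    · simp

theorem slotIsometry_apply {d : ℕ} (i : Fin d) (b : {j // j ≠ i} → basisSet) (f : H) :
    slotIsometry i b f = tens (slot i b f) := rfl

/-- `L²(Ω)` is the Hilbert sum of copies of `L²(0,1)` placed in the `i`-th coordinate. -/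
theorem isHilbertSum_slot {d : ℕ} (i : Fin d) :
    IsHilbertSum ℝ (fun _ : {j // j ≠ i} → basisSet => H) (slotIsometry i) := by
  refine IsHilbertSum.mk ?_ ?_
  · intro b b' hbb' v w
    obtain ⟨j, hj⟩ := Function.ne_iff.1 hbb'
    rw [slotIsometry_apply, slotIsometry_apply, inner_tens]
    refine Finset.prod_eq_zero (Finset.mem_univ j.1) ?_
    rw [slot_of_ne _ _ _ j.2, slot_of_ne _ _ _ j.2]
    exact orthonormal_basisSet.2 hj
  · rw [top_le_iff, Submodule.topologicalClosure_eq_top_iff, Submodule.eq_bot_iff]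
    intro u hu
    refine eq_zero_of_inner_tens fun f => ?_
    have h := multilinear_eq_of_total ((innerSL ℝ u).compContinuousMultilinearMap (tensM d)) 0
      basisSet dense_span_basisSet {i} fun f hf => ?_
    · have := congrArg (fun M => M f) h
      rw [real_inner_comm]
      exact this
    · let b : {j // j ≠ i} → basisSet := fun j => ⟨f j, hf j (by simpa using j.2)⟩
      have hfb : f = slot i b (f i) := by
        funext j
        rcases eq_or_ne j i with rfl | hj
        · rw [slot_self]
        · rw [slot_of_ne _ _ _ hj]
      have := hu (slotIsometry i b (f i))
        (Submodule.mem_iSup_of_mem b (LinearMap.mem_range_self _ _))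
      rw [slotIsometry_apply, ← hfb, real_inner_comm] at this
      exact this

/-- The diagonal operator on an `ℓ²` sum of copies of `E` given by an operator on `E`. -/
def lpDiag {ι E : Type*} [NormedAddCommGroup E] [NormedSpace ℝ E] (A : E →L[ℝ] E) :
    lp (fun _ : ι => E) 2 →L[ℝ] lp (fun _ : ι => E) 2 :=
  LinearMap.mkContinuous
    { toFun := fun u => ⟨fun b => A (u b), by
        refine (memℓp_gen_iff (by norm_num)).2 ?_
        refine Summable.of_nonneg_of_le (fun _ => by positivity) (fun b => ?_)
          (((lp.memℓp u).summable (by norm_num)).mul_left (‖A‖ ^ (2 : ℝ≥0∞).toReal))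
        rw [← Real.mul_rpow (norm_nonneg _) (norm_nonneg _)]
        exact Real.rpow_le_rpow (norm_nonneg _) (A.le_opNorm _) (by norm_num)⟩
      map_add' := fun u v => by ext b; exact map_add A (u b) (v b)
      map_smul' := fun c u => by ext b; exact map_smul A c (u b) }
    ‖A‖ fun u => by
      refine lp.norm_le_of_forall_sum_le (by norm_num) (by positivity) fun s => ?_
      rw [Real.mul_rpow (norm_nonneg _) (norm_nonneg _)]
      refine le_trans ?_ (mul_le_mul_of_nonneg_left
        (lp.sum_rpow_le_norm_rpow (by norm_num) u s) (by positivity))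
      rw [Finset.mul_sum]
      refine Finset.sum_le_sum fun b _ => ?_
      rw [← Real.mul_rpow (norm_nonneg _) (norm_nonneg _)]
      exact Real.rpow_le_rpow (norm_nonneg _) (A.le_opNorm _) (by norm_num)

theorem lpDiag_apply {ι E : Type*} [NormedAddCommGroup E] [NormedSpace ℝ E] (A : E →L[ℝ] E)
    (u : lp (fun _ : ι => E) 2) (b : ι) : lpDiag A u b = A (u b) := rfl

theorem norm_lpDiag_le {ι E : Type*} [NormedAddCommGroup E] [NormedSpace ℝ E] (A : E →L[ℝ] E) :
    ‖(lpDiag A : lp (fun _ : ι => E) 2 →L[ℝ] lp (fun _ : ι => E) 2)‖ ≤ ‖A‖ :=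
  LinearMap.mkContinuous_norm_le _ (norm_nonneg _) _

/-- The operator `A` on `L²(0,1)`, acting on the `i`-th variable of a function in `L²(Ω)`: it acts
as `A` on each of the copies of `L²(0,1)` in the Hilbert sum `isHilbertSum_slot`. -/
def lift {d : ℕ} (i : Fin d) (A : H →L[ℝ] H) : L2 d →L[ℝ] L2 d :=
  let e := (isHilbertSum_slot i).linearIsometryEquiv
  (e.symm : lp (fun _ : {j // j ≠ i} → basisSet => H) 2 →L[ℝ] L2 d) ∘L lpDiag A ∘L
    (e : L2 d →L[ℝ] lp (fun _ : {j // j ≠ i} → basisSet => H) 2)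

theorem norm_lift_le {d : ℕ} (i : Fin d) (A : H →L[ℝ] H) : ‖lift i A‖ ≤ ‖A‖ := by
  refine ContinuousLinearMap.opNorm_le_bound _ (norm_nonneg _) fun u => ?_
  simp only [lift, ContinuousLinearMap.comp_apply]
  refine ((LinearIsometryEquiv.norm_map _ _).le.trans
    ((lpDiag A).le_of_opNorm_le (norm_lpDiag_le A) _)).trans (le_of_eq ?_)
  congr 1
  exact LinearIsometryEquiv.norm_map _ _

theorem lift_tens {d : ℕ} (i : Fin d) (A : H →L[ℝ] H) (f : Fin d → H) :
    lift i A (tens f) = tens (Function.update f i (A (f i))) := by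
  let c : (j : Fin d) → H →L[ℝ] H := fun j => if j = i then A else ContinuousLinearMap.id ℝ H
  have hc : ∀ f : Fin d → H, (fun j => c j (f j)) = Function.update f i (A (f i)) := by
    intro f
    funext j
    rcases eq_or_ne j i with rfl | hj
    · simp [c]
    · simp [c, hj]
  have h := multilinear_eq_of_total ((lift i A).compContinuousMultilinearMap (tensM d))
    ((tensM d).compContinuousLinearMap c) basisSet dense_span_basisSet {i} fun f hf => ?_
  · have := congrArg (fun M => M f) h
    rw [← hc]
    exact this
  · let b : {j // j ≠ i} → basisSet := fun j => ⟨f j, hf j (by simpa using j.2)⟩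
    have hfb : ∀ g, Function.update f i g = slot i b g := by
      intro g
      funext j
      rcases eq_or_ne j i with rfl | hj
      · simp [slot_self]
      · rw [slot_of_ne _ _ _ hj]
        simp [b, hj]
    change lift i A (tens f) = tens fun j => c j (f j)
    rw [hc, hfb, ← slotIsometry_apply, ← Function.update_eq_self i f, hfb, ← slotIsometry_apply]
    classical
    have h1 : (isHilbertSum_slot i).linearIsometryEquiv (slotIsometry i b (f i)) =
        lp.single 2 b (f i) := by
      rw [← IsHilbertSum.linearIsometryEquiv_symm_apply_single (isHilbertSum_slot i),
        LinearIsometryEquiv.apply_symm_apply]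
    have h2 : lpDiag A (lp.single 2 b (f i) : lp (fun _ : {j // j ≠ i} → basisSet => H) 2) =
        lp.single 2 b (A (f i)) := by
      refine lp.ext (funext fun b' => ?_)
      rw [lpDiag_apply]
      rcases eq_or_ne b' b with rfl | hb
      · simp
      · rw [lp.single_apply_ne _ _ _ hb, lp.single_apply_ne _ _ _ hb, map_zero]
    rw [slot_self]
    simp only [lift, ContinuousLinearMap.comp_apply]
    have h3 := (isHilbertSum_slot i).linearIsometryEquiv_symm_apply_single (i := b) (A (f i))
    rw [← h3, ← h2, ← h1]
    rfl

theorem lift_mul {d : ℕ} (i : Fin d) (A A' : H →L[ℝ] H) :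
    lift i (A * A') = lift i A * lift i A' :=
  clm_ext_tens fun f => by simp [lift_tens]

theorem lift_one {d : ℕ} (i : Fin d) : lift i (1 : H →L[ℝ] H) = 1 :=
  clm_ext_tens fun f => by simp [lift_tens]

theorem lift_add {d : ℕ} (i : Fin d) (A A' : H →L[ℝ] H) :
    lift i (A + A') = lift i A + lift i A' :=
  clm_ext_tens fun f => by
    simp only [lift_tens, add_apply]
    exact (tensM d).map_update_add f i _ _

theorem lift_smul {d : ℕ} (i : Fin d) (c : ℝ) (A : H →L[ℝ] H) :
    lift i (c • A) = c • lift i A :=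
  clm_ext_tens fun f => by
    simp only [lift_tens, smul_apply]
    exact (tensM d).map_update_smul f i _ _

theorem lift_neg {d : ℕ} (i : Fin d) (A : H →L[ℝ] H) : lift i (-A) = -lift i A := by
  rw [← neg_one_smul ℝ, lift_smul, neg_one_smul]

theorem lift_sub {d : ℕ} (i : Fin d) (A A' : H →L[ℝ] H) :
    lift i (A - A') = lift i A - lift i A' := by
  rw [sub_eq_add_neg, lift_add, lift_neg, sub_eq_add_neg]

/-- The tensor product of the operators `A i`, acting on `L²(Ω)`: the composition of their copies
`lift i (A i)`, which commute. -/
def tmap {d : ℕ} (A : Fin d → H →L[ℝ] H) : L2 d →L[ℝ] L2 d :=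
  (List.finRange d).foldr (fun i B => lift i (A i) * B) 1

theorem foldr_lift_tens {d : ℕ} (A : Fin d → H →L[ℝ] H) (l : List (Fin d)) (hl : l.Nodup)
    (f : Fin d → H) :
    l.foldr (fun i B => lift i (A i) * B) 1 (tens f) =
      tens fun j => if j ∈ l then A j (f j) else f j := by
  induction l with
  | nil => simp
  | cons a l ih =>
    rw [List.foldr_cons, mul_apply_eq_comp, ih (List.nodup_cons.1 hl).2, lift_tens]
    congr 1
    funext j
    rcases eq_or_ne j a with rfl | hj
    · simp [(List.nodup_cons.1 hl).1]
    · simp [hj]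

theorem tmap_tens {d : ℕ} (A : Fin d → H →L[ℝ] H) (f : Fin d → H) :
    tmap A (tens f) = tens fun i => A i (f i) := by
  rw [tmap, foldr_lift_tens A _ (List.nodup_finRange d)]
  simp

theorem norm_tmap_le {d : ℕ} (A : Fin d → H →L[ℝ] H) : ‖tmap A‖ ≤ ∏ i, ‖A i‖ := by
  have h : ∀ l : List (Fin d), ‖l.foldr (fun i B => lift i (A i) * B) 1‖ ≤
      (l.map fun i => ‖A i‖).prod := by
    intro l
    induction l with
    | nil => exact ContinuousLinearMap.norm_id_le
    | cons a l ih =>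
      rw [List.foldr_cons, List.map_cons, List.prod_cons]
      exact (norm_mul_le _ _).trans (mul_le_mul (norm_lift_le _ _) ih (norm_nonneg _)
        (norm_nonneg _))
  refine (h _).trans (le_of_eq ?_)
  rw [← List.ofFn_eq_map, List.prod_ofFn]

theorem tmap_mul {d : ℕ} (A A' : Fin d → H →L[ℝ] H) : tmap A * tmap A' = tmap (A * A') :=
  clm_ext_tens fun f => by simp [tmap_tens]

theorem lift_eq_tmap {d : ℕ} (i : Fin d) (A : H →L[ℝ] H) :
    lift i A = tmap (Function.update 1 i A) :=
  clm_ext_tens fun f => by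
    rw [lift_tens, tmap_tens]
    congr 1
    funext j
    rcases eq_or_ne j i with rfl | hj
    · simp
    · simp [hj]

theorem inner_tmap_left {d : ℕ} (A A' : Fin d → H →L[ℝ] H)
    (h : ∀ i f g, inner ℝ (A i f) g = inner ℝ f (A' i g)) (u w : L2 d) :
    inner ℝ (tmap A u) w = inner ℝ u (tmap A' w) := by
  have h1 : ContinuousLinearMap.adjoint (tmap A) = tmap A' := by
    refine clm_ext_tens fun f => ext_inner_tens fun g => ?_
    rw [ContinuousLinearMap.adjoint_inner_right, tmap_tens, tmap_tens, inner_tens, inner_tens]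
    exact Finset.prod_congr rfl fun i _ => h i _ _
  rw [← h1, ContinuousLinearMap.adjoint_inner_right]

theorem inner_lift_left {d : ℕ} (i : Fin d) (A A' : H →L[ℝ] H)
    (h : ∀ f g, inner ℝ (A f) g = inner ℝ f (A' g)) (u w : L2 d) :
    inner ℝ (lift i A u) w = inner ℝ u (lift i A' w) := by
  rw [lift_eq_tmap, lift_eq_tmap]
  refine inner_tmap_left _ _ (fun j f g => ?_) u w
  rcases eq_or_ne j i with rfl | hj
  · simpa using h f g
  · simp [hj]

theorem tmap_add_update {d : ℕ} (A : Fin d → H →L[ℝ] H) (i : Fin d) (X Y : H →L[ℝ] H) :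
    tmap (Function.update A i (X + Y)) =
      tmap (Function.update A i X) + tmap (Function.update A i Y) := by
  have h : ∀ X, tmap (Function.update A i X) = lift i X * tmap (Function.update A i 1) := by
    intro X
    rw [lift_eq_tmap, tmap_mul]
    congr 1
    funext j
    rcases eq_or_ne j i with rfl | hj
    · simp
    · simp [hj]
  rw [h, h X, h Y, lift_add, add_mul]

/-- The tensor product of operators, as a multilinear map in the operators. -/
def tmapM (d : ℕ) : MultilinearMap ℝ (fun _ : Fin d => H →L[ℝ] H) (L2 d →L[ℝ] L2 d) where
  toFun := tmap
  map_update_add' := by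
    intro inst A i X Y
    obtain rfl := Subsingleton.elim inst (instDecidableEqFin d)
    exact tmap_add_update A i X Y
  map_update_smul' := by
    intro inst A i c X
    obtain rfl := Subsingleton.elim inst (instDecidableEqFin d)
    refine clm_ext_tens fun f => ?_
    rw [tmap_tens, smul_apply, tmap_tens]
    have h : ∀ Y : H →L[ℝ] H, (fun j => Function.update A i Y j (f j)) =
        Function.update (fun j => A j (f j)) i (Y (f i)) := by
      intro Y
      funext j
      rcases eq_or_ne j i with rfl | hj
      · simp
      · simp [hj]
    rw [h, h, smul_apply]
    exact (tensM d).map_update_smul _ i c _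

theorem tmapM_apply {d : ℕ} (A : Fin d → H →L[ℝ] H) : tmapM d A = tmap A := rfl

/-! ### Classes of functions on the unit interval -/

open Classical in
/-- The class in `L²(0,1)` of a function on the line (`0` if it is not square integrable
on `(0,1)`). -/
def cls (f : ℝ → ℝ) : H := if h : MemLp f 2 unitMeasure then h.toLp f else 0

theorem cls_ae {f : ℝ → ℝ} (h : MemLp f 2 unitMeasure) : cls f =ᵐ[unitMeasure] f := by
  rw [cls, dif_pos h]; exact MemLp.coeFn_toLp h

theorem memLp_of_continuous {f : ℝ → ℝ} (h : Continuous f) : MemLp f 2 unitMeasure := by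
  obtain ⟨C, hC⟩ := isCompact_Icc.exists_bound_of_continuousOn (h.continuousOn (s := Set.Icc 0 1))
  exact MemLp.of_bound h.aestronglyMeasurable C
    ((ae_restrict_mem measurableSet_Ioo).mono fun x hx => hC x (Set.Ioo_subset_Icc_self hx))

theorem cls_coe (f : H) : cls f = f := by
  rw [cls, dif_pos (Lp.memLp f)]; exact Lp.toLp_coeFn f _

theorem eq_cls_of_ae {u : H} {f : ℝ → ℝ} (h : u =ᵐ[unitMeasure] f) : u = cls f := by
  have hf : MemLp f 2 unitMeasure := (memLp_congr_ae h).1 (Lp.memLp u)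
  exact Lp.ext (h.trans (cls_ae hf).symm)

theorem cls_congr {f g : ℝ → ℝ} (hf : MemLp f 2 unitMeasure) (h : f =ᵐ[unitMeasure] g) :
    cls f = cls g :=
  eq_cls_of_ae ((cls_ae hf).trans h)

theorem cls_add {f g : ℝ → ℝ} (hf : MemLp f 2 unitMeasure) (hg : MemLp g 2 unitMeasure) :
    cls (f + g) = cls f + cls g := by
  symm
  apply eq_cls_of_ae
  filter_upwards [Lp.coeFn_add (cls f) (cls g), cls_ae hf, cls_ae hg] with x h1 h2 h3
  rw [h1, Pi.add_apply, h2, h3, Pi.add_apply]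

theorem cls_smul {f : ℝ → ℝ} (c : ℝ) (hf : MemLp f 2 unitMeasure) : cls (c • f) = c • cls f := by
  symm
  apply eq_cls_of_ae
  filter_upwards [Lp.coeFn_smul c (cls f), cls_ae hf] with x h1 h2
  rw [h1, Pi.smul_apply, h2, Pi.smul_apply]

theorem inner_eq_integral {u w : H} {f g : ℝ → ℝ} (hf : u =ᵐ[unitMeasure] f)
    (hg : w =ᵐ[unitMeasure] g) : inner ℝ u w = ∫ x in Set.Ioo (0 : ℝ) 1, f x * g x := by
  rw [L2.inner_def]
  apply integral_congr_ae
  filter_upwards [hf, hg] with x h1 h2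
  simp [h1, h2, mul_comm]

/-- One-dimensional test functions: `θ ∈ C_c^∞(0,1)`. -/
structure IsTest (θ : ℝ → ℝ) : Prop where
  smooth : ContDiff ℝ ∞ θ
  compact : HasCompactSupport θ
  supp : tsupport θ ⊆ Set.Ioo 0 1

theorem IsTest.zero : IsTest 0 :=
  ⟨contDiff_const, HasCompactSupport.zero, by simp⟩

theorem IsTest.add {θ η : ℝ → ℝ} (hθ : IsTest θ) (hη : IsTest η) : IsTest (θ + η) :=
  ⟨hθ.smooth.add hη.smooth, hθ.compact.add hη.compact,
    (tsupport_add θ η).trans (Set.union_subset hθ.supp hη.supp)⟩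

theorem IsTest.const_smul {θ : ℝ → ℝ} (c : ℝ) (hθ : IsTest θ) : IsTest (c • θ) :=
  ⟨hθ.smooth.const_smul c, hθ.compact.mono (Function.support_const_smul_subset c θ),
    (closure_mono (Function.support_const_smul_subset c θ)).trans hθ.supp⟩

theorem IsTest.deriv {θ : ℝ → ℝ} (hθ : IsTest θ) : IsTest (deriv θ) :=
  ⟨(contDiff_infty_iff_deriv.1 hθ.smooth).2, hθ.compact.deriv,
    (closure_minimal (support_deriv_subset) (isClosed_tsupport θ)).trans hθ.supp⟩

theorem IsTest.iteratedDeriv {θ : ℝ → ℝ} (hθ : IsTest θ) (a : ℕ) : IsTest (iteratedDeriv a θ) := by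
  induction a with
  | zero => simpa using hθ
  | succ a ih => rw [iteratedDeriv_succ]; exact ih.deriv

theorem IsTest.memLp {θ : ℝ → ℝ} (hθ : IsTest θ) : MemLp θ 2 unitMeasure :=
  memLp_of_continuous hθ.smooth.continuous

theorem IsTest.eq_zero {θ : ℝ → ℝ} (hθ : IsTest θ) {x : ℝ} (hx : x ∉ Set.Ioo (0 : ℝ) 1) :
    θ x = 0 :=
  image_eq_zero_of_notMem_tsupport fun h => hx (hθ.supp h)

theorem eq_zero_of_inner_test {u : H} (h : ∀ θ, IsTest θ → inner ℝ (cls θ) u = 0) : u = 0 := by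
  have hu : LocallyIntegrableOn u (Set.Ioo (0 : ℝ) 1) volume :=
    IntegrableOn.locallyIntegrableOn ((Lp.memLp u).integrable one_le_two)
  have := isOpen_Ioo.ae_eq_zero_of_integral_contDiff_smul_eq_zero hu fun θ h1 h2 h3 => by
    have hθ : IsTest θ := ⟨h1, h2, h3⟩
    have := h θ hθ
    rw [inner_eq_integral (cls_ae hθ.memLp) ae_eq_rfl, ← integral_indicator measurableSet_Ioo] at this
    rw [← this]
    congr 1
    funext x
    by_cases hx : x ∈ Set.Ioo (0 : ℝ) 1
    · simp [hx]
    · simp [hx, hθ.eq_zero hx]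
  have h0 : u =ᵐ[unitMeasure] 0 := (ae_restrict_iff' measurableSet_Ioo).2 this
  exact Lp.ext (h0.trans (Lp.coeFn_zero _ _ _).symm)

/-- Classes of test functions are total in `L²(0,1)`. -/
theorem dense_span_test : Dense (Submodule.span ℝ {u : H | ∃ θ, IsTest θ ∧ u = cls θ} : Set H) := by
  have : (Submodule.span ℝ {u : H | ∃ θ, IsTest θ ∧ u = cls θ}).topologicalClosure = ⊤ := by
    rw [Submodule.topologicalClosure_eq_top_iff, Submodule.eq_bot_iff]
    exact fun u hu => eq_zero_of_inner_test fun θ hθ =>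
      hu _ (Submodule.subset_span ⟨θ, hθ, rfl⟩)
  rwa [dense_iff_closure_eq, ← Submodule.topologicalClosure_coe, ← Submodule.top_coe (R := ℝ),
    SetLike.coe_set_eq]

theorem ext_inner_test {u w : H} (h : ∀ θ, IsTest θ → inner ℝ (cls θ) u = inner ℝ (cls θ) w) :
    u = w :=
  sub_eq_zero.1 (eq_zero_of_inner_test fun θ hθ => by rw [inner_sub_right, h θ hθ, sub_self])

/-! ### The antiderivative operator -/

theorem intervalIntegrable_unit (f : H) (a b : ℝ) : IntervalIntegrable f unitMeasure a b :=
  ((Lp.memLp f).integrable one_le_two).intervalIntegrable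

theorem continuous_tailIntegral (f : H) :
    Continuous fun x => ∫ y in x..1, f y ∂unitMeasure := by
  have := (intervalIntegral.continuous_primitive (intervalIntegrable_unit f) 1).neg
  refine this.congr fun x => ?_
  rw [intervalIntegral.integral_symm]; simp

theorem abs_tailIntegral_le (f : H) (x : ℝ) : |∫ y in x..1, f y ∂unitMeasure| ≤ ‖f‖ := by
  have hint : Integrable f unitMeasure := (Lp.memLp f).integrable one_le_two
  refine (intervalIntegral.norm_integral_le_integral_norm_uIoc (f := f)).trans ?_
  refine (setIntegral_le_integral hint.norm (ae_of_all _ fun _ => norm_nonneg _)).trans ?_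
  rw [integral_norm_eq_lintegral_enorm hint.1, ← eLpNorm_one_eq_lintegral_enorm, Lp.norm_def]
  exact ENNReal.toReal_mono (Lp.eLpNorm_ne_top f)
    (eLpNorm_le_eLpNorm_of_exponent_le one_le_two hint.1)

/-- The operator `f ↦ ∫_x^1 f` on `L²(0,1)`. -/
def tailInt : H →L[ℝ] H :=
  LinearMap.mkContinuous
    { toFun := fun f => cls fun x => ∫ y in x..1, f y ∂unitMeasure
      map_add' := fun f g => by
        rw [← cls_add (memLp_of_continuous (continuous_tailIntegral f))
          (memLp_of_continuous (continuous_tailIntegral g))]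
        congr 1
        funext x
        rw [Pi.add_apply, ← intervalIntegral.integral_add (intervalIntegrable_unit f _ _)
          (intervalIntegrable_unit g _ _)]
        refine intervalIntegral.integral_congr_ae ?_
        filter_upwards [Lp.coeFn_add f g] with y hy _
        rw [hy, Pi.add_apply]
      map_smul' := fun c f => by
        rw [RingHom.id_apply, ← cls_smul _ (memLp_of_continuous (continuous_tailIntegral f))]
        congr 1
        funext x
        rw [Pi.smul_apply, smul_eq_mul, ← intervalIntegral.integral_const_mul]
        refine intervalIntegral.integral_congr_ae ?_
        filter_upwards [Lp.coeFn_smul c f] with y hy _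
        rw [hy, Pi.smul_apply, smul_eq_mul] }
    1 fun f => by
      have := Lp.norm_le_of_ae_bound (f := cls fun x => ∫ y in x..1, f y ∂unitMeasure)
        (norm_nonneg f) ?_
      · simpa [measureUnivNNReal] using this
      · filter_upwards [cls_ae (memLp_of_continuous (continuous_tailIntegral f))] with x hx
        rw [hx]
        exact abs_tailIntegral_le f x

theorem norm_tailInt_le : ‖tailInt‖ ≤ 1 := LinearMap.mkContinuous_norm_le _ zero_le_one _

/-- The antiderivative of `-f` that vanishes at `1`. -/
def tailPrim (f : ℝ → ℝ) (x : ℝ) : ℝ := ∫ y in x..1, f y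

theorem hasDerivAt_tailPrim {f : ℝ → ℝ} (hf : Continuous f) (x : ℝ) :
    HasDerivAt (tailPrim f) (-f x) x :=
  intervalIntegral.integral_hasDerivAt_left (hf.intervalIntegrable _ _)
    (hf.stronglyMeasurableAtFilter _ _) hf.continuousAt

theorem deriv_tailPrim {f : ℝ → ℝ} (hf : Continuous f) : deriv (tailPrim f) = -f :=
  funext fun x => (hasDerivAt_tailPrim hf x).deriv

theorem contDiff_tailPrim {f : ℝ → ℝ} (hf : ContDiff ℝ ∞ f) : ContDiff ℝ ∞ (tailPrim f) :=
  contDiff_infty_iff_deriv.2 ⟨fun x => (hasDerivAt_tailPrim hf.continuous x).differentiableAt, by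
    rw [deriv_tailPrim hf.continuous]; exact hf.neg⟩

theorem continuous_tailPrim {f : ℝ → ℝ} (hf : Continuous f) : Continuous (tailPrim f) :=
  continuous_iff_continuousAt.2 fun x => (hasDerivAt_tailPrim hf x).continuousAt

theorem tailInt_cls {f : ℝ → ℝ} (hf : Continuous f) : tailInt (cls f) = cls (tailPrim f) := by
  change cls _ = _
  refine cls_congr (memLp_of_continuous (continuous_tailIntegral _)) ?_
  filter_upwards [ae_restrict_mem measurableSet_Ioo] with x hx
  rw [tailPrim, intervalIntegral.integral_of_le hx.2.le, intervalIntegral.integral_of_le hx.2.le]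
  rw [integral_congr_ae (ae_restrict_of_ae (cls_ae (memLp_of_continuous hf)))]
  rw [Measure.restrict_restrict measurableSet_Ioc, integral_Ioc_eq_integral_Ioo]
  congr 2
  ext y
  simp only [Set.mem_inter_iff, Set.mem_Ioc, Set.mem_Ioo]
  exact ⟨fun h => ⟨h.1.1, h.2.2⟩, fun h => ⟨⟨h.1, h.2.le⟩, hx.1.trans h.1, h.2⟩⟩

/-- The operator `f ↦ ∫_0^x f` on `L²(0,1)`, as the adjoint of `f ↦ ∫_x^1 f`. It inverts
differentiation on test functions. -/
def headInt : H →L[ℝ] H := ContinuousLinearMap.adjoint tailInt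

theorem inner_headInt_left (f g : H) : inner ℝ (headInt f) g = inner ℝ f (tailInt g) :=
  ContinuousLinearMap.adjoint_inner_left _ _ _

theorem headInt_cls_deriv {θ : ℝ → ℝ} (hθ : IsTest θ) : headInt (cls (deriv θ)) = cls θ := by
  refine ext_inner_test fun η hη => ?_
  rw [real_inner_comm, inner_headInt_left, tailInt_cls hη.smooth.continuous, real_inner_comm,
    inner_eq_integral (cls_ae (memLp_of_continuous (continuous_tailPrim hη.smooth.continuous)))
      (cls_ae hθ.deriv.memLp), inner_eq_integral (cls_ae hη.memLp) (cls_ae hθ.memLp),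
    ← integral_Ioc_eq_integral_Ioo, ← integral_Ioc_eq_integral_Ioo,
    ← intervalIntegral.integral_of_le zero_le_one, ← intervalIntegral.integral_of_le zero_le_one,
    intervalIntegral.integral_mul_deriv_eq_deriv_mul (u' := -η)
      (fun x _ => hasDerivAt_tailPrim hη.smooth.continuous x)
      (fun x _ => (hθ.smooth.differentiable (by simp)).differentiableAt.hasDerivAt)
      (hη.smooth.continuous.neg.intervalIntegrable _ _)
      (hθ.deriv.smooth.continuous.intervalIntegrable _ _)]
  rw [hθ.eq_zero (x := 0) (by simp), hθ.eq_zero (x := 1) (by simp)]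
  simp

theorem headInt_pow_cls_iteratedDeriv {θ : ℝ → ℝ} (hθ : IsTest θ) (a : ℕ) :
    (headInt ^ a) (cls (iteratedDeriv a θ)) = cls θ := by
  induction a with
  | zero => simp
  | succ a ih =>
    rw [iteratedDeriv_succ, pow_succ, mul_apply_eq_comp, headInt_cls_deriv (hθ.iteratedDeriv a), ih]

theorem inner_headInt_pow_left (a : ℕ) (f g : H) :
    inner ℝ ((headInt ^ a) f) g = inner ℝ f ((tailInt ^ a) g) := by
  induction a generalizing f g with
  | zero => simp
  | succ a ih =>
    rw [pow_succ, mul_apply_eq_comp, ih, inner_headInt_left, pow_succ', mul_apply_eq_comp]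

/-- A test function of vanishing integral is the derivative of a test function. -/
theorem exists_test_deriv_eq {ψ : ℝ → ℝ} (hψ : IsTest ψ) (h0 : ∫ x in Set.Ioo (0 : ℝ) 1, ψ x = 0) :
    ∃ θ, IsTest θ ∧ deriv θ = ψ := by
  have hc := hψ.smooth.continuous
  -- The additional point makes `s` nonempty, so that `[inf s, sup s]` is a compact subinterval.
  let s := insert (1 / 2 : ℝ) (tsupport ψ)
  have hs : IsCompact s := hψ.compact.isCompact.insert _
  have hs1 : s ⊆ Set.Ioo 0 1 := Set.insert_subset (by norm_num) hψ.supp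
  have hne : s.Nonempty := ⟨_, Set.mem_insert _ _⟩
  have ha := hs1 (hs.sInf_mem hne)
  have hb := hs1 (hs.sSup_mem hne)
  have hsab : s ⊆ Set.Icc (sInf s) (sSup s) := fun x hx =>
    ⟨csInf_le hs.bddBelow hx, le_csSup hs.bddAbove hx⟩
  have hz : ∀ x, x ∉ Set.Icc (sInf s) (sSup s) → ψ x = 0 := fun x hx =>
    image_eq_zero_of_notMem_tsupport fun h => hx (hsab (Set.mem_insert_of_mem _ h))
  have h01 : ∫ y in (0 : ℝ)..1, ψ y = 0 := by
    rw [intervalIntegral.integral_of_le zero_le_one, integral_Ioc_eq_integral_Ioo, h0]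
  have hsupp : Function.support (tailPrim ψ) ⊆ Set.Icc (sInf s) (sSup s) := by
    intro x hx
    by_contra hxs
    apply hx
    rw [tailPrim]
    rcases not_and_or.1 hxs with h | h
    · rw [← intervalIntegral.integral_add_adjacent_intervals (b := 0)
        (hc.intervalIntegrable _ _) (hc.intervalIntegrable _ _), h01, add_zero]
      refine (intervalIntegral.integral_congr (g := fun _ => 0) fun y hy => hz y fun hy' => ?_).trans
        (by simp)
      have := (Set.mem_uIcc.1 hy)
      rcases this with h' | h'
      · exact absurd (hy'.1.trans h'.2) (not_le.2 ha.1)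
      · exact h (hy'.1.trans h'.2)
    · refine (intervalIntegral.integral_congr (g := fun _ => 0) fun y hy => hz y fun hy' => ?_).trans
        (by simp)
      rcases Set.mem_uIcc.1 hy with h' | h'
      · exact h (h'.1.trans hy'.2)
      · exact absurd (h'.1.trans hy'.2) (not_le.2 hb.2)
  have hts : tsupport (tailPrim ψ) ⊆ Set.Icc (sInf s) (sSup s) := closure_minimal hsupp isClosed_Icc
  have ht : IsTest (tailPrim ψ) :=
    ⟨contDiff_tailPrim hψ.smooth, HasCompactSupport.of_support_subset_isCompact isCompact_Icc hsupp,
      hts.trans fun x hx => ⟨ha.1.trans_le hx.1, hx.2.trans_lt hb.2⟩⟩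
  refine ⟨(-1 : ℝ) • tailPrim ψ, ht.const_smul _, ?_⟩
  funext x
  rw [((hasDerivAt_tailPrim hc x).const_smul (-1 : ℝ)).deriv]
  simp

theorem exists_test_integral_eq_one : ∃ η, IsTest η ∧ ∫ x in Set.Ioo (0 : ℝ) 1, η x = 1 := by
  let b : ContDiffBump (1 / 2 : ℝ) := ⟨1 / 8, 1 / 4, by norm_num, by norm_num⟩
  have hsub : tsupport (b.normed volume) ⊆ Set.Ioo 0 1 := by
    rw [b.tsupport_normed_eq, Real.closedBall_eq_Icc]
    intro x hx
    constructor <;> [have := hx.1; have := hx.2] <;> norm_num [b] at this ⊢ <;> linarith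
  have ht : IsTest (b.normed volume) := ⟨b.contDiff_normed, b.hasCompactSupport_normed, hsub⟩
  refine ⟨_, ht, ?_⟩
  rw [← integral_indicator measurableSet_Ioo]
  refine Eq.trans ?_ (b.integral_normed (μ := volume))
  congr 1
  funext x
  by_cases hx : x ∈ Set.Ioo (0 : ℝ) 1
  · simp [hx]
  · rw [Set.indicator_of_notMem hx, ht.eq_zero hx]

/-! ### Polynomials and the range of differentiation -/

theorem memLp_poly (p : Polynomial ℝ) : MemLp (fun x => p.eval x) 2 unitMeasure :=
  memLp_of_continuous p.continuous

/-- The class of a polynomial in `L²(0,1)`. -/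
def polyL : Polynomial ℝ →ₗ[ℝ] H where
  toFun p := cls fun x => p.eval x
  map_add' p r := by
    rw [← cls_add (memLp_poly p) (memLp_poly r)]
    congr 1; funext x; simp
  map_smul' c p := by
    rw [RingHom.id_apply, ← cls_smul c (memLp_poly p)]
    congr 1; funext x; simp

/-- The classes of the polynomials of degree less than `a`. -/
def Pol (a : ℕ) : Submodule ℝ H := (Polynomial.degreeLT ℝ a).map polyL

instance (a : ℕ) : FiniteDimensional ℝ (Pol a) := by
  have : FiniteDimensional ℝ (Polynomial.degreeLT ℝ a) :=
    (Polynomial.degreeLTEquiv ℝ a).symm.finiteDimensional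
  exact inferInstanceAs (FiniteDimensional ℝ ((Polynomial.degreeLT ℝ a).map polyL))

theorem Pol_mono {a b : ℕ} (h : a ≤ b) : Pol a ≤ Pol b :=
  Submodule.map_mono (Polynomial.degreeLT_mono h)

theorem tailInt_mem_Pol {a : ℕ} {u : H} (hu : u ∈ Pol a) : tailInt u ∈ Pol (a + 1) := by
  suffices h : Pol a ≤ (Pol (a + 1)).comap tailInt.toLinearMap from h hu
  rw [Pol, Polynomial.degreeLT_eq_span_X_pow, Submodule.map_span, Submodule.span_le]
  rintro _ ⟨_, hp, rfl⟩
  simp only [Finset.coe_image, Finset.coe_range, Set.mem_image, Set.mem_Iio] at hp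
  obtain ⟨i, hi, rfl⟩ := hp
  refine ⟨Polynomial.C ((i + 1 : ℝ)⁻¹) * (1 - Polynomial.X ^ (i + 1)), ?_, ?_⟩
  · rw [SetLike.mem_coe, Polynomial.mem_degreeLT]
    refine lt_of_le_of_lt (b := ((i + 1 : ℕ) : WithBot ℕ)) ?_ (by exact_mod_cast (by omega))
    refine (Polynomial.degree_mul_le _ _).trans (le_trans (add_le_add_left Polynomial.degree_C_le _) ?_)
    rw [zero_add]
    refine (Polynomial.degree_sub_le _ _).trans ?_
    exact max_le (Polynomial.degree_one_le.trans (by exact_mod_cast Nat.zero_le _))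
      (Polynomial.degree_X_pow_le _)
  · change cls _ = tailInt (cls _)
    rw [tailInt_cls (Polynomial.continuous _)]
    congr 1
    funext x
    simp [tailPrim, integral_pow]
    field_simp

theorem tailInt_pow_mem_Pol (a : ℕ) {b : ℕ} {u : H} (hu : u ∈ Pol b) :
    (tailInt ^ a) u ∈ Pol (b + a) := by
  induction a with
  | zero => simpa using hu
  | succ a ih => rw [pow_succ', mul_apply_eq_comp]; exact tailInt_mem_Pol ih

/-- The lemma of du Bois-Reymond: a function orthogonal to all `a`-th derivatives of test functions
is a polynomial of degree less than `a`. -/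
theorem mem_Pol_of_inner_iteratedDeriv (a : ℕ) {v : H}
    (h : ∀ θ, IsTest θ → inner ℝ (cls (iteratedDeriv a θ)) v = 0) : v ∈ Pol a := by
  induction a generalizing v with
  | zero =>
    rw [eq_zero_of_inner_test (u := v) fun θ hθ => by simpa using h θ hθ]
    exact zero_mem _
  | succ a ih =>
    obtain ⟨η, hη, hη1⟩ := exists_test_integral_eq_one
    -- `tailInt ^ a` maps `1` to a polynomial of degree `a`; subtracting its multiple by `m` reduces
    -- the claim to order `a`.
    set m := inner ℝ (cls (iteratedDeriv a η)) v
    have hone : cls (fun _ => 1) ∈ Pol 1 :=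
      ⟨1, by simp [Polynomial.mem_degreeLT], by change cls _ = _; simp⟩
    have h1 : (tailInt ^ a) (cls fun _ => 1) ∈ Pol (a + 1) := by
      rw [add_comm]; exact tailInt_pow_mem_Pol a hone
    have h2 : v - m • (tailInt ^ a) (cls fun _ => 1) ∈ Pol a := by
      refine ih fun φ hφ => ?_
      set c := ∫ x in Set.Ioo (0 : ℝ) 1, φ x
      have hφ1 : inner ℝ (cls (iteratedDeriv a φ)) ((tailInt ^ a) (cls fun _ => 1)) = c := by
        rw [← inner_headInt_pow_left, headInt_pow_cls_iteratedDeriv hφ,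
          inner_eq_integral (cls_ae hφ.memLp) (cls_ae (memLp_of_continuous continuous_const))]
        simp [c]
      -- `φ - c η` has vanishing integral, so that it is the derivative of a test function.
      have hψ := hφ.add (hη.const_smul (-c))
      obtain ⟨θ, hθ, hθ'⟩ := exists_test_deriv_eq hψ (by
        have e1 : Integrable φ unitMeasure := hφ.memLp.integrable one_le_two
        have e2 : Integrable η unitMeasure := hη.memLp.integrable one_le_two
        have : (fun x => (φ + -c • η) x) = fun x => φ x + (-c) * η x := by funext x; simp
        rw [this, integral_add e1 (e2.const_mul _), integral_const_mul, hη1]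
        simp [c])
      have h3 := h θ hθ
      rw [iteratedDeriv_succ', hθ'] at h3
      have h4 : iteratedDeriv a (φ + -c • η) = iteratedDeriv a φ + (-c) • iteratedDeriv a η := by
        funext x
        rw [iteratedDeriv_add (hφ.smooth.contDiffAt.of_le (by exact_mod_cast le_top))
          ((hη.const_smul (-c)).smooth.contDiffAt.of_le (by exact_mod_cast le_top))]
        simp [iteratedDeriv_const_smul_field]
      rw [h4, cls_add (hφ.iteratedDeriv a).memLp ((hη.iteratedDeriv a).const_smul _).memLp,
        cls_smul _ (hη.iteratedDeriv a).memLp, inner_add_left, real_inner_smul_left] at h3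
      rw [inner_sub_right, real_inner_smul_right, hφ1]
      change _ - m * c = 0
      linarith [h3, mul_comm m c, show -c * inner ℝ (cls (iteratedDeriv a η)) v = -(c * m) by ring]
    have := add_mem (Pol_mono a.le_succ h2) (Submodule.smul_mem _ m h1)
    simpa using this

/-- The graph of the inverse of `a`-fold differentiation on test functions: the pairs
`(θ⁽ᵃ⁾, θ)` with `θ ∈ C_c^∞(0,1)`. -/
def testGraph (a : ℕ) : Submodule ℝ (H × H) where
  carrier := {z | ∃ θ, IsTest θ ∧ z = (cls (iteratedDeriv a θ), cls θ)}
  zero_mem' := ⟨0, IsTest.zero, by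
    have h : cls (0 : ℝ → ℝ) = 0 := by
      have := cls_smul (f := 0) 0 (IsTest.zero.memLp)
      simpa using this
    have h' : iteratedDeriv a (0 : ℝ → ℝ) = 0 := by
      funext x; simp [Pi.zero_def, iteratedDeriv_fun_const_zero]
    rw [h', h]; rfl⟩
  add_mem' := by
    rintro _ _ ⟨θ, hθ, rfl⟩ ⟨η, hη, rfl⟩
    refine ⟨θ + η, hθ.add hη, ?_⟩
    have h4 : iteratedDeriv a (θ + η) = iteratedDeriv a θ + iteratedDeriv a η := by
      funext x
      rw [iteratedDeriv_add (hθ.smooth.contDiffAt.of_le (by exact_mod_cast le_top))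
        (hη.smooth.contDiffAt.of_le (by exact_mod_cast le_top))]
      rfl
    rw [h4, cls_add hθ.memLp hη.memLp, cls_add (hθ.iteratedDeriv a).memLp (hη.iteratedDeriv a).memLp]
    rfl
  smul_mem' := by
    rintro c _ ⟨θ, hθ, rfl⟩
    refine ⟨c • θ, hθ.const_smul c, ?_⟩
    have h4 : iteratedDeriv a (c • θ) = c • iteratedDeriv a θ := by
      funext x; simp [iteratedDeriv_const_smul_field]
    rw [h4, cls_smul c hθ.memLp, cls_smul c (hθ.iteratedDeriv a).memLp]
    rfl

/-- The closure of `a`-fold differentiation on test functions is defined on the orthogonal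
complement of the polynomials of degree less than `a`, where it is inverted by `headInt ^ a`. -/
theorem mem_closure_testGraph {a : ℕ} {χ : H} (h : χ ∈ (Pol a)ᗮ) :
    (χ, (headInt ^ a) χ) ∈ (testGraph a).topologicalClosure := by
  let D : Submodule ℝ H := (testGraph a).map (LinearMap.fst ℝ H H)
  have hD : Dᗮ ≤ Pol a := fun v hv => mem_Pol_of_inner_iteratedDeriv a fun θ hθ =>
    hv _ ⟨_, ⟨θ, hθ, rfl⟩, rfl⟩
  -- By the lemma of du Bois-Reymond the `a`-th derivatives are dense in the complement of `Pol a`.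
  have hχ : χ ∈ D.topologicalClosure := by
    rw [← Submodule.orthogonal_orthogonal_eq_closure]
    exact Submodule.orthogonal_le hD h
  have hc : Continuous fun χ : H => (χ, (headInt ^ a) χ) := by fun_prop
  refine map_mem_closure (f := fun χ : H => (χ, (headInt ^ a) χ)) hc hχ ?_
  rintro _ ⟨_, ⟨θ, hθ, rfl⟩, rfl⟩
  exact ⟨θ, hθ, by simp [headInt_pow_cls_iteratedDeriv hθ]⟩

/-! ### Affine changes of variable on the unit interval -/

/-- The restriction of a function to `(0,1)`, extended by zero. -/
abbrev ext0 (f : ℝ → ℝ) : ℝ → ℝ := (Set.Ioo (0 : ℝ) 1).indicator f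

theorem quasiMeasurePreserving_affine {a : ℝ} (ha : a ≠ 0) (b : ℝ) :
    Measure.QuasiMeasurePreserving (fun x : ℝ => a * x + b) volume volume := by
  have h1 : Measure.QuasiMeasurePreserving (fun x : ℝ => a * x) volume volume :=
    ⟨measurable_const_mul a, by
      rw [Real.map_volume_mul_left ha]; exact Measure.smul_absolutelyContinuous⟩
  exact (measurePreserving_add_right volume b).quasiMeasurePreserving.comp h1

theorem integral_comp_affine (F : ℝ → ℝ) (a b : ℝ) :
    ∫ x, F (a * x + b) = |a⁻¹| * ∫ x, F x := by
  rw [Measure.integral_comp_mul_left (fun x => F (x + b)) a, integral_add_right_eq_self F b,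
    smul_eq_mul]

theorem ext0_ae_eq {f g : ℝ → ℝ} (h : f =ᵐ[unitMeasure] g) : ext0 f =ᵐ[volume] ext0 g :=
  (ae_eq_restrict_iff_indicator_ae_eq measurableSet_Ioo).1 h

theorem memLp_ext0_affine {f : ℝ → ℝ} (hf : MemLp f 2 unitMeasure) {a : ℝ} (ha : a ≠ 0) (b : ℝ) :
    MemLp (fun x => ext0 f (a * x + b)) 2 volume := by
  have h := (memLp_indicator_iff_restrict measurableSet_Ioo).2 hf
  have hm : AEStronglyMeasurable (fun x => ext0 f (a * x + b)) volume :=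
    h.1.comp_quasiMeasurePreserving (quasiMeasurePreserving_affine ha b)
  rw [memLp_two_iff_integrable_sq hm]
  exact (((memLp_two_iff_integrable_sq h.1).1 h).comp_add_right b).comp_mul_left' ha

theorem integral_mul_eq_ext0 (f g : ℝ → ℝ) :
    ∫ x in Set.Ioo (0 : ℝ) 1, f x * g x = ∫ x, ext0 f x * ext0 g x := by
  rw [← integral_indicator measurableSet_Ioo]
  congr 1
  funext x
  by_cases hx : x ∈ Set.Ioo (0 : ℝ) 1 <;> simp [hx]

theorem memLp_affine_unit {f : ℝ → ℝ} (hf : MemLp f 2 unitMeasure) {a : ℝ} (ha : a ≠ 0) (b : ℝ) :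
    MemLp (fun x => ext0 f (a * x + b)) 2 unitMeasure :=
  (memLp_ext0_affine hf ha b).restrict _

/-- The pull-back of the zero extension of a function on `(0,1)` under `x ↦ a x + b`. -/
def affinePull (a : ℝ) (ha : a ≠ 0) (b : ℝ) : H →L[ℝ] H :=
  LinearMap.mkContinuous
    { toFun := fun f => cls fun x => ext0 f (a * x + b)
      map_add' := fun f g => by
        rw [← cls_add (memLp_affine_unit (Lp.memLp f) ha b) (memLp_affine_unit (Lp.memLp g) ha b)]
        refine cls_congr (memLp_affine_unit (Lp.memLp _) ha b) (ae_restrict_of_ae ?_)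
        filter_upwards [(quasiMeasurePreserving_affine ha b).ae_eq_comp
          (ext0_ae_eq (Lp.coeFn_add f g))] with x hx
        simp only [Function.comp_apply] at hx
        rw [hx, Pi.add_apply, ext0, Set.indicator_add']
        rfl
      map_smul' := fun c f => by
        rw [RingHom.id_apply, ← cls_smul c (memLp_affine_unit (Lp.memLp f) ha b)]
        refine cls_congr (memLp_affine_unit (Lp.memLp _) ha b) (ae_restrict_of_ae ?_)
        filter_upwards [(quasiMeasurePreserving_affine ha b).ae_eq_comp
          (ext0_ae_eq (Lp.coeFn_smul c f))] with x hx
        simp only [Function.comp_apply] at hx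
        rw [hx]
        exact Set.indicator_const_smul_apply (Set.Ioo (0 : ℝ) 1) c f (a * x + b) }
    (√|a⁻¹|) fun f => by
      have hm := memLp_ext0_affine (Lp.memLp f) ha b
      refine abs_le_of_sq_le_sq' ?_ (by positivity) |>.2
      change ‖cls fun x => ext0 f (a * x + b)‖ ^ 2 ≤ _
      rw [mul_pow, Real.sq_sqrt (abs_nonneg _), ← real_inner_self_eq_norm_sq,
        ← real_inner_self_eq_norm_sq,
        inner_eq_integral (cls_ae (hm.restrict _)) (cls_ae (hm.restrict _)),
        inner_eq_integral ae_eq_rfl ae_eq_rfl, integral_mul_eq_ext0 f f,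
        ← integral_comp_affine (fun x => ext0 f x * ext0 f x) a b]
      refine setIntegral_le_integral ?_ (ae_of_all _ fun x => mul_self_nonneg _)
      simpa only [pow_two] using (memLp_two_iff_integrable_sq hm.1).1 hm

theorem affinePull_cls {a : ℝ} (ha : a ≠ 0) (b : ℝ) {f : ℝ → ℝ} (hf : MemLp f 2 unitMeasure) :
    affinePull a ha b (cls f) = cls fun x => ext0 f (a * x + b) :=
  cls_congr (memLp_affine_unit (Lp.memLp _) ha b) (ae_restrict_of_ae
    ((quasiMeasurePreserving_affine ha b).ae_eq_comp (ext0_ae_eq (cls_ae hf))))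

theorem inner_affinePull_left {a : ℝ} (ha : a ≠ 0) (b : ℝ) {a' : ℝ} (ha' : a' ≠ 0) (b' : ℝ)
    (h : ∀ x, a' * (a * x + b) + b' = x) (f g : H) :
    inner ℝ (affinePull a ha b f) g = |a⁻¹| * inner ℝ f (affinePull a' ha' b' g) := by
  rw [← cls_coe f, ← cls_coe g, affinePull_cls ha b (Lp.memLp f), affinePull_cls ha' b' (Lp.memLp g),
    inner_eq_integral (cls_ae (memLp_affine_unit (Lp.memLp f) ha b)) (cls_ae (Lp.memLp g)),
    inner_eq_integral (cls_ae (Lp.memLp f)) (cls_ae (memLp_affine_unit (Lp.memLp g) ha' b'))]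
  have e1 : ∫ x in Set.Ioo (0 : ℝ) 1, ext0 f (a * x + b) * g x =
      ∫ x, ext0 f (a * x + b) * ext0 g x := by
    rw [← integral_indicator measurableSet_Ioo]
    congr 1; funext x
    by_cases hx : x ∈ Set.Ioo (0 : ℝ) 1
    · simp only [Set.indicator_of_mem hx, ext0]
    · simp only [Set.indicator_of_notMem hx, ext0, mul_zero]
  have e2 : ∫ x in Set.Ioo (0 : ℝ) 1, f x * ext0 g (a' * x + b') =
      ∫ x, ext0 f x * ext0 g (a' * x + b') := by
    rw [← integral_indicator measurableSet_Ioo]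
    congr 1; funext x
    by_cases hx : x ∈ Set.Ioo (0 : ℝ) 1
    · simp only [Set.indicator_of_mem hx, ext0]
    · simp only [Set.indicator_of_notMem hx, ext0, zero_mul]
  rw [e1, e2, ← integral_comp_affine (fun x => ext0 f x * ext0 g (a' * x + b')) a b]
  simp_rw [h]

/-! ### Dyadic cells and the rescaling of operators -/

/-- The open dyadic interval `(2⁻ⁿ j, 2⁻ⁿ (j + 1))`. -/
def dyadic (n : ℕ) (j : Fin (2 ^ n)) : Set ℝ :=
  Set.Ioo (((j : ℕ) : ℝ) / 2 ^ n) ((((j : ℕ) : ℝ) + 1) / 2 ^ n)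

theorem mem_dyadic_iff {n : ℕ} {j : Fin (2 ^ n)} {x : ℝ} :
    x ∈ dyadic n j ↔ (2 : ℝ) ^ n * x + -(j : ℕ) ∈ Set.Ioo (0 : ℝ) 1 := by
  have h2 : (0 : ℝ) < 2 ^ n := by positivity
  rw [dyadic, Set.mem_Ioo, Set.mem_Ioo, div_lt_iff₀ h2, lt_div_iff₀ h2]
  constructor <;> rintro ⟨h, h'⟩ <;> constructor <;> linarith

theorem dyadic_subset (n : ℕ) (j : Fin (2 ^ n)) : dyadic n j ⊆ Set.Ioo 0 1 := by
  intro x hx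
  have h2 : (0 : ℝ) < 2 ^ n := by positivity
  have h1 : ((j : ℕ) : ℝ) + 1 ≤ 2 ^ n := by exact_mod_cast j.2
  exact ⟨lt_of_le_of_lt (by positivity) hx.1, hx.2.trans_le ((div_le_one h2).2 h1)⟩

theorem dyadic_mem_iff {n : ℕ} {j : Fin (2 ^ n)} {y : ℝ} :
    ((2 : ℝ) ^ n)⁻¹ * y + (j : ℕ) / 2 ^ n ∈ dyadic n j ↔ y ∈ Set.Ioo (0 : ℝ) 1 := by
  rw [mem_dyadic_iff]
  have : (2 : ℝ) ^ n * (((2 : ℝ) ^ n)⁻¹ * y + (j : ℕ) / 2 ^ n) + -(j : ℕ) = y := by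
    field_simp; ring
  rw [this]

theorem halfOpen_unique {n : ℕ} {j j' : Fin (2 ^ n)} {x : ℝ}
    (hj : x ∈ Set.Ioc (((j : ℕ) : ℝ) / 2 ^ n) ((((j : ℕ) : ℝ) + 1) / 2 ^ n))
    (hj' : x ∈ Set.Ioc (((j' : ℕ) : ℝ) / 2 ^ n) ((((j' : ℕ) : ℝ) + 1) / 2 ^ n)) : j = j' := by
  have h2 : (0 : ℝ) < 2 ^ n := by positivity
  rw [Set.mem_Ioc, div_lt_iff₀ h2, le_div_iff₀ h2] at hj hj'
  have h1 : ((j' : ℕ) : ℝ) < (j : ℕ) + 1 := by linarith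
  have h3 : ((j : ℕ) : ℝ) < (j' : ℕ) + 1 := by linarith
  have h1' : (j' : ℕ) < (j : ℕ) + 1 := by exact_mod_cast h1
  have h3' : (j : ℕ) < (j' : ℕ) + 1 := by exact_mod_cast h3
  exact Fin.ext (by omega)

theorem dyadic_unique {n : ℕ} {j j' : Fin (2 ^ n)} {x : ℝ} (hj : x ∈ dyadic n j)
    (hj' : x ∈ dyadic n j') : j = j' :=
  halfOpen_unique ⟨hj.1, hj.2.le⟩ ⟨hj'.1, hj'.2.le⟩

/-- The isometry that transplants a function on `(0,1)` to the dyadic interval `j` of level `n`. -/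
def transplant (n : ℕ) (j : Fin (2 ^ n)) : H →L[ℝ] H :=
  √((2 : ℝ) ^ n) • affinePull (2 ^ n) (by positivity) (-(j : ℕ))

/-- The adjoint of `transplant`: the restriction to a dyadic interval, rescaled to `(0,1)`. -/
def localize (n : ℕ) (j : Fin (2 ^ n)) : H →L[ℝ] H :=
  (√((2 : ℝ) ^ n))⁻¹ • affinePull (2 ^ n)⁻¹ (by positivity) ((j : ℕ) / 2 ^ n)

theorem sqrt_two_pow_pos (n : ℕ) : 0 < √((2 : ℝ) ^ n) := Real.sqrt_pos.2 (by positivity)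

theorem transplant_cls {n : ℕ} (j : Fin (2 ^ n)) {f : ℝ → ℝ} (hf : MemLp f 2 unitMeasure) :
    transplant n j (cls f) = cls fun x => √((2 : ℝ) ^ n) * ext0 f (2 ^ n * x + -(j : ℕ)) := by
  rw [transplant, smul_apply, affinePull_cls _ _ hf,
    ← cls_smul _ (memLp_affine_unit hf (by positivity) _)]
  rfl

theorem localize_ae {n : ℕ} (j : Fin (2 ^ n)) (f : ℝ → ℝ) :
    ((√((2 : ℝ) ^ n))⁻¹ • fun y => ext0 f ((2 ^ n)⁻¹ * y + (j : ℕ) / 2 ^ n)) =ᵐ[unitMeasure]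
      fun y => (√((2 : ℝ) ^ n))⁻¹ * f ((2 ^ n)⁻¹ * y + (j : ℕ) / 2 ^ n) := by
  filter_upwards [ae_restrict_mem measurableSet_Ioo] with y hy
  rw [Pi.smul_apply, smul_eq_mul, ext0, Set.indicator_of_mem]
  exact dyadic_subset n j (dyadic_mem_iff.2 hy)

theorem memLp_localize {n : ℕ} (j : Fin (2 ^ n)) {f : ℝ → ℝ} (hf : MemLp f 2 unitMeasure) :
    MemLp (fun y => (√((2 : ℝ) ^ n))⁻¹ * f ((2 ^ n)⁻¹ * y + (j : ℕ) / 2 ^ n)) 2 unitMeasure :=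
  (memLp_congr_ae (localize_ae j f)).1
    ((memLp_affine_unit hf (a := (2 ^ n)⁻¹) (by positivity) ((j : ℕ) / 2 ^ n)).const_smul _)

theorem localize_cls {n : ℕ} (j : Fin (2 ^ n)) {f : ℝ → ℝ} (hf : MemLp f 2 unitMeasure) :
    localize n j (cls f) =
      cls fun y => (√((2 : ℝ) ^ n))⁻¹ * f ((2 ^ n)⁻¹ * y + (j : ℕ) / 2 ^ n) := by
  have hm := memLp_affine_unit hf (a := (2 ^ n)⁻¹) (by positivity) ((j : ℕ) / 2 ^ n)
  rw [localize, smul_apply, affinePull_cls _ _ hf, ← cls_smul _ hm]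
  exact cls_congr (hm.const_smul _) (localize_ae j f)

theorem memLp_transplant {n : ℕ} (j : Fin (2 ^ n)) {f : ℝ → ℝ} (hf : MemLp f 2 unitMeasure) :
    MemLp (fun x => √((2 : ℝ) ^ n) * ext0 f (2 ^ n * x + -(j : ℕ))) 2 unitMeasure :=
  (memLp_affine_unit hf (a := (2 : ℝ) ^ n) (by positivity) (-(j : ℕ))).const_smul (√((2 : ℝ) ^ n))

theorem inner_transplant_left {n : ℕ} (j : Fin (2 ^ n)) (f g : H) :
    inner ℝ (transplant n j f) g = inner ℝ f (localize n j g) := by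
  rw [transplant, localize, smul_apply, smul_apply,
    real_inner_smul_left, real_inner_smul_right,
    inner_affinePull_left _ _ (a' := (2 ^ n)⁻¹) (by positivity) ((j : ℕ) / 2 ^ n), ← mul_assoc]
  · congr 1
    rw [abs_of_pos (by positivity)]
    have h := Real.mul_self_sqrt (show (0 : ℝ) ≤ 2 ^ n by positivity)
    have h' := sqrt_two_pow_pos n
    rw [← div_eq_mul_inv, div_eq_iff (by positivity)]
    nth_rw 3 [← h]
    field_simp
  · intro x
    field_simp; ring

theorem localize_transplant {n : ℕ} (j : Fin (2 ^ n)) (f : H) :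
    localize n j (transplant n j f) = f := by
  rw [← cls_coe f, transplant_cls j (Lp.memLp f), localize_cls j (memLp_transplant j (Lp.memLp f))]
  symm
  refine cls_congr (Lp.memLp f) ?_
  filter_upwards [ae_restrict_mem measurableSet_Ioo] with y hy
  have h : (2 : ℝ) ^ n * (((2 : ℝ) ^ n)⁻¹ * y + (j : ℕ) / 2 ^ n) + -(j : ℕ) = y := by
    field_simp; ring
  rw [h, ext0, Set.indicator_of_mem hy, inv_mul_cancel_left₀ (sqrt_two_pow_pos n).ne']

theorem localize_transplant_of_ne {n : ℕ} {j j' : Fin (2 ^ n)} (hne : j ≠ j') (f : H) :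
    localize n j (transplant n j' f) = 0 := by
  rw [← cls_coe f, transplant_cls j' (Lp.memLp f), localize_cls j (memLp_transplant j' (Lp.memLp f))]
  symm
  refine eq_cls_of_ae ((Lp.coeFn_zero _ _ _).trans ?_)
  filter_upwards [ae_restrict_mem measurableSet_Ioo] with y hy
  rw [ext0, Set.indicator_of_notMem, mul_zero, mul_zero]
  · rfl
  · rw [← mem_dyadic_iff]
    exact fun h => hne (dyadic_unique (dyadic_mem_iff.2 hy) h)

theorem transplant_localize {n : ℕ} (j : Fin (2 ^ n)) (f : H) :
    transplant n j (localize n j f) = cls ((dyadic n j).indicator f) := by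
  rw [← cls_coe f, localize_cls j (Lp.memLp f), transplant_cls j (memLp_localize j (Lp.memLp f)),
    cls_coe]
  congr 1
  funext x
  by_cases hx : x ∈ dyadic n j
  · have h : ((2 : ℝ) ^ n)⁻¹ * ((2 : ℝ) ^ n * x + -(j : ℕ)) + (j : ℕ) / 2 ^ n = x := by
      field_simp; ring
    rw [Set.indicator_of_mem hx, ext0, Set.indicator_of_mem (mem_dyadic_iff.1 hx), h,
      mul_inv_cancel_left₀ (sqrt_two_pow_pos n).ne']
  · rw [Set.indicator_of_notMem hx, ext0, Set.indicator_of_notMem (fun h => hx (mem_dyadic_iff.2 h)),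
      mul_zero]

theorem ae_mem_dyadic (n : ℕ) : ∀ᵐ x ∂unitMeasure, ∃ j : Fin (2 ^ n), x ∈ dyadic n j := by
  have h : ∀ᵐ x ∂unitMeasure, ∀ j : Fin (2 ^ n), x ≠ (((j : ℕ) : ℝ) + 1) / 2 ^ n :=
    ae_all_iff.2 fun j => ae_restrict_of_ae (Measure.ae_ne volume _)
  filter_upwards [ae_restrict_mem measurableSet_Ioo, h] with x hx hne
  obtain ⟨j, hj⟩ := exists_cell n ⟨hx.1, hx.2.le⟩
  exact ⟨j, hj.1, hj.2.lt_of_ne (hne j)⟩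

theorem ext_localize {n : ℕ} {u w : H} (h : ∀ j, localize n j u = localize n j w) : u = w := by
  have h1 : ∀ j : Fin (2 ^ n), (dyadic n j).indicator u =ᵐ[unitMeasure] (dyadic n j).indicator w := by
    intro j
    have h2 := congrArg (transplant n j) (h j)
    rw [transplant_localize, transplant_localize] at h2
    have hm : ∀ v : H, MemLp ((dyadic n j).indicator v) 2 unitMeasure := fun v =>
      (Lp.memLp v).indicator measurableSet_Ioo
    have h3 := cls_ae (hm u)
    rw [h2] at h3
    exact h3.symm.trans (cls_ae (hm w))
  refine Lp.ext ?_
  filter_upwards [ae_all_iff.2 h1, ae_mem_dyadic n] with x hx ⟨j, hj⟩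
  simpa [hj] using hx j

/-- The operator that acts as `A` on each dyadic interval of level `n`, after rescaling
to `(0,1)`. -/
def rescale (n : ℕ) (A : H →L[ℝ] H) : H →L[ℝ] H :=
  ∑ j, transplant n j * A * localize n j

theorem rescale_apply (n : ℕ) (A : H →L[ℝ] H) (f : H) :
    rescale n A f = ∑ j, transplant n j (A (localize n j f)) := by
  simp [rescale]

theorem localize_rescale {n : ℕ} (j : Fin (2 ^ n)) (A : H →L[ℝ] H) (f : H) :
    localize n j (rescale n A f) = A (localize n j f) := by
  rw [rescale_apply, map_sum, Finset.sum_eq_single j, localize_transplant]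
  · intro j' _ hj'
    exact localize_transplant_of_ne hj'.symm _
  · simp

theorem rescale_mul (n : ℕ) (A A' : H →L[ℝ] H) : rescale n (A * A') = rescale n A * rescale n A' :=
  ContinuousLinearMap.ext fun f => ext_localize (n := n) fun j => by
    simp only [mul_apply_eq_comp, localize_rescale]

theorem rescale_one (n : ℕ) : rescale n 1 = 1 :=
  ContinuousLinearMap.ext fun f => ext_localize (n := n) fun j => by
    rw [localize_rescale]; rfl

theorem rescale_sub (n : ℕ) (A A' : H →L[ℝ] H) : rescale n (A - A') = rescale n A - rescale n A' :=
  ContinuousLinearMap.ext fun f => ext_localize (n := n) fun j => by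
    simp only [sub_apply, map_sub, localize_rescale]

theorem inner_eq_sum_localize (n : ℕ) (f g : H) :
    inner ℝ f g = ∑ j, inner ℝ (localize n j f) (localize n j g) := by
  have h : f = ∑ j, transplant n j (localize n j f) := by
    have := rescale_apply n 1 f
    rw [rescale_one] at this
    exact this
  conv_lhs => rw [h]
  rw [sum_inner]
  exact Finset.sum_congr rfl fun j _ => inner_transplant_left j _ _

theorem norm_sq_eq_sum_localize (n : ℕ) (f : H) : ‖f‖ ^ 2 = ∑ j, ‖localize n j f‖ ^ 2 := by
  rw [← real_inner_self_eq_norm_sq, inner_eq_sum_localize n]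
  exact Finset.sum_congr rfl fun j _ => real_inner_self_eq_norm_sq _

theorem norm_rescale_le (n : ℕ) (A : H →L[ℝ] H) : ‖rescale n A‖ ≤ ‖A‖ := by
  refine ContinuousLinearMap.opNorm_le_bound _ (norm_nonneg _) fun f => ?_
  refine abs_le_of_sq_le_sq' ?_ (by positivity) |>.2
  rw [mul_pow, norm_sq_eq_sum_localize n, norm_sq_eq_sum_localize n f, Finset.mul_sum]
  refine Finset.sum_le_sum fun j _ => ?_
  rw [localize_rescale, ← mul_pow]
  exact pow_le_pow_left₀ (norm_nonneg _) (A.le_opNorm _) 2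

theorem inner_rescale_left (n : ℕ) {A A' : H →L[ℝ] H}
    (h : ∀ f g, inner ℝ (A f) g = inner ℝ f (A' g)) (f g : H) :
    inner ℝ (rescale n A f) g = inner ℝ f (rescale n A' g) := by
  rw [inner_eq_sum_localize n, inner_eq_sum_localize n f]
  exact Finset.sum_congr rfl fun j _ => by rw [localize_rescale, localize_rescale, h]

/-- The restriction of functions on `(0,1)` to a dyadic interval, extended by zero. -/
def cutoff (n : ℕ) (j : Fin (2 ^ n)) : H →L[ℝ] H := transplant n j * localize n j

theorem cutoff_apply {n : ℕ} (j : Fin (2 ^ n)) (f : H) :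
    cutoff n j f = cls ((dyadic n j).indicator f) := transplant_localize j f

theorem rescale_mul_cutoff {n : ℕ} (j : Fin (2 ^ n)) (A : H →L[ℝ] H) :
    rescale n A * cutoff n j = cutoff n j * rescale n A :=
  ContinuousLinearMap.ext fun f => ext_localize (n := n) fun j' => by
    simp only [mul_apply_eq_comp, cutoff, localize_rescale]
    rcases eq_or_ne j' j with rfl | h
    · simp only [localize_transplant]
    · simp only [localize_transplant_of_ne h, map_zero]

/-! ### The projections onto piecewise polynomials of one variable -/

/-- The orthogonal projection of `L²(0,1)` onto the polynomials of degree less than `a`. -/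
def polProj (a : ℕ) : H →L[ℝ] H := (Pol a).starProjection

theorem inner_polProj_left (a : ℕ) (f g : H) : inner ℝ (polProj a f) g = inner ℝ f (polProj a g) :=
  Submodule.inner_starProjection_left_eq_right _ _ _

/-- The orthogonal projection of `L²(0,1)` onto the piecewise polynomials of degree at most `k`
on the dyadic intervals of level `n`. -/
def pwProj (k n : ℕ) : H →L[ℝ] H := rescale n (polProj (k + 1))

theorem inner_pwProj_left (k n : ℕ) (f g : H) :
    inner ℝ (pwProj k n f) g = inner ℝ f (pwProj k n g) :=
  inner_rescale_left n (inner_polProj_left _) f g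

theorem pwProj_mul_self (k n : ℕ) : pwProj k n * pwProj k n = pwProj k n := by
  rw [pwProj, ← rescale_mul]
  congr 1
  exact Submodule.isIdempotentElem_starProjection _

theorem norm_pwProj_le (k n : ℕ) : ‖pwProj k n‖ ≤ 1 :=
  (norm_rescale_le n _).trans (Submodule.starProjection_norm_le _)

theorem memLp_of_mem_V {k n : ℕ} {g : ℝ → ℝ} (hg : g ∈ V k n) : MemLp g 2 unitMeasure := by
  obtain ⟨-, hg⟩ := hg
  choose p hp hgp using hg
  have h : MemLp (∑ j : Fin (2 ^ n), (dyadic n j).indicator fun x => (p j).eval x) 2 unitMeasure :=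
    memLp_finsetSum' _ fun j _ => (memLp_poly (p j)).indicator measurableSet_Ioo
  refine (memLp_congr_ae ?_).1 h
  filter_upwards [ae_mem_dyadic n] with x ⟨j, hj⟩
  rw [Finset.sum_apply, Finset.sum_eq_single j]
  · rw [Set.indicator_of_mem hj, hgp j x ⟨hj.1, hj.2.le⟩]
  · intro j' _ hne
    exact Set.indicator_of_notMem (fun h => hne (dyadic_unique h hj)) _
  · simp

theorem mem_degreeLT_succ_iff {k : ℕ} {p : Polynomial ℝ} :
    p ∈ Polynomial.degreeLT ℝ (k + 1) ↔ p.natDegree ≤ k := by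
  rw [Polynomial.mem_degreeLT, Polynomial.degree_lt_iff_coeff_zero,
    Polynomial.natDegree_le_iff_coeff_eq_zero]
  rfl

theorem natDegree_affine_le {k : ℕ} {p : Polynomial ℝ} (hp : p.natDegree ≤ k) (c a b : ℝ) :
    (Polynomial.C c * p.comp (Polynomial.C a * Polynomial.X + Polynomial.C b)).natDegree ≤ k := by
  refine (Polynomial.natDegree_C_mul_le _ _).trans (Polynomial.natDegree_comp_le.trans ?_)
  exact (Nat.mul_le_mul hp Polynomial.natDegree_linear_le).trans (mul_one k).le

theorem localize_mem_Pol {k n : ℕ} {g : ℝ → ℝ} (hg : g ∈ V k n) (j : Fin (2 ^ n)) :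
    localize n j (cls g) ∈ Pol (k + 1) := by
  obtain ⟨p, hp, hgp⟩ := hg.2 j
  rw [localize_cls j (memLp_of_mem_V hg)]
  refine ⟨Polynomial.C (√((2 : ℝ) ^ n))⁻¹ * p.comp (Polynomial.C ((2 : ℝ) ^ n)⁻¹ * Polynomial.X +
    Polynomial.C (((j : ℕ) : ℝ) / 2 ^ n)), mem_degreeLT_succ_iff.2 (natDegree_affine_le hp _ _ _), ?_⟩
  symm
  refine cls_congr (memLp_localize j (memLp_of_mem_V hg)) ?_
  filter_upwards [ae_restrict_mem measurableSet_Ioo] with y hy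
  have := (dyadic_mem_iff (j := j)).2 hy
  rw [hgp _ ⟨this.1, this.2.le⟩]
  simp

/-- The projection `pwProj k n` fixes the functions in `V k n`. -/
theorem pwProj_cls {k n : ℕ} {g : ℝ → ℝ} (hg : g ∈ V k n) : pwProj k n (cls g) = cls g :=
  ext_localize fun j => by
    rw [pwProj, localize_rescale]
    exact Submodule.starProjection_eq_self_iff.2 (localize_mem_Pol hg j)

/-- The projection `pwProj k n` takes its values in the classes of functions in `V k n`. -/
theorem exists_mem_V (k n : ℕ) (f : H) : ∃ g ∈ V k n, pwProj k n f = cls g := by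
  have h : ∀ j : Fin (2 ^ n), ∃ g ∈ V k n, transplant n j (polProj (k + 1) (localize n j f)) = cls g := by
    intro j
    obtain ⟨p, hp, hpf⟩ := Submodule.starProjection_apply_mem (Pol (k + 1)) (localize n j f)
    refine ⟨(Set.Ioc (((j : ℕ) : ℝ) / 2 ^ n) ((((j : ℕ) : ℝ) + 1) / 2 ^ n)).indicator
      fun x => √((2 : ℝ) ^ n) * p.eval (2 ^ n * x + -(j : ℕ)), ⟨?_, ?_⟩, ?_⟩
    · intro x hx
      refine Set.indicator_of_notMem (fun h => hx ?_) _
      have h2 : (0 : ℝ) < 2 ^ n := by positivity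
      have h1 : ((j : ℕ) : ℝ) + 1 ≤ 2 ^ n := by exact_mod_cast j.2
      exact ⟨lt_of_le_of_lt (by positivity) h.1, h.2.trans ((div_le_one h2).2 h1)⟩
    · intro j'
      rcases eq_or_ne j' j with rfl | hne
      · refine ⟨Polynomial.C √((2 : ℝ) ^ n) * p.comp (Polynomial.C ((2 : ℝ) ^ n) * Polynomial.X +
          Polynomial.C (-((j' : ℕ) : ℝ))), natDegree_affine_le (mem_degreeLT_succ_iff.1 hp) _ _ _,
          fun x hx => ?_⟩
        rw [Set.indicator_of_mem hx]
        simp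
      · refine ⟨0, by simp, fun x hx => ?_⟩
        rw [Set.indicator_of_notMem (fun h => hne (halfOpen_unique hx h))]
        simp
    · rw [polProj, ← hpf]
      change transplant n j (cls _) = _
      rw [transplant_cls j (memLp_poly p)]
      refine cls_congr (memLp_transplant j (memLp_poly p)) ?_
      filter_upwards [ae_mem_dyadic n] with x ⟨i, hi⟩
      by_cases hx : x ∈ dyadic n j
      · have hx' : x ∈ Set.Ioc (((j : ℕ) : ℝ) / 2 ^ n) ((((j : ℕ) : ℝ) + 1) / 2 ^ n) :=
          ⟨hx.1, hx.2.le⟩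
        rw [ext0, Set.indicator_of_mem (mem_dyadic_iff.1 hx), Set.indicator_of_mem hx']
      · rw [ext0, Set.indicator_of_notMem (fun h => hx (mem_dyadic_iff.2 h)),
          Set.indicator_of_notMem, mul_zero]
        intro h
        exact hx (halfOpen_unique h ⟨hi.1, hi.2.le⟩ ▸ hi)
  choose g hg hgf using h
  refine ⟨∑ j, g j, Submodule.sum_mem _ fun j _ => hg j, ?_⟩
  rw [pwProj, rescale_apply]
  simp_rw [hgf]
  have : ∀ s : Finset (Fin (2 ^ n)), ∑ j ∈ s, cls (g j) = cls (∑ j ∈ s, g j) := by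
    intro s
    induction s using Finset.cons_induction with
    | empty =>
      rw [Finset.sum_empty, Finset.sum_empty]
      exact eq_cls_of_ae (Lp.coeFn_zero _ _ _)
    | cons a s ha ih =>
      rw [Finset.sum_cons, Finset.sum_cons, ih, cls_add (memLp_of_mem_V (hg a))
        (memLp_finsetSum' _ fun j _ => memLp_of_mem_V (hg j))]
  exact this _

/-- Each cell of level `n + 1` lies in a cell of level `n`. -/
theorem halfOpen_subset {n : ℕ} (j : Fin (2 ^ (n + 1))) : ∃ i : Fin (2 ^ n),
    Set.Ioc (((j : ℕ) : ℝ) / 2 ^ (n + 1)) ((((j : ℕ) : ℝ) + 1) / 2 ^ (n + 1)) ⊆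
      Set.Ioc (((i : ℕ) : ℝ) / 2 ^ n) ((((i : ℕ) : ℝ) + 1) / 2 ^ n) := by
  obtain ⟨j, hj⟩ := j
  have hj' : j < 2 ^ n * 2 := by rwa [pow_succ] at hj
  refine ⟨⟨j / 2, by omega⟩, Set.Ioc_subset_Ioc ?_ ?_⟩
  · have h1 : (2 * ((j / 2 : ℕ) : ℝ)) ≤ j := by exact_mod_cast Nat.mul_div_le j 2
    change ((j / 2 : ℕ) : ℝ) / 2 ^ n ≤ (j : ℝ) / 2 ^ (n + 1)
    rw [div_le_div_iff₀ (by positivity) (by positivity), pow_succ]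
    nlinarith [show (0 : ℝ) < 2 ^ n by positivity]
  · have h3 : (j : ℝ) + 1 ≤ 2 * ((j / 2 : ℕ) : ℝ) + 2 := by
      exact_mod_cast (by omega : j + 1 ≤ 2 * (j / 2) + 2)
    change ((j : ℝ) + 1) / 2 ^ (n + 1) ≤ (((j / 2 : ℕ) : ℝ) + 1) / 2 ^ n
    rw [div_le_div_iff₀ (by positivity) (by positivity), pow_succ]
    nlinarith [show (0 : ℝ) < 2 ^ n by positivity]

theorem V_le_succ (k n : ℕ) : V k n ≤ V k (n + 1) := by
  rintro g ⟨h0, hg⟩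
  refine ⟨h0, fun j => ?_⟩
  obtain ⟨i, hi⟩ := halfOpen_subset j
  obtain ⟨p, hp, hgp⟩ := hg i
  exact ⟨p, hp, fun x hx => hgp x (hi hx)⟩

theorem V_mono (k : ℕ) {n m : ℕ} (h : n ≤ m) : V k n ≤ V k m :=
  monotone_nat_of_le_succ (V_le_succ k) h

theorem pwProj_mul_of_le (k : ℕ) {n m : ℕ} (h : n ≤ m) :
    pwProj k m * pwProj k n = pwProj k n :=
  ContinuousLinearMap.ext fun f => by
    obtain ⟨g, hg, hgf⟩ := exists_mem_V k n f
    rw [mul_apply_eq_comp, hgf, pwProj_cls (V_mono k h hg)]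

theorem pwProj_mul_of_ge (k : ℕ) {n m : ℕ} (h : n ≤ m) :
    pwProj k n * pwProj k m = pwProj k n :=
  ContinuousLinearMap.ext fun f => ext_inner_left ℝ fun g => by
    rw [mul_apply_eq_comp, ← inner_pwProj_left, ← inner_pwProj_left, ← mul_apply_eq_comp,
      pwProj_mul_of_le k h, inner_pwProj_left]

/-! ### Representation of the projection error by the weak derivative -/

theorem transplant_test {n : ℕ} (j : Fin (2 ^ n)) {θ : ℝ → ℝ} (hθ : IsTest θ) :
    IsTest fun x => √((2 : ℝ) ^ n) * θ (2 ^ n * x + -(j : ℕ)) := by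
  have h2 : (0 : ℝ) < 2 ^ n := by positivity
  let e : ℝ ≃ₜ ℝ := (Homeomorph.mulLeft₀ ((2 : ℝ) ^ n) h2.ne').trans
    (Homeomorph.addRight (-((j : ℕ) : ℝ)))
  have he : ∀ x, e x = 2 ^ n * x + -(j : ℕ) := fun x => rfl
  have hts : tsupport (θ ∘ e) = e ⁻¹' tsupport θ := tsupport_comp_eq_preimage θ e
  have hc : HasCompactSupport (θ ∘ e) := hθ.compact.comp_homeomorph e
  have hsub : Function.support (fun x => √((2 : ℝ) ^ n) * θ (2 ^ n * x + -(j : ℕ))) ⊆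
      Function.support (θ ∘ e) := fun x hx h => hx (by
    change √((2 : ℝ) ^ n) * (θ ∘ e) x = 0
    rw [h, mul_zero])
  refine ⟨contDiff_const.mul (hθ.smooth.comp (by fun_prop)), hc.mono hsub, ?_⟩
  refine (closure_mono hsub).trans ?_
  change tsupport (θ ∘ e) ⊆ _
  rw [hts]
  exact fun x hx => dyadic_subset n j (mem_dyadic_iff.2 (hθ.supp hx))

theorem transplant_cls_test {n : ℕ} (j : Fin (2 ^ n)) {θ : ℝ → ℝ} (hθ : IsTest θ) :
    transplant n j (cls θ) = cls fun x => √((2 : ℝ) ^ n) * θ (2 ^ n * x + -(j : ℕ)) := by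
  rw [transplant_cls j hθ.memLp]
  congr 1
  funext x
  rw [ext0, Set.indicator_eq_self.2]
  intro y hy
  by_contra h
  exact hy (hθ.eq_zero h)

theorem iteratedDeriv_affine {θ : ℝ → ℝ} (hθ : ContDiff ℝ ∞ θ) (c r b : ℝ) (a : ℕ) :
    iteratedDeriv a (fun x => c * θ (r * x + b)) =
      fun x => r ^ a * (c * iteratedDeriv a θ (r * x + b)) := by
  induction a with
  | zero => simp
  | succ a ih =>
    rw [iteratedDeriv_succ, ih]
    funext x
    have h1 : HasDerivAt (iteratedDeriv a θ) (iteratedDeriv (a + 1) θ (r * x + b)) (r * x + b) := by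
      rw [iteratedDeriv_succ]
      exact ((hθ.differentiable_iteratedDeriv a (by exact_mod_cast ENat.natCast_lt_top a))
        _).hasDerivAt
    have h2 : HasDerivAt (fun x => r * x + b) r x := by
      simpa using ((hasDerivAt_id x).const_mul r).add_const b
    have h3 : HasDerivAt (fun x => r ^ a * (c * iteratedDeriv a θ (r * x + b)))
        (r ^ a * (c * (iteratedDeriv (a + 1) θ (r * x + b) * r))) x :=
      ((h1.comp x h2).const_mul c).const_mul (r ^ a)
    rw [h3.deriv]
    ring

theorem transplant_mem_testGraph {n : ℕ} (j : Fin (2 ^ n)) {a : ℕ} {z : H × H}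
    (hz : z ∈ (testGraph a).topologicalClosure) :
    (transplant n j z.1, (((2 : ℝ) ^ n) ^ a)⁻¹ • transplant n j z.2) ∈
      (testGraph a).topologicalClosure := by
  refine map_mem_closure (f := fun z : H × H =>
    (transplant n j z.1, (((2 : ℝ) ^ n) ^ a)⁻¹ • transplant n j z.2)) (by fun_prop) hz ?_
  rintro _ ⟨θ, hθ, rfl⟩
  refine ⟨_, (transplant_test j hθ).const_smul ((((2 : ℝ) ^ n) ^ a)⁻¹), Prod.ext ?_ ?_⟩
  · simp only
    rw [transplant_cls_test j (hθ.iteratedDeriv a)]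
    congr 1
    funext x
    rw [iteratedDeriv_const_smul_field, iteratedDeriv_affine hθ.smooth, smul_eq_mul]
    field_simp
  · simp only
    rw [transplant_cls_test j hθ, cls_smul _ (transplant_test j hθ).memLp]

/-- The operator with `∂^a ∘ errPrim k n a = 1 - pwProj k n`: the `a`-fold antiderivative of
the projection error, taken on each dyadic interval of level `n`. For `a ≤ k + 1` it vanishes to
order `a` at the end points of these intervals, because the error is orthogonal to `Pol a`. -/
def errPrim (k n a : ℕ) : H →L[ℝ] H :=
  (((2 : ℝ) ^ n) ^ a)⁻¹ • rescale n (headInt ^ a * (1 - polProj (k + 1)))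

theorem errPrim_mem_testGraph {k a : ℕ} (n : ℕ) (ha : a ≤ k + 1) (f : H) :
    ((1 - pwProj k n) f, errPrim k n a f) ∈ (testGraph a).topologicalClosure := by
  have h : ∀ j : Fin (2 ^ n), (transplant n j ((1 - polProj (k + 1)) (localize n j f)),
      (((2 : ℝ) ^ n) ^ a)⁻¹ • transplant n j ((headInt ^ a * (1 - polProj (k + 1)))
        (localize n j f))) ∈ (testGraph a).topologicalClosure := by
    intro j
    have h0 : (1 - polProj (k + 1)) (localize n j f) ∈ (Pol a)ᗮ :=
      Submodule.orthogonal_le (Pol_mono ha) (Submodule.sub_starProjection_mem_orthogonal _)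
    have h1 := transplant_mem_testGraph j (mem_closure_testGraph h0)
    rw [mul_apply_eq_comp]
    exact h1
  have h2 : ∀ u w : Fin (2 ^ n) → H, (∀ j, (u j, w j) ∈ (testGraph a).topologicalClosure) →
      (∑ j, u j, ∑ j, w j) ∈ (testGraph a).topologicalClosure := fun u w huw => by
    have := Submodule.sum_mem (t := Finset.univ) _ fun j _ => huw j
    rwa [show ∑ j, (u j, w j) = (∑ j, u j, ∑ j, w j) from Prod.ext Prod.fst_sum Prod.snd_sum] at this
  have hs := h2 _ _ h
  rw [← Finset.smul_sum, ← rescale_apply, ← rescale_apply] at hs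
  have h1 : 1 - pwProj k n = rescale n (1 - polProj (k + 1)) := by
    rw [rescale_sub, rescale_one]; rfl
  rw [h1]
  exact hs

/-- The adjoint of `errPrim`; up to sign it maps the `a`-th weak derivative of a function
to the error of its projection. -/
def errRep (k n a : ℕ) : H →L[ℝ] H :=
  (((2 : ℝ) ^ n) ^ a)⁻¹ • rescale n ((1 - polProj (k + 1)) * tailInt ^ a)

theorem inner_errPrim_left (k n a : ℕ) (f g : H) :
    inner ℝ (errPrim k n a f) g = inner ℝ f (errRep k n a g) := by
  rw [errPrim, errRep, smul_apply, smul_apply, real_inner_smul_left, real_inner_smul_right]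
  congr 1
  refine inner_rescale_left n (fun f g => ?_) f g
  rw [mul_apply_eq_comp, mul_apply_eq_comp, inner_headInt_pow_left]
  simp only [sub_apply, inner_sub_left, inner_sub_right, one_apply_eq_self, inner_polProj_left]

theorem norm_one_sub_polProj_le (a : ℕ) : ‖1 - polProj a‖ ≤ 1 := by
  rw [polProj, ← Submodule.starProjection_orthogonal']
  exact Submodule.starProjection_norm_le _

theorem norm_tailInt_pow_le (a : ℕ) : ‖tailInt ^ a‖ ≤ 1 := by
  rcases a with _ | a
  · exact ContinuousLinearMap.norm_id_le
  · exact (norm_pow_le' _ a.succ_pos).trans (pow_le_one₀ (norm_nonneg _) norm_tailInt_le)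

theorem norm_errRep_le (k n a : ℕ) : ‖errRep k n a‖ ≤ (((2 : ℝ) ^ n) ^ a)⁻¹ := by
  rw [errRep, norm_smul, Real.norm_of_nonneg (by positivity)]
  refine mul_le_of_le_one_right (by positivity) ((norm_rescale_le _ _).trans ?_)
  exact (norm_mul_le _ _).trans (mul_le_one₀ (norm_one_sub_polProj_le _) (norm_nonneg _)
    (norm_tailInt_pow_le a))

theorem errRep_mul_cutoff {n : ℕ} (k a : ℕ) (j : Fin (2 ^ n)) :
    errRep k n a * cutoff n j = cutoff n j * errRep k n a := by
  rw [errRep, smul_mul_assoc, rescale_mul_cutoff, mul_smul_comm]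

/-! ### Differentiation of piecewise polynomials -/

theorem contDiff_poly (p : Polynomial ℝ) : ContDiff ℝ ∞ fun x => p.eval x := by
  simpa [Polynomial.coe_aeval_eq_eval] using p.contDiff_aeval (R := ℝ) (𝕜 := ℝ) ∞

theorem exists_polyL_section (a : ℕ) : ∃ r : Pol a →ₗ[ℝ] Polynomial ℝ, ∀ u, polyL (r u) = u := by
  obtain ⟨g, hg⟩ := (polyL.submoduleMap (Polynomial.degreeLT ℝ a)).exists_rightInverse_of_surjective
    (LinearMap.range_eq_top.2 (polyL.submoduleMap_surjective _))
  refine ⟨(Polynomial.degreeLT ℝ a).subtype ∘ₗ g, fun u => ?_⟩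
  exact congrArg Subtype.val (LinearMap.congr_fun hg u)

/-- A linear choice of polynomials representing the classes in `Pol a`. -/
def polyRep (a : ℕ) : Pol a →ₗ[ℝ] Polynomial ℝ := (exists_polyL_section a).choose

theorem polyL_polyRep {a : ℕ} (u : Pol a) : polyL (polyRep a u) = u :=
  (exists_polyL_section a).choose_spec u

/-- The derivative of the projection onto polynomials of degree at most `k`. The mean value is
subtracted first, so that constants are mapped to `0` whatever the choice of representatives. -/
def polDeriv (k : ℕ) : H →L[ℝ] H :=
  (LinearMap.toContinuousLinearMap
    (polyL ∘ₗ Polynomial.derivative ∘ₗ polyRep (k + 1))) ∘L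
    (Pol (k + 1)).orthogonalProjectionOnto ∘L (1 - polProj 1)

/-- The operators `A` and `A'` satisfy `(A f)' = A' f` on the set `I` for smooth `f`. -/
def IsDerivOn (I : Set ℝ) (A A' : H →L[ℝ] H) : Prop :=
  ∀ f : ℝ → ℝ, ContDiff ℝ ∞ f → ∃ F : ℝ → ℝ, ContDiff ℝ ∞ F ∧
    (∀ᵐ x ∂unitMeasure, x ∈ I → A (cls f) x = F x) ∧
    (∀ᵐ x ∂unitMeasure, x ∈ I → A' (cls f) x = deriv F x)

theorem IsDerivOn.mono {I I' : Set ℝ} {A A' : H →L[ℝ] H} (h : IsDerivOn I A A') (hI : I' ⊆ I) :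
    IsDerivOn I' A A' := fun f hf => by
  obtain ⟨F, hF, h1, h2⟩ := h f hf
  exact ⟨F, hF, h1.mono fun x hx hxI => hx (hI hxI), h2.mono fun x hx hxI => hx (hI hxI)⟩

theorem IsDerivOn.const_smul {I : Set ℝ} {A A' : H →L[ℝ] H} (h : IsDerivOn I A A') (c : ℝ) :
    IsDerivOn I (c • A) (c • A') := fun f hf => by
  obtain ⟨F, hF, h1, h2⟩ := h f hf
  refine ⟨c • F, hF.const_smul c, ?_, ?_⟩
  · filter_upwards [h1, Lp.coeFn_smul c (A (cls f))] with x hx hc hxI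
    rw [smul_apply, hc, Pi.smul_apply, hx hxI, Pi.smul_apply]
  · filter_upwards [h2, Lp.coeFn_smul c (A' (cls f))] with x hx hc hxI
    rw [smul_apply, hc, Pi.smul_apply, hx hxI,
      ((hF.differentiable (by simp) x).hasDerivAt.const_smul c).deriv]

/-- If `A f = F` and `A' f = F'` for smooth `f`, with `F` smooth, then the rescaled operators have
the corresponding property on each dyadic interval. -/
theorem isDerivOn_rescale {A A' : H →L[ℝ] H}
    (h : ∀ f : ℝ → ℝ, ContDiff ℝ ∞ f → ∃ F : ℝ → ℝ, ContDiff ℝ ∞ F ∧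
      A (cls f) = cls F ∧ A' (cls f) = cls (deriv F)) (n : ℕ) (j : Fin (2 ^ n)) :
    IsDerivOn (dyadic n j) (rescale n A) ((2 : ℝ) ^ n • rescale n A') := by
  intro f hf
  set fj : ℝ → ℝ := fun y => (√((2 : ℝ) ^ n))⁻¹ * f ((2 ^ n)⁻¹ * y + (j : ℕ) / 2 ^ n) with hfj
  have hfjs : ContDiff ℝ ∞ fj := contDiff_const.mul (hf.comp (by fun_prop))
  obtain ⟨F, hF, h1, h2⟩ := h fj hfjs
  have hcell : ∀ (B : H →L[ℝ] H) (G : ℝ → ℝ), Continuous G → B (cls fj) = cls G →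
      ∀ᵐ x ∂unitMeasure, x ∈ dyadic n j →
        rescale n B (cls f) x = √((2 : ℝ) ^ n) * G (2 ^ n * x + -(j : ℕ)) := by
    intro B G hG hB
    have e1 : cutoff n j (rescale n B (cls f)) = transplant n j (cls G) := by
      rw [cutoff, mul_apply_eq_comp, localize_rescale, localize_cls j
        (memLp_of_continuous hf.continuous), hB]
    rw [cutoff_apply, transplant_cls j (memLp_of_continuous hG)] at e1
    have e2 := cls_ae (f := (dyadic n j).indicator (rescale n B (cls f)))
      ((Lp.memLp _).indicator measurableSet_Ioo)
    rw [e1] at e2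
    filter_upwards [e2, cls_ae (memLp_transplant j (memLp_of_continuous hG))] with x hx hx' hxI
    rw [Set.indicator_of_mem hxI] at hx
    rw [← hx, hx', ext0, Set.indicator_of_mem (mem_dyadic_iff.1 hxI)]
  have hFc : Continuous F := hF.continuous
  have hF' : Continuous (deriv F) := (contDiff_infty_iff_deriv.1 hF).2.continuous
  refine ⟨fun x => √((2 : ℝ) ^ n) * F (2 ^ n * x + -(j : ℕ)),
    contDiff_const.mul (hF.comp (by fun_prop)), hcell A F hFc h1, ?_⟩
  filter_upwards [hcell A' (deriv F) hF' h2,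
    Lp.coeFn_smul ((2 : ℝ) ^ n) (rescale n A' (cls f))] with x hx hc hxI
  rw [smul_apply, hc, Pi.smul_apply, hx hxI]
  have e1 : HasDerivAt (fun x : ℝ => (2 : ℝ) ^ n * x + -(j : ℕ)) (2 ^ n) x := by
    simpa using ((hasDerivAt_id x).const_mul ((2 : ℝ) ^ n)).add_const (-((j : ℕ) : ℝ))
  have e2 := (hF.differentiable (by simp) (2 ^ n * x + -(j : ℕ))).hasDerivAt
  have e3 : HasDerivAt (fun x : ℝ => √((2 : ℝ) ^ n) * F (2 ^ n * x + -(j : ℕ)))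
      (√((2 : ℝ) ^ n) * (deriv F (2 ^ n * x + -(j : ℕ)) * 2 ^ n)) x :=
    (e2.comp x e1).const_mul _
  rw [e3.deriv, smul_eq_mul]
  ring

theorem polProj_isDeriv (k : ℕ) (f : H) : ∃ p : Polynomial ℝ,
    polProj (k + 1) f = polyL p ∧ polDeriv k f = polyL (Polynomial.derivative p) := by
  obtain ⟨p0, hp0, h0⟩ := Submodule.starProjection_apply_mem (Pol 1) f
  set u := (Pol (k + 1)).orthogonalProjectionOnto ((1 - polProj 1) f)
  refine ⟨polyRep (k + 1) u + p0, ?_, ?_⟩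
  · have h1 : polProj (k + 1) (polProj 1 f) = polProj 1 f :=
      Submodule.starProjection_eq_self_iff.2
        (Pol_mono (by omega) (Submodule.starProjection_apply_mem (Pol 1) f))
    have h2 : (u : H) = polProj (k + 1) ((1 - polProj 1) f) := rfl
    rw [map_add, polyL_polyRep, h2, h0, sub_apply, map_sub]
    change _ = _ - polProj (k + 1) (polProj 1 f) + polProj 1 f
    rw [h1]
    simp
  · have h3 : Polynomial.derivative p0 = 0 := by
      have := mem_degreeLT_succ_iff.1 hp0
      rw [Polynomial.eq_C_of_natDegree_le_zero this, Polynomial.derivative_C]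
    rw [map_add, h3, add_zero]
    rfl

theorem polDeriv_mul_polProj (k : ℕ) : polDeriv k * polProj 1 = 0 := by
  refine ContinuousLinearMap.ext fun f => ?_
  have : (1 - polProj 1) (polProj 1 f) = 0 := by
    rw [sub_apply, sub_eq_zero]
    exact (Submodule.starProjection_eq_self_iff.2
      (Submodule.starProjection_apply_mem (Pol 1) f)).symm
  rw [mul_apply_eq_comp, polDeriv, ContinuousLinearMap.comp_apply, ContinuousLinearMap.comp_apply,
    this]
  simp

/-- The derivative, on the dyadic intervals of level `n`, of the projection `pwProj k n`. -/
def pwDeriv (k n : ℕ) : H →L[ℝ] H := (2 : ℝ) ^ n • rescale n (polDeriv k)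

theorem norm_pwDeriv_le (k n : ℕ) : ‖pwDeriv k n‖ ≤ 2 ^ n * ‖polDeriv k‖ := by
  rw [pwDeriv, norm_smul, Real.norm_of_nonneg (by positivity)]
  exact mul_le_mul_of_nonneg_left (norm_rescale_le _ _) (by positivity)

theorem pwDeriv_mul_pwProj_zero (k n : ℕ) : pwDeriv k n * pwProj 0 n = 0 := by
  rw [pwDeriv, pwProj, smul_mul_assoc, ← rescale_mul, zero_add, polDeriv_mul_polProj]
  have : rescale n 0 = 0 := by simpa using rescale_sub n 0 0
  rw [this, smul_zero]

theorem isDerivOn_pwProj (k n : ℕ) (j : Fin (2 ^ n)) :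
    IsDerivOn (dyadic n j) (pwProj k n) (pwDeriv k n) := by
  refine isDerivOn_rescale (fun f _ => ?_) n j
  obtain ⟨p, h1, h2⟩ := polProj_isDeriv k (cls f)
  refine ⟨fun x => p.eval x, contDiff_poly p, h1, h2.trans ?_⟩
  change cls _ = _
  congr 1
  funext x
  exact p.deriv.symm

/-- The derivative of `errRep k n (a + 1)` on the dyadic intervals of level `n`: on the unit
interval, `tailInt ^ (a + 1)` has the derivative `-tailInt ^ a`, and rescaling to length `2⁻ⁿ`
replaces the factor `2^{-n(a+1)}` by `2^{-na}`. -/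
def errDeriv (k n a : ℕ) : H →L[ℝ] H :=
  (((2 : ℝ) ^ n) ^ a)⁻¹ • rescale n (-(tailInt ^ a) - polDeriv k * tailInt ^ (a + 1))

theorem norm_errDeriv_le (k n a : ℕ) :
    ‖errDeriv k n a‖ ≤ (((2 : ℝ) ^ n) ^ a)⁻¹ * (1 + ‖polDeriv k‖) := by
  rw [errDeriv, norm_smul, Real.norm_of_nonneg (by positivity)]
  refine mul_le_mul_of_nonneg_left ((norm_rescale_le _ _).trans ?_) (by positivity)
  refine (norm_sub_le _ _).trans (add_le_add ?_ ?_)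
  · rw [norm_neg]; exact norm_tailInt_pow_le a
  · exact (norm_mul_le _ _).trans
      (mul_le_of_le_one_right (norm_nonneg _) (norm_tailInt_pow_le _))

theorem errDeriv_mul_cutoff {n : ℕ} (k a : ℕ) (j : Fin (2 ^ n)) :
    errDeriv k n a * cutoff n j = cutoff n j * errDeriv k n a := by
  rw [errDeriv, smul_mul_assoc, rescale_mul_cutoff, mul_smul_comm]

theorem isDerivOn_errRep (k n a : ℕ) (j : Fin (2 ^ n)) :
    IsDerivOn (dyadic n j) (errRep k n (a + 1)) (errDeriv k n a) := by
  have hpow : ∀ (b : ℕ) (f : ℝ → ℝ), ContDiff ℝ ∞ f →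
      ∃ F, ContDiff ℝ ∞ F ∧ (tailInt ^ b) (cls f) = cls F := by
    intro b f hf
    induction b with
    | zero => exact ⟨f, hf, rfl⟩
    | succ b ih =>
      obtain ⟨F, hF, h⟩ := ih
      refine ⟨tailPrim F, contDiff_tailPrim hF, ?_⟩
      rw [pow_succ', mul_apply_eq_comp, h, tailInt_cls hF.continuous]
  have h := isDerivOn_rescale (A := (1 - polProj (k + 1)) * tailInt ^ (a + 1))
    (A' := -(tailInt ^ a) - polDeriv k * tailInt ^ (a + 1)) (fun f hf => ?_) n j
  · have h2 : errDeriv k n a = (((2 : ℝ) ^ n) ^ (a + 1))⁻¹ •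
        ((2 : ℝ) ^ n • rescale n (-(tailInt ^ a) - polDeriv k * tailInt ^ (a + 1))) := by
      rw [errDeriv, smul_smul]
      congr 1
      rw [pow_succ]
      field_simp
    rw [h2]
    exact h.const_smul _
  · obtain ⟨F, hF, hFa⟩ := hpow a f hf
    have hFa1 : (tailInt ^ (a + 1)) (cls f) = cls (tailPrim F) := by
      rw [pow_succ', mul_apply_eq_comp, hFa, tailInt_cls hF.continuous]
    obtain ⟨p, h1, h2⟩ := polProj_isDeriv k (cls (tailPrim F))
    have hG := contDiff_tailPrim hF
    have hd : deriv (tailPrim F + (-1 : ℝ) • fun x => p.eval x) =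
        (-1 : ℝ) • F + (-1 : ℝ) • fun x => (Polynomial.derivative p).eval x := by
      funext x
      rw [((hasDerivAt_tailPrim hF.continuous x).add
        ((p.hasDerivAt x).const_smul (-1 : ℝ))).deriv]
      simp
    refine ⟨tailPrim F + (-1 : ℝ) • fun x => p.eval x, hG.add ((contDiff_poly p).const_smul (-1 : ℝ)), ?_, ?_⟩
    · rw [mul_apply_eq_comp, hFa1, sub_apply, h1, cls_add (memLp_of_continuous hG.continuous)
        ((memLp_poly p).const_smul _), cls_smul _ (memLp_poly p), neg_one_smul, ← sub_eq_add_neg]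
      rfl
    · rw [sub_apply, mul_apply_eq_comp, hFa1, h2, hd, neg_apply, hFa,
        cls_add ((memLp_of_continuous hF.continuous).const_smul _) ((memLp_poly _).const_smul _),
        cls_smul _ (memLp_of_continuous hF.continuous), cls_smul _ (memLp_poly _), neg_one_smul,
        neg_one_smul, ← sub_eq_add_neg]
      rfl

/-! ### Weak derivatives tested against product functions -/

/-- The product function `x ↦ ∏ i, θ i (x i)`. -/
def prodFn {d : ℕ} (θ : Fin d → ℝ → ℝ) (x : Fin d → ℝ) : ℝ := ∏ i, θ i (x i)

theorem contDiff_prodFn {d : ℕ} {θ : Fin d → ℝ → ℝ} (h : ∀ i, ContDiff ℝ ∞ (θ i)) :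
    ContDiff ℝ ∞ (prodFn θ) :=
  contDiff_prod fun i _ => (h i).comp (contDiff_apply ℝ ℝ i)

theorem pderiv_prodFn {d : ℕ} {θ : Fin d → ℝ → ℝ} (h : ∀ i, ContDiff ℝ ∞ (θ i)) (i : Fin d) :
    pderiv i (prodFn θ) = prodFn (Function.update θ i (deriv (θ i))) := by
  funext x
  have h1 : ∀ j ∈ (Finset.univ : Finset (Fin d)), HasFDerivAt (fun x : Fin d → ℝ => θ j (x j))
      (deriv (θ j) (x j) • ContinuousLinearMap.proj (R := ℝ) (φ := fun _ : Fin d => ℝ) j) x := by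
    intro j _
    exact (((h j).differentiable (by simp) (x j)).hasDerivAt).comp_hasFDerivAt x
      (ContinuousLinearMap.proj (R := ℝ) (φ := fun _ : Fin d => ℝ) j).hasFDerivAt
  have h2 := HasFDerivAt.finsetProd h1
  have h3 : fderiv ℝ (prodFn θ) x = _ := h2.fderiv
  rw [pderiv, h3, sum_apply, Finset.sum_eq_single i, prodFn,
    ← Finset.prod_erase_mul _ _ (Finset.mem_univ i), Function.update_self]
  · simp only [smul_apply, ContinuousLinearMap.proj_apply, Pi.single_eq_same, smul_eq_mul, mul_one]
    congr 1
    refine Finset.prod_congr rfl fun j hj => ?_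
    rw [Function.update_of_ne (Finset.ne_of_mem_erase hj)]
  · intro j _ hj
    simp [hj]
  · simp

theorem pderiv_iterate_prodFn {d : ℕ} {θ : Fin d → ℝ → ℝ} (h : ∀ i, ContDiff ℝ ∞ (θ i))
    (i : Fin d) (a : ℕ) :
    (pderiv i)^[a] (prodFn θ) = prodFn (Function.update θ i (iteratedDeriv a (θ i))) := by
  induction a with
  | zero => simp
  | succ a ih =>
    rw [Function.iterate_succ_apply', ih, pderiv_prodFn]
    · simp [iteratedDeriv_succ]
    · intro j
      rcases eq_or_ne j i with rfl | hj
      · rw [Function.update_self]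
        rw [iteratedDeriv_eq_iterate]
        exact ContDiff.iterate_deriv a (h j)
      · rw [Function.update_of_ne hj]; exact h j

theorem mderiv_prodFn {d : ℕ} {θ : Fin d → ℝ → ℝ} (h : ∀ i, ContDiff ℝ ∞ (θ i)) (α : Fin d → ℕ) :
    mderiv α (prodFn θ) = prodFn fun i => iteratedDeriv (α i) (θ i) := by
  have key : ∀ l : List (Fin d), l.Nodup →
      l.foldr (fun i ψ => (pderiv i)^[α i] ψ) (prodFn θ) =
        prodFn fun i => if i ∈ l then iteratedDeriv (α i) (θ i) else θ i := by
    intro l hl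
    induction l with
    | nil => simp
    | cons a l ih =>
      rw [List.foldr_cons, ih (List.nodup_cons.1 hl).2, pderiv_iterate_prodFn]
      · congr 1
        funext j
        rcases eq_or_ne j a with rfl | hj
        · simp [(List.nodup_cons.1 hl).1]
        · simp [hj]
      · intro i
        split_ifs
        · rw [iteratedDeriv_eq_iterate]; exact ContDiff.iterate_deriv _ (h i)
        · exact h i
  rw [mderiv, key _ (List.nodup_finRange d)]
  simp

theorem isTestFunction_prodFn {d : ℕ} {θ : Fin d → ℝ → ℝ} (h : ∀ i, IsTest (θ i)) :
    IsTestFunction (cube d) (prodFn θ) := by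
  have hK : IsCompact (Set.pi Set.univ fun i => tsupport (θ i)) :=
    isCompact_univ_pi fun i => (h i).compact
  have hs : Function.support (prodFn θ) ⊆ Set.pi Set.univ fun i => tsupport (θ i) := by
    intro x hx i _
    by_contra hi
    exact hx (Finset.prod_eq_zero (Finset.mem_univ i) (image_eq_zero_of_notMem_tsupport hi))
  refine ⟨contDiff_prodFn fun i => (h i).smooth, HasCompactSupport.of_support_subset_isCompact hK hs,
    (closure_minimal hs hK.isClosed).trans fun x hx i => (h i).supp (hx i (Set.mem_univ i))⟩

theorem tens_cls_ae {d : ℕ} {θ : Fin d → ℝ → ℝ} (h : ∀ i, MemLp (θ i) 2 unitMeasure) :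
    tens (fun i => cls (θ i)) =ᵐ[volume.restrict (cube d)] prodFn θ :=
  tens_ae _ fun i => cls_ae (h i)

theorem inner_L2_eq {d : ℕ} {u w : L2 d} {f g : (Fin d → ℝ) → ℝ}
    (hf : u =ᵐ[volume.restrict (cube d)] f) (hg : w =ᵐ[volume.restrict (cube d)] g) :
    inner ℝ u w = ∫ x in cube d, f x * g x := by
  rw [L2.inner_def]
  apply integral_congr_ae
  filter_upwards [hf, hg] with x h1 h2
  simp [h1, h2, mul_comm]

/-- The weak derivative tested against products of test functions; by density, the identity holds
for the closure of differentiation on test functions. -/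
theorem inner_tens_of_hasWeakDeriv {d : ℕ} {α : Fin d → ℕ} {v G : L2 d}
    (h : HasWeakDeriv (cube d) α v G) (z : Fin d → H × H)
    (hz : ∀ i, z i ∈ (testGraph (α i)).topologicalClosure) :
    inner ℝ v (tens fun i => (z i).1) = (-1) ^ (∑ i, α i) * inner ℝ G (tens fun i => (z i).2) := by
  have hz' : z ∈ closure (Set.pi Set.univ fun i => (testGraph (α i) : Set (H × H))) := by
    rw [closure_pi_set]; exact fun i _ => hz i
  have c1 : Continuous fun z : Fin d → H × H => inner ℝ v (tens fun i => (z i).1) :=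
    continuous_const.inner ((continuous_tens d).comp (by fun_prop))
  have c2 : Continuous fun z : Fin d → H × H =>
      (-1 : ℝ) ^ (∑ i, α i) * inner ℝ G (tens fun i => (z i).2) :=
    continuous_const.mul (continuous_const.inner ((continuous_tens d).comp (by fun_prop)))
  refine closure_minimal (fun z hz => ?_) (isClosed_eq c1 c2) hz'
  choose θ hθ hzθ using fun i => hz i (Set.mem_univ i)
  have hz1 : (fun i => (z i).1) = fun i => cls (iteratedDeriv (α i) (θ i)) := by
    funext i; rw [hzθ]
  have hz2 : (fun i => (z i).2) = fun i => cls (θ i) := by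
    funext i; rw [hzθ]
  change inner ℝ v (tens fun i => (z i).1) = _ * inner ℝ G (tens fun i => (z i).2)
  rw [hz1, hz2, inner_L2_eq ae_eq_rfl (tens_cls_ae fun i => ((hθ i).iteratedDeriv _).memLp),
    inner_L2_eq ae_eq_rfl (tens_cls_ae fun i => (hθ i).memLp),
    ← mderiv_prodFn fun i => (hθ i).smooth]
  exact h.2.2 _ (isTestFunction_prodFn hθ)

/-- The dual form of `inner_tens_of_hasWeakDeriv`: `R'` and `T'` are the adjoints of operators `R`, `T`
whose values are related by `α i`-fold differentiation. -/
theorem tmap_eq_of_hasWeakDeriv {d : ℕ} {α : Fin d → ℕ} {v G : L2 d}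
    (h : HasWeakDeriv (cube d) α v G) {R R' T T' : Fin d → H →L[ℝ] H}
    (hRT : ∀ i f, (R i f, T i f) ∈ (testGraph (α i)).topologicalClosure)
    (hR : ∀ i f g, inner ℝ (R i f) g = inner ℝ f (R' i g))
    (hT : ∀ i f g, inner ℝ (T i f) g = inner ℝ f (T' i g)) :
    tmap R' v = (-1 : ℝ) ^ (∑ i, α i) • tmap T' G := by
  refine ext_inner_tens fun f => ?_
  rw [real_inner_smul_right, ← inner_tmap_left R R' hR, ← inner_tmap_left T T' hT, tmap_tens,
    tmap_tens, real_inner_comm, real_inner_comm G]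
  exact inner_tens_of_hasWeakDeriv h (fun i => (R i (f i), T i (f i))) fun i => hRT i (f i)

/-- The error of the projections in the variables `i` with `α i ≠ 0` is represented by the weak
derivative of order `α`. -/
theorem tmap_one_sub_pwProj {d : ℕ} {α : Fin d → ℕ} {v G : L2 d}
    (h : HasWeakDeriv (cube d) α v G) (k n : Fin d → ℕ) (hα : ∀ i, α i ≤ k i + 1) :
    tmap (fun i => if α i = 0 then 1 else 1 - pwProj (k i) (n i)) v =
      (-1 : ℝ) ^ (∑ i, α i) •
        tmap (fun i => if α i = 0 then 1 else errRep (k i) (n i) (α i)) G := by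
  refine tmap_eq_of_hasWeakDeriv h
    (R := fun i => if α i = 0 then 1 else 1 - pwProj (k i) (n i))
    (T := fun i => if α i = 0 then 1 else errPrim (k i) (n i) (α i)) ?_ ?_ ?_
  · intro i f
    by_cases hi : α i = 0
    · rw [if_pos hi, if_pos hi, hi]
      have h0 : f ∈ (Pol 0)ᗮ := by
        have : Pol 0 = ⊥ := by
          rw [Pol, Polynomial.degreeLT_eq_span_X_pow]; simp
        rw [this]; simp
      have := mem_closure_testGraph h0
      rwa [pow_zero] at this
    · rw [if_neg hi, if_neg hi]
      exact errPrim_mem_testGraph _ (hα i) f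
  · intro i f g
    split_ifs
    · rfl
    · simp only [sub_apply, inner_sub_left, inner_sub_right, one_apply_eq_self, inner_pwProj_left]
  · intro i f g
    split_ifs
    · rfl
    · exact inner_errPrim_left _ _ _ f g

/-! ### Weak derivatives of tensor products of operators -/

theorem isOpen_cell {d : ℕ} (N : ℕ) (j : Fin d → Fin (2 ^ N)) : IsOpen (cell N j) := by
  have : cell N j = Set.pi Set.univ fun i => dyadic N (j i) := by
    ext x; simp [cell, dyadic]
  rw [this]
  exact isOpen_set_pi Set.finite_univ fun i _ => isOpen_Ioo

theorem isOpen_cube (d : ℕ) : IsOpen (cube d) := by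
  have : cube d = Set.pi Set.univ fun _ => Set.Ioo (0 : ℝ) 1 := by
    ext x; simp [cube]
  rw [this]
  exact isOpen_set_pi Set.finite_univ fun i _ => isOpen_Ioo

theorem cell_subset_cube {d : ℕ} (N : ℕ) (j : Fin d → Fin (2 ^ N)) : cell N j ⊆ cube d :=
  fun _ hx i => dyadic_subset N (j i) (hx i)

theorem mderiv_single {d : ℕ} (j : Fin d) (φ : (Fin d → ℝ) → ℝ) :
    mderiv (Pi.single j 1) φ = pderiv j φ := by
  have key : ∀ l : List (Fin d), l.Nodup →
      l.foldr (fun i ψ => (pderiv i)^[(Pi.single j 1 : Fin d → ℕ) i] ψ) φ =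
        if j ∈ l then pderiv j φ else φ := by
    intro l hl
    induction l with
    | nil => simp
    | cons a l ih =>
      rw [List.foldr_cons, ih (List.nodup_cons.1 hl).2]
      rcases eq_or_ne a j with rfl | ha
      · simp [(List.nodup_cons.1 hl).1]
      · simp [ha, ha.symm]
  rw [mderiv, key _ (List.nodup_finRange d)]
  simp

theorem mderiv_zero {d : ℕ} (φ : (Fin d → ℝ) → ℝ) : mderiv 0 φ = φ := by
  have key : ∀ l : List (Fin d),
      l.foldr (fun i ψ => (pderiv i)^[(0 : Fin d → ℕ) i] ψ) φ = φ := by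
    intro l
    induction l with
    | nil => rfl
    | cons a l ih => rw [List.foldr_cons, ih]; rfl
  exact key _

theorem IsTestFunction.pderiv {d : ℕ} {U : Set (Fin d → ℝ)} {φ : (Fin d → ℝ) → ℝ}
    (h : IsTestFunction U φ) (j : Fin d) : IsTestFunction U (pderiv j φ) := by
  have hs : Function.support (SparseDG.pderiv j φ) ⊆ tsupport φ := by
    intro x hx
    by_contra hx'
    apply hx
    have : fderiv ℝ φ x = 0 := by
      by_contra hne
      exact hx' (support_fderiv_subset ℝ hne)
    rw [SparseDG.pderiv, this]; rfl
  refine ⟨?_, h.2.1.mono' hs, (closure_minimal hs (isClosed_tsupport φ)).trans h.2.2⟩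
  exact (h.1.fderiv_right (m := ∞) (by simp)).clm_apply contDiff_const

theorem IsTestFunction.mono {d : ℕ} {U U' : Set (Fin d → ℝ)} {φ : (Fin d → ℝ) → ℝ}
    (h : IsTestFunction U φ) (hU : U ⊆ U') : IsTestFunction U' φ :=
  ⟨h.1, h.2.1, h.2.2.trans hU⟩

theorem IsTestFunction.memLp {d : ℕ} {U : Set (Fin d → ℝ)} {φ : (Fin d → ℝ) → ℝ}
    (h : IsTestFunction U φ) (μ : Measure (Fin d → ℝ)) [IsFiniteMeasureOnCompacts μ] :
    MemLp φ 2 μ :=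
  h.1.continuous.memLp_of_hasCompactSupport h.2.1

theorem IsTestFunction.setIntegral_mul {d : ℕ} {U U' : Set (Fin d → ℝ)} {φ : (Fin d → ℝ) → ℝ}
    (h : IsTestFunction U φ) (hU : U ⊆ U') (hm : MeasurableSet U) (hm' : MeasurableSet U')
    (w : (Fin d → ℝ) → ℝ) :
    ∫ x in U, w x * φ x = ∫ x in U', w x * φ x := by
  rw [← integral_indicator hm, ← integral_indicator hm']
  congr 1
  funext x
  by_cases hx : x ∈ U
  · rw [Set.indicator_of_mem hx, Set.indicator_of_mem (hU hx)]
  · have : φ x = 0 := image_eq_zero_of_notMem_tsupport fun h' => hx (h.2.2 h')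
    rw [Set.indicator_of_notMem hx]
    by_cases hx' : x ∈ U'
    · rw [Set.indicator_of_mem hx', this, mul_zero]
    · rw [Set.indicator_of_notMem hx']

/-- Integration by parts against a smooth product function. -/
theorem integral_prodFn_mul_pderiv {d : ℕ} {U : Set (Fin d → ℝ)} {φ : (Fin d → ℝ) → ℝ}
    (h : IsTestFunction U φ) (hU : MeasurableSet U) {θ : Fin d → ℝ → ℝ}
    (hθ : ∀ i, ContDiff ℝ ∞ (θ i)) (j : Fin d) :
    ∫ x in U, prodFn θ x * pderiv j φ x =
      -∫ x in U, prodFn (Function.update θ j (deriv (θ j))) x * φ x := by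
  have hP := contDiff_prodFn hθ
  have hP' : ContDiff ℝ ∞ (prodFn (Function.update θ j (deriv (θ j)))) := by
    refine contDiff_prodFn fun i => ?_
    rcases eq_or_ne i j with rfl | hi
    · rw [Function.update_self]; exact (contDiff_infty_iff_deriv.1 (hθ i)).2
    · rw [Function.update_of_ne hi]; exact hθ i
  have hp := h.pderiv j
  rw [hp.setIntegral_mul (Set.subset_univ U) hU MeasurableSet.univ,
    h.setIntegral_mul (Set.subset_univ U) hU MeasurableSet.univ, setIntegral_univ, setIntegral_univ,
    ← pderiv_prodFn hθ]
  refine integral_mul_fderiv_eq_neg_fderiv_mul_of_integrable (v := Pi.single j 1) ?_ ?_ ?_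
    (fun x _ => hP.differentiable (by simp) x) (fun x _ => h.1.differentiable (by simp) x)
  · change Integrable (fun x => pderiv j (prodFn θ) x * φ x) volume
    rw [pderiv_prodFn hθ]
    exact (hP'.continuous.mul h.1.continuous).integrable_of_hasCompactSupport h.2.1.mul_left
  · exact (hP.continuous.mul hp.1.continuous).integrable_of_hasCompactSupport hp.2.1.mul_left
  · exact (hP.continuous.mul h.1.continuous).integrable_of_hasCompactSupport h.2.1.mul_left

/-- If `(A f)' = A' f` on `I` for smooth `f`, then `A`, acting on the `j`-th variable, maps `L²(Ω)`
to functions with a weak `j`-th derivative, given by `A'`, where the `j`-th variable lies in `I`. -/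
theorem hasWeakDeriv_lift {d : ℕ} {I : Set ℝ} {A A' : H →L[ℝ] H} (hA : IsDerivOn I A A')
    {U : Set (Fin d → ℝ)} (hU : MeasurableSet U) (hUc : U ⊆ cube d) (j : Fin d)
    (hUI : ∀ x ∈ U, x j ∈ I) (u : L2 d) :
    HasWeakDeriv U (Pi.single j 1) (lift j A u) (lift j A' u) := by
  have hle : volume.restrict U ≤ volume.restrict (cube d) := Measure.restrict_mono hUc le_rfl
  refine ⟨(Lp.memLp _).mono_measure hle, (Lp.memLp _).mono_measure hle, fun φ hφ => ?_⟩
  have hmc : MeasurableSet (cube d) := (isOpen_cube d).measurableSet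
  have hp := hφ.pderiv j
  have m1 := hφ.memLp (volume.restrict (cube d))
  have m2 := hp.memLp (volume.restrict (cube d))
  have hint : ∀ (w : L2 d) (ψ : (Fin d → ℝ) → ℝ) (hψ : MemLp ψ 2 (volume.restrict (cube d))),
      IsTestFunction U ψ → ∫ x in U, w x * ψ x = inner ℝ w (hψ.toLp ψ) := fun w ψ hψ h => by
    rw [h.setIntegral_mul hUc hU hmc, inner_L2_eq ae_eq_rfl hψ.coeFn_toLp]
  have hsum : ∑ i, (Pi.single j 1 : Fin d → ℕ) i = 1 := by simp
  rw [mderiv_single, hsum, pow_one, neg_one_mul, hint _ _ m2 hp, hint _ _ m1 hφ]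
  have hclm : (innerSL ℝ (m2.toLp (pderiv j φ))) ∘L lift j A =
      -((innerSL ℝ (m1.toLp φ)) ∘L lift j A') := by
    refine clm_ext_tens fun f => ?_
    have hmul := multilinear_eq_of_total
      (((innerSL ℝ (m2.toLp (pderiv j φ))) ∘L lift j A).compContinuousMultilinearMap (tensM d))
      ((-((innerSL ℝ (m1.toLp φ)) ∘L lift j A')).compContinuousMultilinearMap (tensM d))
      {u : H | ∃ θ, IsTest θ ∧ u = cls θ} dense_span_test ∅ fun f hf => ?_
    · exact congrArg (fun M => M f) hmul
    · choose θ hθ hfθ using fun i => hf i (Finset.notMem_empty i)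
      obtain rfl : f = fun i => cls (θ i) := funext hfθ
      obtain ⟨F, hF, h1, h2⟩ := hA (θ j) (hθ j).smooth
      change inner ℝ (m2.toLp (pderiv j φ)) (lift j A (tens fun i => cls (θ i))) =
        -inner ℝ (m1.toLp φ) (lift j A' (tens fun i => cls (θ i)))
      rw [real_inner_comm, real_inner_comm (lift j A' _), ← hint _ _ m2 hp, ← hint _ _ m1 hφ,
        lift_tens, lift_tens]
      have hae : ∀ (B : H →L[ℝ] H) (G : ℝ → ℝ),
          (∀ᵐ x ∂unitMeasure, x ∈ I → B (cls (θ j)) x = G x) →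
          tens (Function.update (fun i => cls (θ i)) j (B (cls (θ j)))) =ᵐ[volume.restrict U]
            prodFn (Function.update θ j G) := by
        intro B G hB
        have e1 := tens_ae (Function.update (fun i => cls (θ i)) j (B (cls (θ j))))
          (g := Function.update θ j (B (cls (θ j)))) fun i => by
            rcases eq_or_ne i j with rfl | hi
            · simp only [Function.update_self]; exact ae_eq_rfl
            · simp only [Function.update_of_ne hi]; exact cls_ae (hθ i).memLp
        have e2 : ∀ᵐ x : Fin d → ℝ ∂(volume.restrict (cube d)),
            x j ∈ I → B (cls (θ j)) (x j) = G (x j) := by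
          rw [restrict_cube]
          exact (Measure.quasiMeasurePreserving_eval (fun _ : Fin d => unitMeasure) j).ae hB
        filter_upwards [hle.absolutelyContinuous e1, hle.absolutelyContinuous e2,
          ae_restrict_mem hU] with x h1 h2 hx
        rw [h1, prodFn]
        refine Finset.prod_congr rfl fun i _ => ?_
        rcases eq_or_ne i j with rfl | hi
        · simp only [Function.update_self]; exact h2 (hUI x hx)
        · simp only [Function.update_of_ne hi]
      have e1 := integral_congr_ae ((hae A F h1).mul (ae_eq_refl (pderiv j φ)))
      have e2 := integral_congr_ae ((hae A' (deriv F) h2).mul (ae_eq_refl φ))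
      simp only [Pi.mul_apply] at e1 e2
      rw [e1, e2]
      have := integral_prodFn_mul_pderiv hφ hU (θ := Function.update θ j F) (fun i => by
        rcases eq_or_ne i j with rfl | hi
        · rw [Function.update_self]; exact hF
        · rw [Function.update_of_ne hi]; exact (hθ i).smooth) j
      simpa using this
  have := congrArg (fun M => M u) hclm
  rw [real_inner_comm, real_inner_comm (m1.toLp φ)]
  exact this

/-! ### Rules for weak derivatives and semi-norms -/

theorem restrict_le_cube {d : ℕ} {U : Set (Fin d → ℝ)} (hU : U ⊆ cube d) :
    (volume.restrict U : Measure (Fin d → ℝ)) ≤ volume.restrict (cube d) :=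
  Measure.restrict_mono hU le_rfl

theorem HasWeakDeriv.congr {d : ℕ} {U : Set (Fin d → ℝ)} {α : Fin d → ℕ}
    {v v' g g' : (Fin d → ℝ) → ℝ} (h : HasWeakDeriv U α v g)
    (hv : v =ᵐ[volume.restrict U] v') (hg : g =ᵐ[volume.restrict U] g') :
    HasWeakDeriv U α v' g' := by
  refine ⟨(memLp_congr_ae hv).1 h.1, (memLp_congr_ae hg).1 h.2.1, fun φ hφ => ?_⟩
  have e1 := integral_congr_ae (hv.mul (ae_eq_refl (mderiv α φ)))
  have e2 := integral_congr_ae (hg.mul (ae_eq_refl φ))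
  simp only [Pi.mul_apply] at e1 e2
  rw [← e1, ← e2]
  exact h.2.2 φ hφ

theorem HasWeakDeriv.add_single {d : ℕ} {U : Set (Fin d → ℝ)} {j : Fin d}
    {v v' g g' : (Fin d → ℝ) → ℝ} (h : HasWeakDeriv U (Pi.single j 1) v g)
    (h' : HasWeakDeriv U (Pi.single j 1) v' g') :
    HasWeakDeriv U (Pi.single j 1) (v + v') (g + g') := by
  refine ⟨h.1.add h'.1, h.2.1.add h'.2.1, fun φ hφ => ?_⟩
  have m1 : MemLp (mderiv (Pi.single j 1) φ) 2 (volume.restrict U) := by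
    rw [mderiv_single]; exact (hφ.pderiv j).memLp _
  have m2 : MemLp φ 2 (volume.restrict U) := hφ.memLp _
  simp only [Pi.add_apply, add_mul]
  have i1 : Integrable (fun x => v x * mderiv (Pi.single j 1) φ x) (volume.restrict U) :=
    h.1.integrable_mul m1
  have i2 : Integrable (fun x => v' x * mderiv (Pi.single j 1) φ x) (volume.restrict U) :=
    h'.1.integrable_mul m1
  have i3 : Integrable (fun x => g x * φ x) (volume.restrict U) := h.2.1.integrable_mul m2
  have i4 : Integrable (fun x => g' x * φ x) (volume.restrict U) := h'.2.1.integrable_mul m2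
  rw [integral_add i1 i2, integral_add i3 i4, h.2.2 φ hφ, h'.2.2 φ hφ, mul_add]

theorem HasWeakDeriv.const_smul {d : ℕ} {U : Set (Fin d → ℝ)} {α : Fin d → ℕ}
    {v g : (Fin d → ℝ) → ℝ} (c : ℝ) (h : HasWeakDeriv U α v g) :
    HasWeakDeriv U α (c • v) (c • g) := by
  refine ⟨h.1.const_smul c, h.2.1.const_smul c, fun φ hφ => ?_⟩
  simp only [Pi.smul_apply, smul_eq_mul, mul_assoc]
  rw [integral_const_mul, integral_const_mul, h.2.2 φ hφ]
  ring

theorem HasWeakDeriv.mono {d : ℕ} {U U' : Set (Fin d → ℝ)} {α : Fin d → ℕ}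
    {v g : (Fin d → ℝ) → ℝ} (h : HasWeakDeriv U α v g) (hU : U' ⊆ U) (hm : MeasurableSet U)
    (hm' : MeasurableSet U') (hα : ∀ φ, IsTestFunction U' φ → IsTestFunction U' (mderiv α φ)) :
    HasWeakDeriv U' α v g := by
  have hle : volume.restrict U' ≤ volume.restrict U := Measure.restrict_mono hU le_rfl
  refine ⟨h.1.mono_measure hle, h.2.1.mono_measure hle, fun φ hφ => ?_⟩
  rw [(hα φ hφ).setIntegral_mul hU hm' hm, hφ.setIntegral_mul hU hm' hm]
  exact h.2.2 φ (hφ.mono hU)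

theorem IsTestFunction.mderiv {d : ℕ} {U : Set (Fin d → ℝ)} {φ : (Fin d → ℝ) → ℝ}
    (h : IsTestFunction U φ) (α : Fin d → ℕ) : IsTestFunction U (mderiv α φ) := by
  have hit : ∀ (i : Fin d) (a : ℕ) (ψ : (Fin d → ℝ) → ℝ), IsTestFunction U ψ →
      IsTestFunction U ((SparseDG.pderiv i)^[a] ψ) := by
    intro i a ψ hψ
    induction a with
    | zero => exact hψ
    | succ a ih => rw [Function.iterate_succ_apply']; exact ih.pderiv i
  have key : ∀ l : List (Fin d),
      IsTestFunction U (l.foldr (fun i ψ => (SparseDG.pderiv i)^[α i] ψ) φ) := by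
    intro l
    induction l with
    | nil => exact h
    | cons a l ih => rw [List.foldr_cons]; exact hit _ _ _ ih
  exact key _

/-- Weak derivatives are unique, so that the infimum in `derivNorm` is over one value. -/
theorem HasWeakDeriv.unique {d : ℕ} {U : Set (Fin d → ℝ)} (hU : IsOpen U) {α : Fin d → ℕ}
    {v g g' : (Fin d → ℝ) → ℝ} (hfin : IsFiniteMeasure (volume.restrict U))
    (h : HasWeakDeriv U α v g) (h' : HasWeakDeriv U α v g') : g =ᵐ[volume.restrict U] g' := by
  have hi : LocallyIntegrableOn (g - g') U volume :=
    IntegrableOn.locallyIntegrableOn ((h.2.1.sub h'.2.1).integrable one_le_two)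
  have := hU.ae_eq_zero_of_integral_contDiff_smul_eq_zero hi fun φ h1 h2 h3 => by
    have hφ : IsTestFunction U φ := ⟨h1, h2, h3⟩
    have m2 : MemLp φ 2 (volume.restrict U) := hφ.memLp _
    have e1 := (h.2.2 φ hφ).symm.trans (h'.2.2 φ hφ)
    have e2 : ∫ x in U, g x * φ x = ∫ x in U, g' x * φ x :=
      mul_left_cancel₀ (pow_ne_zero _ (by norm_num)) e1
    have e3 : ∫ x, φ x • (g - g') x = ∫ x, (g - g') x * φ x := by
      simp only [smul_eq_mul, mul_comm]
    rw [e3, ← setIntegral_univ, ← hφ.setIntegral_mul (Set.subset_univ U) hU.measurableSet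
      MeasurableSet.univ]
    simp only [Pi.sub_apply, sub_mul]
    have i1 : Integrable (fun x => g x * φ x) (volume.restrict U) := h.2.1.integrable_mul m2
    have i2 : Integrable (fun x => g' x * φ x) (volume.restrict U) := h'.2.1.integrable_mul m2
    rw [integral_sub i1 i2, e2, sub_self]
  rw [Filter.EventuallyEq, ae_restrict_iff' hU.measurableSet]
  filter_upwards [this] with x hx hxU
  exact sub_eq_zero.1 (hx hxU)

theorem derivNorm_le {d : ℕ} {U : Set (Fin d → ℝ)} {α : Fin d → ℕ} {v g : (Fin d → ℝ) → ℝ}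
    (h : HasWeakDeriv U α v g) : derivNorm U α v ≤ eLpNorm g 2 (volume.restrict U) :=
  iInf₂_le g h

theorem derivNorm_eq {d : ℕ} {U : Set (Fin d → ℝ)} (hU : IsOpen U) (hUc : U ⊆ cube d)
    {α : Fin d → ℕ} {v g : (Fin d → ℝ) → ℝ} (h : HasWeakDeriv U α v g) :
    derivNorm U α v = eLpNorm g 2 (volume.restrict U) := by
  refine le_antisymm (derivNorm_le h) (le_iInf₂ fun g' h' => ?_)
  have : IsFiniteMeasure (volume.restrict U : Measure (Fin d → ℝ)) :=
    isFiniteMeasure_of_le _ (restrict_le_cube hUc)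
  exact (eLpNorm_congr_ae (h.unique hU this h')).le

theorem exists_weakDeriv_L2 {d : ℕ} {α : Fin d → ℕ} {v : L2 d}
    (h : ∃ g, HasWeakDeriv (cube d) α v g) : ∃ G : L2 d, HasWeakDeriv (cube d) α v G := by
  obtain ⟨g, hg⟩ := h
  exact ⟨hg.2.1.toLp g, hg.congr ae_eq_rfl hg.2.1.coeFn_toLp.symm⟩

theorem eLpNorm_L2 {d : ℕ} (u : L2 d) :
    eLpNorm u 2 (volume.restrict (cube d)) = ENNReal.ofReal ‖u‖ := by
  rw [Lp.norm_def, ENNReal.ofReal_toReal (Lp.eLpNorm_ne_top u)]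

theorem derivNorm_cube {d : ℕ} {α : Fin d → ℕ} {v G : L2 d} (h : HasWeakDeriv (cube d) α v G) :
    derivNorm (cube d) α v = ENNReal.ofReal ‖G‖ := by
  rw [derivNorm_eq (isOpen_cube d) subset_rfl h, eLpNorm_L2]

theorem hasWeakDeriv_zero {d : ℕ} {U : Set (Fin d → ℝ)} {v : (Fin d → ℝ) → ℝ}
    (h : MemLp v 2 (volume.restrict U)) : HasWeakDeriv U 0 v v :=
  ⟨h, h, fun φ _ => by simp [mderiv_zero]⟩

theorem rpow_half_sq (x : ℝ≥0∞) : (x ^ 2) ^ (1 / 2 : ℝ) = x := by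
  rw [← ENNReal.rpow_natCast, ← ENNReal.rpow_mul]
  norm_num

theorem sq_rpow_half (x : ℝ≥0∞) : (x ^ (1 / 2 : ℝ)) ^ 2 = x := by
  rw [← ENNReal.rpow_natCast, ← ENNReal.rpow_mul]
  norm_num

theorem ofReal_sqrt_eq {x : ℝ} (hx : 0 ≤ x) :
    ENNReal.ofReal (√x) = (ENNReal.ofReal x) ^ (1 / 2 : ℝ) := by
  rw [Real.sqrt_eq_rpow, ENNReal.ofReal_rpow_of_nonneg hx (by norm_num)]

theorem sobolevSeminorm_zero_le {d : ℕ} {U : Set (Fin d → ℝ)} {v : (Fin d → ℝ) → ℝ}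
    (h : MemLp v 2 (volume.restrict U)) :
    sobolevSeminorm U 0 v ≤ eLpNorm v 2 (volume.restrict U) := by
  rw [sobolevSeminorm, Finset.piAntidiag_zero, Finset.sum_singleton, rpow_half_sq]
  exact derivNorm_le (hasWeakDeriv_zero h)

theorem piAntidiag_one_subset (d : ℕ) : Finset.piAntidiag (Finset.univ : Finset (Fin d)) 1 ⊆
    Finset.univ.image fun j : Fin d => (Pi.single j 1 : Fin d → ℕ) := by
  intro α hα
  have hs : ∑ i, α i = 1 := (Finset.mem_piAntidiag.1 hα).1
  obtain ⟨j, -, hj⟩ : ∃ j ∈ Finset.univ, α j ≠ 0 := by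
    by_contra h
    push Not at h
    rw [Finset.sum_eq_zero h] at hs
    exact zero_ne_one hs
  refine Finset.mem_image.2 ⟨j, Finset.mem_univ j, ?_⟩
  have h1 := Finset.add_sum_erase Finset.univ α (Finset.mem_univ j)
  have h2 : ∑ i ∈ Finset.univ.erase j, α i = 0 := by omega
  funext i
  rcases eq_or_ne i j with rfl | hi
  · rw [Pi.single_eq_same]; omega
  · rw [Pi.single_eq_of_ne hi]
    exact ((Finset.sum_eq_zero_iff.1 h2) i (Finset.mem_erase.2 ⟨hi, Finset.mem_univ i⟩)).symm

theorem sobolevSeminorm_one_le {d : ℕ} {U : Set (Fin d → ℝ)} {v : (Fin d → ℝ) → ℝ}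
    {b : Fin d → (Fin d → ℝ) → ℝ} (h : ∀ j, HasWeakDeriv U (Pi.single j 1) v (b j)) :
    sobolevSeminorm U 1 v ^ 2 ≤ ∑ j, eLpNorm (b j) 2 (volume.restrict U) ^ 2 := by
  rw [sobolevSeminorm, sq_rpow_half]
  refine (Finset.sum_le_sum_of_subset (piAntidiag_one_subset d)).trans ?_
  refine (Finset.sum_image_le_of_nonneg fun _ _ => zero_le).trans ?_
  exact Finset.sum_le_sum fun j _ => pow_le_pow_left' (derivNorm_le (h j)) 2

theorem sum_cells_eLpNorm_sq_le {d : ℕ} (N : ℕ) (u : L2 d) :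
    ∑ j : Fin d → Fin (2 ^ N), eLpNorm u 2 (volume.restrict (cell N j)) ^ 2 ≤
      ENNReal.ofReal (‖u‖ ^ 2) := by
  have h2 : ∀ μ : Measure (Fin d → ℝ), eLpNorm u 2 μ ^ 2 = ∫⁻ x, ‖u x‖ₑ ^ (2 : ℝ) ∂μ := by
    intro μ
    have := eLpNorm_nnreal_pow_eq_lintegral (f := u) (μ := μ) (p := 2) (by norm_num)
    simpa using this
  rw [ENNReal.ofReal_pow (norm_nonneg _), ← eLpNorm_L2, h2]
  simp_rw [h2]
  have hd : Pairwise fun j j' : Fin d → Fin (2 ^ N) => Disjoint (cell N j) (cell N j') := by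
    intro j j' hjj'
    refine Set.disjoint_left.2 fun x hx hx' => hjj' (funext fun i => ?_)
    exact dyadic_unique (hx i) (hx' i)
  rw [← tsum_fintype (L := SummationFilter.unconditional _),
    ← lintegral_iUnion (fun j => (isOpen_cell N j).measurableSet) hd]
  exact lintegral_mono_set (Set.iUnion_subset fun j => cell_subset_cube N j)

theorem brokenSeminorm_zero_le {d : ℕ} (N : ℕ) (u : L2 d) :
    brokenSeminorm N 0 u ≤ ENNReal.ofReal ‖u‖ := by
  rw [brokenSeminorm, ← rpow_half_sq (ENNReal.ofReal ‖u‖)]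
  refine ENNReal.rpow_le_rpow ?_ (by norm_num)
  rw [← ENNReal.ofReal_pow (norm_nonneg _)]
  refine le_trans (Finset.sum_le_sum fun j _ => ?_) (sum_cells_eLpNorm_sq_le N u)
  exact pow_le_pow_left' (sobolevSeminorm_zero_le
    ((Lp.memLp u).mono_measure (restrict_le_cube (cell_subset_cube N j)))) 2

/-- The broken `H¹` semi-norm is controlled by weak derivatives on the cells. -/
theorem brokenSeminorm_one_le {d : ℕ} (N : ℕ) (u : L2 d) (b : Fin d → L2 d)
    (h : ∀ c j, HasWeakDeriv (cell N c) (Pi.single j 1) u (b j)) :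
    brokenSeminorm N 1 u ≤ ENNReal.ofReal √(∑ j, ‖b j‖ ^ 2) := by
  rw [brokenSeminorm, ofReal_sqrt_eq (by positivity)]
  refine ENNReal.rpow_le_rpow ?_ (by norm_num)
  refine (Finset.sum_le_sum fun c _ => sobolevSeminorm_one_le (h c)).trans ?_
  rw [Finset.sum_comm, ENNReal.ofReal_sum_of_nonneg fun _ _ => by positivity]
  exact Finset.sum_le_sum fun j _ => sum_cells_eLpNorm_sq_le N (b j)

/-- A lower bound for the Sobolev semi-norm by a family of distinct derivatives of order `m`. -/
theorem le_sobolevSeminorm {d m : ℕ} {v : L2 d} {ι : Type*} (s : Finset ι) (α : ι → Fin d → ℕ)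
    (G : ι → L2 d) (hα : ∀ i ∈ s, ∑ x, α i x = m) (hinj : Set.InjOn α s)
    (hG : ∀ i ∈ s, HasWeakDeriv (cube d) (α i) v (G i)) :
    ENNReal.ofReal √(∑ i ∈ s, ‖G i‖ ^ 2) ≤ sobolevSeminorm (cube d) m v := by
  classical
  rw [sobolevSeminorm, ofReal_sqrt_eq (Finset.sum_nonneg fun _ _ => by positivity)]
  refine ENNReal.rpow_le_rpow ?_ (by norm_num)
  rw [ENNReal.ofReal_sum_of_nonneg fun _ _ => by positivity]
  have hsub : s.image α ⊆ Finset.piAntidiag Finset.univ m := by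
    intro β hβ
    obtain ⟨i, hi, rfl⟩ := Finset.mem_image.1 hβ
    exact Finset.mem_piAntidiag.2 ⟨hα i hi, fun _ _ => Finset.mem_univ _⟩
  refine le_trans (le_of_eq ?_) (Finset.sum_le_sum_of_subset hsub)
  rw [Finset.sum_image hinj]
  refine Finset.sum_congr rfl fun i hi => ?_
  rw [derivNorm_cube (hG i hi), ENNReal.ofReal_pow (norm_nonneg _)]

/-! ### The projections as tensor products of operators -/

/-- A symmetric operator with values in `toL2 S` that fixes `toL2 S` is the orthogonal projection;
the values need only be known on product functions. -/
theorem starProjection_toL2_apply {d : ℕ} (S : Submodule ℝ ((Fin d → ℝ) → ℝ)) [Module.Finite ℝ S]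
    (Q : L2 d →L[ℝ] L2 d) (hQ : ∀ u w, inner ℝ (Q u) w = inner ℝ u (Q w))
    (hr : ∀ f, Q (tens f) ∈ toL2 S)
    (hfix : ∀ G ∈ S, ∃ W : L2 d, W =ᵐ[volume.restrict (cube d)] G ∧ Q W = W) (u : L2 d) :
    (toL2 S).starProjection u = Q u := by
  refine Submodule.eq_starProjection_of_mem_of_inner_eq_zero (K := toL2 S) ?_ ?_
  · have hcl : IsClosed ((toL2 S).comap Q.toLinearMap : Set (L2 d)) :=
      (Submodule.closed_of_finiteDimensional (toL2 S)).preimage Q.continuous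
    have hle : (Submodule.span ℝ (Set.range (tens : (Fin d → H) → L2 d))).topologicalClosure ≤
        (toL2 S).comap Q.toLinearMap := by
      refine Submodule.topologicalClosure_minimal _ (Submodule.span_le.2 ?_) hcl
      rintro _ ⟨f, rfl⟩
      exact hr f
    rw [dense_span_tens] at hle
    exact hle (Submodule.mem_top (x := u))
  · rintro w ⟨G, hG, hwG⟩
    obtain ⟨W, hW, hQW⟩ := hfix G hG
    obtain rfl : w = W := Lp.ext (hwG.trans hW.symm)
    rw [inner_sub_left, hQ, hQW, sub_self]

theorem exists_fixed_of_mem_span {d : ℕ} {s : Set ((Fin d → ℝ) → ℝ)} {Q : L2 d →L[ℝ] L2 d}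
    (h : ∀ G ∈ s, ∃ W : L2 d, W =ᵐ[volume.restrict (cube d)] G ∧ Q W = W)
    {G : (Fin d → ℝ) → ℝ} (hG : G ∈ Submodule.span ℝ s) :
    ∃ W : L2 d, W =ᵐ[volume.restrict (cube d)] G ∧ Q W = W := by
  induction hG using Submodule.span_induction with
  | mem G hG => exact h G hG
  | zero => exact ⟨0, Lp.coeFn_zero _ _ _, map_zero Q⟩
  | add F G _ _ hF hG =>
    obtain ⟨W, hW, hQ⟩ := hF
    obtain ⟨W', hW', hQ'⟩ := hG
    exact ⟨W + W', (Lp.coeFn_add _ _).trans (hW.add hW'), by rw [map_add, hQ, hQ']⟩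
  | smul c G _ hG =>
    obtain ⟨W, hW, hQ⟩ := hG
    exact ⟨c • W, (Lp.coeFn_smul _ _).trans (hW.const_smul c), by rw [map_smul, hQ]⟩

theorem fullProj_eq (d k N : ℕ) : fullProj d k N = tmap fun _ => pwProj k N := by
  refine ContinuousLinearMap.ext fun u => ?_
  refine starProjection_toL2_apply _ _ (inner_tmap_left _ _ fun _ => inner_pwProj_left k N) ?_ ?_ u
  · intro f
    choose g hg hgf using fun i => exists_mem_V k N (f i)
    rw [tmap_tens]
    simp_rw [hgf]
    exact ⟨prodFn g, Submodule.subset_span ⟨g, hg, rfl⟩, tens_cls_ae fun i => memLp_of_mem_V (hg i)⟩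
  · intro G hG
    refine exists_fixed_of_mem_span ?_ hG
    rintro _ ⟨g, hg, rfl⟩
    refine ⟨tens fun i => cls (g i), tens_cls_ae fun i => memLp_of_mem_V (hg i), ?_⟩
    rw [tmap_tens]
    congr 1
    funext i
    exact pwProj_cls (hg i)

/-- The orthogonal projection of `L²(0,1)` onto the multiwavelet space of level `n`. -/
def pwDiff (k : ℕ) : ℕ → H →L[ℝ] H
  | 0 => pwProj k 0
  | n + 1 => pwProj k (n + 1) - pwProj k n

theorem sum_pwDiff (k N : ℕ) : ∑ n ∈ Finset.range (N + 1), pwDiff k n = pwProj k N := by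
  induction N with
  | zero => simp [pwDiff]
  | succ N ih => rw [Finset.sum_range_succ, ih, pwDiff]; abel

theorem inner_pwDiff_left (k n : ℕ) (f g : H) :
    inner ℝ (pwDiff k n f) g = inner ℝ f (pwDiff k n g) := by
  cases n with
  | zero => exact inner_pwProj_left k 0 f g
  | succ n => simp only [pwDiff, sub_apply, inner_sub_left, inner_sub_right, inner_pwProj_left]

theorem inner_cls_eq {f g : ℝ → ℝ} (hf : MemLp f 2 unitMeasure) (hg : MemLp g 2 unitMeasure) :
    inner ℝ (cls f) (cls g) = ∫ x in Set.Ioc (0 : ℝ) 1, f x * g x := by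
  rw [inner_eq_integral (cls_ae hf) (cls_ae hg), integral_Ioc_eq_integral_Ioo]

theorem exists_mem_W (k n : ℕ) (f : H) : ∃ g ∈ W k n, pwDiff k n f = cls g := by
  cases n with
  | zero => exact exists_mem_V k 0 f
  | succ n =>
    obtain ⟨g, hg, hgf⟩ := exists_mem_V k (n + 1) f
    obtain ⟨g', hg', hgf'⟩ := exists_mem_V k n f
    have hV : g + (-1 : ℝ) • g' ∈ V k (n + 1) :=
      add_mem hg (Submodule.smul_mem _ _ (V_mono k n.le_succ hg'))
    have he : pwDiff k (n + 1) f = cls (g + (-1 : ℝ) • g') := by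
      rw [cls_add (memLp_of_mem_V hg) ((memLp_of_mem_V hg').const_smul _),
        cls_smul _ (memLp_of_mem_V hg'), ← hgf, ← hgf', neg_one_smul, ← sub_eq_add_neg]
      rfl
    refine ⟨_, ⟨hV, fun h hh => ?_⟩, he⟩
    rw [← inner_cls_eq (memLp_of_mem_V hV) (memLp_of_mem_V hh), ← he, inner_pwDiff_left, pwDiff,
      sub_apply, pwProj_cls hh, pwProj_cls (V_mono k n.le_succ hh), sub_self, inner_zero_right]

theorem pwProj_cls_of_mem_W {k l : ℕ} {w : ℝ → ℝ} (hw : w ∈ W k l) (n : ℕ) :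
    pwProj k n (cls w) = if l ≤ n then cls w else 0 := by
  split_ifs with h
  · exact pwProj_cls (V_mono k h (W_subset_V k l hw))
  · obtain ⟨m, rfl⟩ : ∃ m, l = m + 1 := ⟨l - 1, by omega⟩
    have h0 : pwProj k m (cls w) = 0 := by
      refine ext_inner_right ℝ fun f => ?_
      obtain ⟨g, hg, hgf⟩ := exists_mem_V k m f
      rw [inner_pwProj_left, hgf, inner_zero_left,
        inner_cls_eq (memLp_of_mem_V hw.1) (memLp_of_mem_V hg)]
      exact hw.2 g hg
    rw [← pwProj_mul_of_ge k (show n ≤ m by omega), mul_apply_eq_comp, h0, map_zero]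

/-- The multiwavelet spaces are the ranges of the mutually orthogonal projections `pwDiff k n`. -/
theorem pwDiff_cls_of_mem_W {k l : ℕ} {w : ℝ → ℝ} (hw : w ∈ W k l) (n : ℕ) :
    pwDiff k n (cls w) = if n = l then cls w else 0 := by
  cases n with
  | zero =>
    rw [pwDiff, pwProj_cls_of_mem_W hw]
    congr 1
    exact propext ⟨fun h => by omega, fun h => by omega⟩
  | succ n =>
    rw [pwDiff, sub_apply, pwProj_cls_of_mem_W hw, pwProj_cls_of_mem_W hw]
    rcases lt_trichotomy l (n + 1) with h | h | h
    · rw [if_pos h.le, if_pos (by omega), if_neg (by omega), sub_self]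
    · rw [if_pos h.le, if_neg (by omega), if_pos h.symm, sub_zero]
    · rw [if_neg (by omega), if_neg (by omega), if_neg (by omega), sub_self]

/-- The multi-levels `l` with `l i ≤ N` for every `i`. -/
def levels (d N : ℕ) : Finset (Fin d → ℕ) := Fintype.piFinset fun _ => Finset.range (N + 1)

theorem mem_levels {d N : ℕ} {l : Fin d → ℕ} : l ∈ levels d N ↔ ∀ i, l i ≤ N := by
  simp [levels, Fintype.mem_piFinset]

theorem sparseProj_eq (d k N : ℕ) : sparseProj d k N =
    ∑ l ∈ (levels d N).filter fun l => ∑ i, l i ≤ N, tmap fun i => pwDiff k (l i) := by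
  refine ContinuousLinearMap.ext fun u => ?_
  refine starProjection_toL2_apply _ _ ?_ ?_ ?_ u
  · intro u w
    simp only [sum_apply, sum_inner, inner_sum]
    exact Finset.sum_congr rfl fun l _ => inner_tmap_left _ _ (fun i => inner_pwDiff_left k (l i)) u w
  · intro f
    rw [sum_apply]
    refine Submodule.sum_mem _ fun l hl => ?_
    choose g hg hgf using fun i => exists_mem_W k (l i) (f i)
    rw [tmap_tens]
    simp_rw [hgf]
    refine ⟨prodFn g, ?_, tens_cls_ae fun i => memLp_of_mem_V (W_subset_V k _ (hg i))⟩
    have h1 : prodFn g ∈ tensorSpace fun i => W k (l i) := Submodule.subset_span ⟨g, hg, rfl⟩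
    exact Submodule.mem_iSup_of_mem l (Submodule.mem_iSup_of_mem (Finset.mem_filter.1 hl).2 h1)
  · intro G hG
    have hle : sparseSpace d k N ≤ Submodule.span ℝ {F | ∃ l : Fin d → ℕ, ∑ i, l i ≤ N ∧
        ∃ f : Fin d → ℝ → ℝ, (∀ i, f i ∈ W k (l i)) ∧ F = fun x => ∏ i, f i (x i)} := by
      refine iSup₂_le fun l hl => Submodule.span_mono ?_
      rintro F ⟨f, hf, rfl⟩
      exact ⟨l, hl, f, hf, rfl⟩
    refine exists_fixed_of_mem_span ?_ (hle hG)
    rintro _ ⟨l, hl, g, hg, rfl⟩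
    refine ⟨tens fun i => cls (g i), tens_cls_ae fun i => memLp_of_mem_V (W_subset_V k _ (hg i)), ?_⟩
    rw [sum_apply, Finset.sum_eq_single l]
    · rw [tmap_tens]
      congr 1
      funext i
      rw [pwDiff_cls_of_mem_W (hg i), if_pos rfl]
    · intro m _ hm
      obtain ⟨i, hi⟩ := Function.ne_iff.1 hm
      rw [tmap_tens]
      refine (tensM d).map_coord_zero i ?_
      rw [pwDiff_cls_of_mem_W (hg i), if_neg hi]
    · intro h
      refine absurd (Finset.mem_filter.2 ⟨mem_levels.2 fun i => ?_, hl⟩) h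
      exact (Finset.single_le_sum (fun j _ => Nat.zero_le (l j)) (Finset.mem_univ i)).trans hl

/-- The full projection exceeds the sparse one by the increments with `|l|₁ > N`. -/
theorem fullProj_sub_sparseProj (d k N : ℕ) : fullProj d k N - sparseProj d k N =
    ∑ l ∈ (levels d N).filter fun l => N < ∑ i, l i, tmap fun i => pwDiff k (l i) := by
  have h : tmap (fun _ : Fin d => pwProj k N) = ∑ l ∈ levels d N, tmap fun i => pwDiff k (l i) := by
    rw [← sum_pwDiff, ← tmapM_apply]
    exact (tmapM d).map_sum_finset (fun _ n => pwDiff k n) fun _ => Finset.range (N + 1)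
  rw [fullProj_eq, sparseProj_eq, h, sub_eq_iff_eq_add, add_comm,
    ← Finset.sum_filter_add_sum_filter_not (levels d N) fun l => ∑ i, l i ≤ N]
  simp only [not_le]

/-! ### Projection errors in one and in several variables -/

theorem norm_clm_apply_le {d : ℕ} {A : L2 d →L[ℝ] L2 d} {c : ℝ} (h : ‖A‖ ≤ c) (u : L2 d) :
    ‖A u‖ ≤ c * ‖u‖ :=
  (A.le_opNorm u).trans (mul_le_mul_of_nonneg_right h (norm_nonneg u))

theorem norm_lift_apply_le {d : ℕ} (i : Fin d) {A : H →L[ℝ] H} {c : ℝ} (h : ‖A‖ ≤ c) (u : L2 d) :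
    ‖lift i A u‖ ≤ c * ‖u‖ :=
  norm_clm_apply_le ((norm_lift_le i A).trans h) u

/-- The representation of the projection error in a single variable. -/
theorem sub_lift_pwProj {d k a : ℕ} {i : Fin d} {v G : L2 d} (ha : a ≠ 0) (hak : a ≤ k + 1)
    (h : HasWeakDeriv (cube d) (Pi.single i a) v G) (n : ℕ) :
    v - lift i (pwProj k n) v = (-1 : ℝ) ^ a • lift i (errRep k n a) G := by
  have key := tmap_one_sub_pwProj h (fun _ => k) (fun _ => n) fun x => by
    rcases eq_or_ne x i with rfl | hx
    · rwa [Pi.single_eq_same]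
    · rw [Pi.single_eq_of_ne hx]; exact Nat.zero_le _
  have e : ∀ X : Fin d → H →L[ℝ] H, (fun x => if (Pi.single i a : Fin d → ℕ) x = 0 then 1 else X x) =
      Function.update (1 : Fin d → H →L[ℝ] H) i (X i) := fun X => by
    funext x
    rcases eq_or_ne x i with rfl | hx
    · simp [ha]
    · simp [hx]
  rw [e, e fun x => errRep k n ((Pi.single i a : Fin d → ℕ) x), ← lift_eq_tmap, ← lift_eq_tmap,
    lift_sub, lift_one, Pi.single_eq_same, Finset.sum_pi_single' i a] at key
  simpa using key

theorem norm_sub_lift_pwProj_le {d k a : ℕ} {i : Fin d} {v G : L2 d} (ha : a ≠ 0)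
    (hak : a ≤ k + 1) (h : HasWeakDeriv (cube d) (Pi.single i a) v G) (n : ℕ) :
    ‖v - lift i (pwProj k n) v‖ ≤ (((2 : ℝ) ^ n) ^ a)⁻¹ * ‖G‖ := by
  rw [sub_lift_pwProj ha hak h, norm_smul, norm_pow, norm_neg, norm_one, one_pow, one_mul]
  exact norm_lift_apply_le i (norm_errRep_le k n a) G

/-- The error of the projections in all variables `i` with `α i ≠ 0` simultaneously. -/
theorem norm_tmap_one_sub_pwProj_le {d : ℕ} {α : Fin d → ℕ} {v G : L2 d}
    (h : HasWeakDeriv (cube d) α v G) (k n : Fin d → ℕ) (hα : ∀ i, α i ≤ k i + 1) :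
    ‖tmap (fun i => if α i = 0 then 1 else 1 - pwProj (k i) (n i)) v‖ ≤
      (∏ i, (((2 : ℝ) ^ n i) ^ α i)⁻¹) * ‖G‖ := by
  rw [tmap_one_sub_pwProj h k n hα, norm_smul, norm_pow, norm_neg, norm_one, one_pow, one_mul]
  refine norm_clm_apply_le ((norm_tmap_le _).trans ?_) G
  refine Finset.prod_le_prod (fun _ _ => norm_nonneg _) fun i _ => ?_
  split_ifs with hi
  · rw [hi, pow_zero, inv_one]; exact ContinuousLinearMap.norm_id_le
  · exact norm_errRep_le _ _ _

/-- The error of the piecewise constant projection in one variable and the projection of degree `k`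
in another one. -/
theorem norm_lift_sub_lift_pwProj_le {d k a n : ℕ} {i j : Fin d} {v G : L2 d} (hij : i ≠ j)
    (ha : a ≠ 0) (hak : a ≤ k + 1)
    (h : HasWeakDeriv (cube d) (Pi.single j 1 + Pi.single i a) v G) :
    ‖lift j (1 - pwProj 0 n) v - lift i (pwProj k n) (lift j (1 - pwProj 0 n) v)‖ ≤
      (((2 : ℝ) ^ n) ^ (a + 1))⁻¹ * ‖G‖ := by
  have hα : ∀ x, (Pi.single j 1 + Pi.single i a : Fin d → ℕ) x ≤
      Function.update (fun _ => k) j 0 x + 1 := fun x => by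
    rcases eq_or_ne x j with rfl | hx
    · simp [hij.symm]
    · rcases eq_or_ne x i with rfl | hx'
      · simpa [hx] using hak
      · simp [hx, hx']
  have key := norm_tmap_one_sub_pwProj_le h (Function.update (fun _ => k) j 0) (fun _ => n) hα
  have e : (fun x => if (Pi.single j 1 + Pi.single i a : Fin d → ℕ) x = 0 then 1 else
        1 - pwProj (Function.update (fun _ => k) j 0 x) n) =
      Function.update (1 : Fin d → H →L[ℝ] H) i (1 - pwProj k n) *
        Function.update (1 : Fin d → H →L[ℝ] H) j (1 - pwProj 0 n) := by
    funext x
    rcases eq_or_ne x j with rfl | hx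
    · simp [hij.symm]
    · rcases eq_or_ne x i with rfl | hx'
      · simp [hx, ha]
      · simp [hx, hx']
  have hs : ∑ x, (Pi.single j 1 + Pi.single i a : Fin d → ℕ) x = a + 1 := by
    simp [Finset.sum_add_distrib, add_comm]
  rw [e, ← tmap_mul, ← lift_eq_tmap, ← lift_eq_tmap, mul_apply_eq_comp, lift_sub i, lift_one,
    sub_apply, one_apply_eq_self, Finset.prod_inv_distrib, Finset.prod_pow_eq_pow_sum, hs] at key
  exact key

/-- The projection of degree `k` on level `n` in the variables of `S`. -/
def partialProj (d k n : ℕ) (S : Finset (Fin d)) : L2 d →L[ℝ] L2 d :=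
  tmap fun i => if i ∈ S then pwProj k n else 1

theorem partialProj_empty (d k n : ℕ) : partialProj d k n ∅ = 1 := by
  refine clm_ext_tens fun f => ?_
  simp [partialProj, tmap_tens]

theorem partialProj_insert {d : ℕ} (k n : ℕ) {S : Finset (Fin d)} {a : Fin d} (ha : a ∉ S) :
    partialProj d k n (insert a S) = lift a (pwProj k n) * partialProj d k n S := by
  rw [partialProj, partialProj, lift_eq_tmap, tmap_mul]
  congr 1
  funext i
  rcases eq_or_ne i a with rfl | hi
  · simp [ha]
  · simp [hi]

theorem fullProj_eq_partialProj (d k n : ℕ) : fullProj d k n = partialProj d k n Finset.univ := by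
  rw [fullProj_eq, partialProj]
  simp

/-- By orthogonality, the squared error of a tensor product of projections is at most the sum of the
squared errors of the one-dimensional projections. -/
theorem norm_sub_partialProj_sq_le {d : ℕ} (k n : ℕ) (S : Finset (Fin d)) (v : L2 d) :
    ‖v - partialProj d k n S v‖ ^ 2 ≤ ∑ i ∈ S, ‖v - lift i (pwProj k n) v‖ ^ 2 := by
  induction S using Finset.induction_on with
  | empty => simp [partialProj_empty]
  | insert a S ha ih =>
    set P := lift a (pwProj k n) with hP
    set w := v - partialProj d k n S v with hw
    -- The two summands are orthogonal, and `P` is a contraction.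
    have e : v - partialProj d k n (insert a S) v = (v - P v) + P w := by
      rw [partialProj_insert k n ha, mul_apply_eq_comp, hw, map_sub]; abel
    have hPP : P (P v) = P v := by
      rw [← mul_apply_eq_comp, hP, ← lift_mul, pwProj_mul_self]
    have horth : inner ℝ (v - P v) (P w) = 0 := by
      rw [← inner_lift_left a (pwProj k n) (pwProj k n) (inner_pwProj_left k n), ← hP, map_sub, hPP,
        sub_self, inner_zero_left]
    have hPw : ‖P w‖ ≤ ‖w‖ := by
      simpa using norm_lift_apply_le a (norm_pwProj_le k n) w
    have hpyth := norm_add_sq_eq_norm_sq_add_norm_sq_of_inner_eq_zero _ _ horth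
    rw [Finset.sum_insert ha, e]
    nlinarith [norm_nonneg (P w), norm_nonneg w]

theorem lift_partialProj_comm {d : ℕ} (k n : ℕ) {S : Finset (Fin d)} {j : Fin d} (hj : j ∉ S)
    (A : H →L[ℝ] H) : lift j A * partialProj d k n S = partialProj d k n S * lift j A := by
  rw [partialProj, lift_eq_tmap, tmap_mul, tmap_mul]
  congr 1
  funext i
  rcases eq_or_ne i j with rfl | hi
  · simp [hj]
  · simp [hi]

/-! ### The cellwise estimate in one dimension -/

/-- Restriction to a measurable set, as an operator on `L²(Ω)`. -/
def restrictL2 {d : ℕ} {s : Set (Fin d → ℝ)} (hs : MeasurableSet s) : L2 d →L[ℝ] L2 d :=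
  LinearMap.mkContinuous
    { toFun := fun u => ((Lp.memLp u).indicator hs).toLp
      map_add' := fun u w => by
        refine Lp.ext ?_
        filter_upwards [((Lp.memLp (u + w)).indicator hs).coeFn_toLp,
          ((Lp.memLp u).indicator hs).coeFn_toLp, ((Lp.memLp w).indicator hs).coeFn_toLp,
          Lp.coeFn_add u w, Lp.coeFn_add (((Lp.memLp u).indicator hs).toLp)
            (((Lp.memLp w).indicator hs).toLp)] with x h1 h2 h3 h4 h5
        rw [h1, h5, Pi.add_apply, h2, h3]
        by_cases hx : x ∈ s
        · rw [Set.indicator_of_mem hx, Set.indicator_of_mem hx, Set.indicator_of_mem hx, h4,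
            Pi.add_apply]
        · simp [hx]
      map_smul' := fun c u => by
        refine Lp.ext ?_
        filter_upwards [((Lp.memLp (c • u)).indicator hs).coeFn_toLp,
          ((Lp.memLp u).indicator hs).coeFn_toLp, Lp.coeFn_smul c u,
          Lp.coeFn_smul c (((Lp.memLp u).indicator hs).toLp)] with x h1 h2 h3 h4
        rw [h1, RingHom.id_apply, h4, Pi.smul_apply, h2]
        by_cases hx : x ∈ s
        · simp [hx, h3]
        · simp [hx] } 1 fun u => by
    rw [one_mul]
    refine Lp.norm_le_norm_of_ae_le ?_
    filter_upwards [((Lp.memLp u).indicator hs).coeFn_toLp] with x hx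
    change ‖((Lp.memLp u).indicator hs).toLp _ x‖ ≤ _
    rw [hx]
    exact norm_indicator_le_norm_self _ _

theorem restrictL2_ae {d : ℕ} {s : Set (Fin d → ℝ)} (hs : MeasurableSet s) (u : L2 d) :
    restrictL2 hs u =ᵐ[volume.restrict (cube d)] s.indicator u :=
  ((Lp.memLp u).indicator hs).coeFn_toLp

/-- For `d = 1` the operator `cutoff`, acting on the only variable, is the restriction to a cell. -/
theorem lift_cutoff_eq {n : ℕ} (j : Fin 1 → Fin (2 ^ n)) :
    lift 0 (cutoff n (j 0)) = restrictL2 (isOpen_cell n j).measurableSet := by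
  refine clm_ext_tens fun f => ?_
  rw [lift_tens, cutoff_apply]
  refine Lp.ext ?_
  have hm : MemLp ((dyadic n (j 0)).indicator (f 0)) 2 unitMeasure :=
    (Lp.memLp (f 0)).indicator measurableSet_Ioo
  have e1 := tens_ae (Function.update f 0 (cls ((dyadic n (j 0)).indicator (f 0))))
    (g := fun _ => (dyadic n (j 0)).indicator (f 0)) fun i => by
      obtain rfl : i = 0 := Subsingleton.elim _ _
      rw [Function.update_self]
      exact cls_ae hm
  have e2 := tens_ae f (g := fun i => f i) fun i => ae_eq_rfl
  filter_upwards [e1, e2, restrictL2_ae (isOpen_cell n j).measurableSet (tens f)] with x h1 h2 h3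
  rw [h1, h3]
  by_cases hx : x 0 ∈ dyadic n (j 0)
  · have hc : x ∈ cell n j := fun i => by
      obtain rfl : i = 0 := Subsingleton.elim _ _
      exact hx
    rw [Set.indicator_of_mem hc, h2]
    simp [hx]
  · have hc : x ∉ cell n j := fun h => hx (h 0)
    rw [Set.indicator_of_notMem hc]
    simp [hx]

theorem eLpNorm_cell_eq {n : ℕ} (j : Fin 1 → Fin (2 ^ n)) (u : L2 1) :
    eLpNorm u 2 (volume.restrict (cell n j)) = ENNReal.ofReal ‖lift 0 (cutoff n (j 0)) u‖ := by
  have hm := (isOpen_cell n j).measurableSet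
  rw [lift_cutoff_eq, ← eLpNorm_L2, eLpNorm_congr_ae (restrictL2_ae hm u),
    eLpNorm_indicator_eq_eLpNorm_restrict hm, Measure.restrict_restrict hm,
    Set.inter_eq_left.2 (cell_subset_cube n j)]

/-- An operator that commutes with the restriction to a cell is bounded on that cell. -/
theorem eLpNorm_cell_lift_le {n : ℕ} (j : Fin 1 → Fin (2 ^ n)) {A : H →L[ℝ] H} {c : ℝ}
    (hA : A * cutoff n (j 0) = cutoff n (j 0) * A) (hc : ‖A‖ ≤ c) (u : L2 1) :
    eLpNorm (lift 0 A u) 2 (volume.restrict (cell n j)) ≤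
      ENNReal.ofReal c * eLpNorm u 2 (volume.restrict (cell n j)) := by
  rw [eLpNorm_cell_eq, eLpNorm_cell_eq, ← mul_apply_eq_comp, ← lift_mul, ← hA, lift_mul,
    mul_apply_eq_comp, ← ENNReal.ofReal_mul ((norm_nonneg A).trans hc)]
  exact ENNReal.ofReal_le_ofReal (norm_lift_apply_le 0 hc _)

theorem derivNorm_le_sobolevSeminorm {d m : ℕ} {U : Set (Fin d → ℝ)} {α : Fin d → ℕ}
    (hα : ∑ i, α i = m) (v : (Fin d → ℝ) → ℝ) : derivNorm U α v ≤ sobolevSeminorm U m v := by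
  rw [sobolevSeminorm, ← rpow_half_sq (derivNorm U α v)]
  refine ENNReal.rpow_le_rpow ?_ (by norm_num)
  exact Finset.single_le_sum (f := fun β => derivNorm U β v ^ 2) (fun _ _ => zero_le)
    (Finset.mem_piAntidiag.2 ⟨hα, fun _ _ => Finset.mem_univ _⟩)

theorem rate_zero (n q : ℕ) : rate n q 0 = (((2 : ℝ) ^ n) ^ (q + 1))⁻¹ := by
  rw [rate, zpow_neg, ← pow_mul, ← zpow_natCast]
  push_cast
  simp

theorem rate_one (n q : ℕ) : rate n q 1 = (((2 : ℝ) ^ n) ^ q)⁻¹ := by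
  rw [rate, zpow_neg, ← pow_mul, ← zpow_natCast]
  push_cast
  simp

/-- The cellwise estimate in one dimension. On a cell, both sides only involve the restrictions to
that cell, since the operators `errRep` and `errDeriv` commute with `cutoff`. -/
theorem sobolevSeminorm_cell_le {k q n s : ℕ} (hqk : q ≤ k) (hs : s ≤ 1) {v : L2 1}
    (hv : ∃ g, HasWeakDeriv (cube 1) (Pi.single 0 (q + 1)) v g) (j : Fin 1 → Fin (2 ^ n)) {c : ℝ}
    (h0 : s = 0 → 1 ≤ c) (h1 : s = 1 → 1 + ‖polDeriv k‖ ≤ c) :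
    sobolevSeminorm (cell n j) s (fullProj 1 k n v - v : L2 1) ≤
      ENNReal.ofReal (c * rate n q s) * sobolevSeminorm (cell n j) (q + 1) v := by
  obtain ⟨G, hG⟩ := exists_weakDeriv_L2 hv
  have hopen := isOpen_cell n j
  have hsub := cell_subset_cube n j
  have hfull : fullProj 1 k n v - v = (-(-1 : ℝ) ^ (q + 1)) • lift 0 (errRep k n (q + 1)) G := by
    have e : fullProj 1 k n = lift 0 (pwProj k n) := by
      rw [fullProj_eq, lift_eq_tmap]
      congr 1
      funext i
      obtain rfl : i = 0 := Subsingleton.elim _ _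
      simp
    rw [e, neg_smul, ← sub_lift_pwProj (Nat.succ_ne_zero q) (by omega) hG n, neg_sub]
  have hsign : ‖(-(-1 : ℝ) ^ (q + 1))‖ₑ = 1 := by
    rw [enorm_neg, enorm_pow]; simp
  have hcoe : ((fullProj 1 k n v - v : L2 1) : (Fin 1 → ℝ) → ℝ) =ᵐ[volume.restrict (cell n j)]
      (-(-1 : ℝ) ^ (q + 1)) • (lift 0 (errRep k n (q + 1)) G : (Fin 1 → ℝ) → ℝ) := by
    rw [hfull]
    exact (restrict_le_cube hsub).absolutelyContinuous (Lp.coeFn_smul _ _)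
  have hGs : eLpNorm G 2 (volume.restrict (cell n j)) ≤ sobolevSeminorm (cell n j) (q + 1) v := by
    have hG' : HasWeakDeriv (cell n j) (Pi.single 0 (q + 1)) v G :=
      hG.mono hsub (isOpen_cube 1).measurableSet hopen.measurableSet fun φ h => h.mderiv _
    rw [← derivNorm_eq hopen hsub hG']
    exact derivNorm_le_sobolevSeminorm (by simp) _
  have hmem : ∀ u : L2 1, MemLp u 2 (volume.restrict (cell n j)) := fun u =>
    (Lp.memLp u).mono_measure (restrict_le_cube hsub)
  rcases Nat.le_one_iff_eq_zero_or_eq_one.1 hs with rfl | rfl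
  · refine (sobolevSeminorm_zero_le (hmem _)).trans ?_
    rw [eLpNorm_congr_ae hcoe, eLpNorm_const_smul, hsign, one_mul]
    refine (eLpNorm_cell_lift_le j (errRep_mul_cutoff k (q + 1) (j 0))
      ((norm_errRep_le k n (q + 1)).trans ?_) G).trans (mul_le_mul_right hGs _)
    rw [rate_zero]
    exact le_mul_of_one_le_left (by positivity) (h0 rfl)
  · have hd := hasWeakDeriv_lift (isDerivOn_errRep k n q (j 0)) hopen.measurableSet hsub 0
      (fun x hx => hx 0) G
    have hd' := (hd.const_smul (-(-1 : ℝ) ^ (q + 1))).congr hcoe.symm ae_eq_rfl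
    have hle : sobolevSeminorm (cell n j) 1 (fullProj 1 k n v - v : L2 1) ≤
        eLpNorm ((-(-1 : ℝ) ^ (q + 1)) • (lift 0 (errDeriv k n q) G : (Fin 1 → ℝ) → ℝ)) 2
          (volume.restrict (cell n j)) := by
      rw [← ENNReal.pow_le_pow_left_iff two_ne_zero]
      refine (sobolevSeminorm_one_le (b := fun _ => _) fun i => ?_).trans
        (Fin.sum_univ_one _).le
      obtain rfl : i = 0 := Subsingleton.elim _ _
      exact hd'
    refine hle.trans ?_
    rw [eLpNorm_const_smul, hsign, one_mul]
    refine (eLpNorm_cell_lift_le j (errDeriv_mul_cutoff k q (j 0))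
      ((norm_errDeriv_le k n q).trans ?_) G).trans (mul_le_mul_right hGs _)
    rw [rate_one, mul_comm]
    exact mul_le_mul_of_nonneg_right (h1 rfl) (by positivity)

/-! ### Broken derivatives of the projection error -/

theorem hasWeakDeriv_L2_add {d : ℕ} {U : Set (Fin d → ℝ)} (hU : U ⊆ cube d) {j : Fin d}
    {u u' g g' : L2 d} (h : HasWeakDeriv U (Pi.single j 1) u g)
    (h' : HasWeakDeriv U (Pi.single j 1) u' g') :
    HasWeakDeriv U (Pi.single j 1) (u + u' : L2 d) (g + g' : L2 d) :=
  (h.add_single h').congr ((restrict_le_cube hU).absolutelyContinuous (Lp.coeFn_add u u').symm)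
    ((restrict_le_cube hU).absolutelyContinuous (Lp.coeFn_add g g').symm)

theorem hasWeakDeriv_L2_smul {d : ℕ} {U : Set (Fin d → ℝ)} (hU : U ⊆ cube d) {α : Fin d → ℕ}
    (c : ℝ) {u g : L2 d} (h : HasWeakDeriv U α u g) :
    HasWeakDeriv U α (c • u : L2 d) (c • g : L2 d) :=
  (h.const_smul c).congr ((restrict_le_cube hU).absolutelyContinuous (Lp.coeFn_smul c u).symm)
    ((restrict_le_cube hU).absolutelyContinuous (Lp.coeFn_smul c g).symm)

theorem hasWeakDeriv_L2_sum {d : ℕ} {U : Set (Fin d → ℝ)} (hU : U ⊆ cube d) {j : Fin d}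
    {ι : Type*} (s : Finset ι) {u g : ι → L2 d}
    (h : ∀ i ∈ s, HasWeakDeriv U (Pi.single j 1) (u i) (g i)) :
    HasWeakDeriv U (Pi.single j 1) (∑ i ∈ s, u i : L2 d) (∑ i ∈ s, g i : L2 d) := by
  classical
  induction s using Finset.induction_on with
  | empty =>
    have h0 : HasWeakDeriv U (Pi.single j 1) (0 : (Fin d → ℝ) → ℝ) 0 :=
      ⟨MemLp.zero, MemLp.zero, fun φ _ => by simp⟩
    have hz := (restrict_le_cube hU).absolutelyContinuous
      (Lp.coeFn_zero ℝ 2 (volume.restrict (cube d))).symm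
    simpa only [Finset.sum_empty] using h0.congr hz hz
  | insert a s ha ih =>
    rw [Finset.sum_insert ha, Finset.sum_insert ha]
    exact hasWeakDeriv_L2_add hU (h a (Finset.mem_insert_self a s))
      (ih fun i hi => h i (Finset.mem_insert_of_mem hi))

/-- The `j`-th broken derivative of the error of the full projection: one part comes from the error
of the projection in the variable `x_j`, the other one from the errors in the other variables. -/
theorem exists_weakDeriv_fullProj_sub {d k q : ℕ} (hqk : q ≤ k) {v G : L2 d} {j : Fin d}
    (h : HasWeakDeriv (cube d) (Pi.single j (q + 1)) v G) (N : ℕ) :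
    ∃ b : L2 d, ‖b‖ ≤ (((2 : ℝ) ^ N) ^ q)⁻¹ * (1 + ‖polDeriv k‖) * ‖G‖ ∧
      ∀ c : Fin d → Fin (2 ^ N), HasWeakDeriv (cell N c) (Pi.single j 1)
        (fullProj d k N v - v : L2 d)
        (b + lift j (pwDeriv k N) (partialProj d k N (Finset.univ.erase j) v - v) : L2 d) := by
  refine ⟨(-(-1 : ℝ) ^ (q + 1)) • lift j (errDeriv k N q) G, ?_, fun c => ?_⟩
  · rw [norm_smul, norm_neg, norm_pow, norm_neg, norm_one, one_pow, one_mul]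
    exact norm_lift_apply_le j (norm_errDeriv_le k N q) G
  · have e : fullProj d k N v - v = (-(-1 : ℝ) ^ (q + 1)) • lift j (errRep k N (q + 1)) G +
        lift j (pwProj k N) (partialProj d k N (Finset.univ.erase j) v - v) := by
      rw [neg_smul, ← sub_lift_pwProj (Nat.succ_ne_zero q) (by omega) h N, map_sub,
        ← mul_apply_eq_comp (lift j (pwProj k N)),
        ← partialProj_insert k N (Finset.notMem_erase j _),
        Finset.insert_erase (Finset.mem_univ j), fullProj_eq_partialProj]
      abel
    have hm := (isOpen_cell N c).measurableSet
    have hsub := cell_subset_cube N c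
    rw [e]
    exact hasWeakDeriv_L2_add hsub
      (hasWeakDeriv_L2_smul hsub _
        (hasWeakDeriv_lift (isDerivOn_errRep k N q (c j)) hm hsub j (fun x hx => hx j) G))
      (hasWeakDeriv_lift (isDerivOn_pwProj k N (c j)) hm hsub j (fun x hx => hx j) _)

/-- The broken derivative annihilates piecewise constant functions, so that the mean values may be
subtracted before the inverse estimate is applied. -/
theorem norm_lift_pwDeriv_le {d : ℕ} (k N : ℕ) (j : Fin d) (w : L2 d) :
    ‖lift j (pwDeriv k N) w‖ ≤ 2 ^ N * ‖polDeriv k‖ * ‖lift j (1 - pwProj 0 N) w‖ := by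
  have e : pwDeriv k N = pwDeriv k N * (1 - pwProj 0 N) := by
    rw [mul_sub, mul_one, pwDeriv_mul_pwProj_zero, sub_zero]
  conv_lhs => rw [e, lift_mul, mul_apply_eq_comp]
  exact norm_lift_apply_le j (norm_pwDeriv_le k N) _

/-- Subtracting the piecewise mean in `x_j` gains a factor `2^{-N}`, which compensates the loss in
the inverse estimate. -/
theorem norm_lift_pwDeriv_partialProj_sub_sq_le {d k q : ℕ} (hq : 1 ≤ q) (hqk : q ≤ k) {v : L2 d}
    {j : Fin d} {G : Fin d → L2 d}
    (h : ∀ i, HasWeakDeriv (cube d) (Pi.single j 1 + Pi.single i q) v (G i)) (N : ℕ) :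
    ‖lift j (pwDeriv k N) (partialProj d k N (Finset.univ.erase j) v - v)‖ ^ 2 ≤
      ((((2 : ℝ) ^ N) ^ q)⁻¹ * ‖polDeriv k‖) ^ 2 * ∑ i ∈ Finset.univ.erase j, ‖G i‖ ^ 2 := by
  set S := Finset.univ.erase j
  set w := lift j (1 - pwProj 0 N) v with hw
  have e : lift j (1 - pwProj 0 N) (partialProj d k N S v - v) = -(w - partialProj d k N S w) := by
    rw [map_sub, ← mul_apply_eq_comp, lift_partialProj_comm k N (Finset.notMem_erase j _),
      mul_apply_eq_comp, neg_sub]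
  have h1 := norm_lift_pwDeriv_le k N j (partialProj d k N S v - v)
  rw [e, norm_neg] at h1
  have h2 : ‖w - partialProj d k N S w‖ ^ 2 ≤
      ((((2 : ℝ) ^ N) ^ (q + 1))⁻¹) ^ 2 * ∑ i ∈ S, ‖G i‖ ^ 2 := by
    refine (norm_sub_partialProj_sq_le k N S w).trans ?_
    rw [Finset.mul_sum]
    refine Finset.sum_le_sum fun i hi => ?_
    rw [← mul_pow]
    exact pow_le_pow_left₀ (norm_nonneg _) (norm_lift_sub_lift_pwProj_le
      (Finset.ne_of_mem_erase hi) (by omega) (by omega) (h i)) 2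
  calc _ ≤ (2 ^ N * ‖polDeriv k‖ * ‖w - partialProj d k N S w‖) ^ 2 :=
        pow_le_pow_left₀ (norm_nonneg _) h1 2
    _ = (2 ^ N * ‖polDeriv k‖) ^ 2 * ‖w - partialProj d k N S w‖ ^ 2 := by ring
    _ ≤ (2 ^ N * ‖polDeriv k‖) ^ 2 *
          (((((2 : ℝ) ^ N) ^ (q + 1))⁻¹) ^ 2 * ∑ i ∈ S, ‖G i‖ ^ 2) := by gcongr
    _ = _ := by
      rw [← mul_assoc, ← mul_pow]
      congr 2
      rw [pow_succ]
      field_simp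

/-! ### The full tensor-product space -/

theorem norm_fullProj_sub_sq_le {d k q : ℕ} (hqk : q ≤ k) {v : L2 d} {G : Fin d → L2 d}
    (h : ∀ i, HasWeakDeriv (cube d) (Pi.single i (q + 1)) v (G i)) (N : ℕ) :
    ‖fullProj d k N v - v‖ ^ 2 ≤ ((((2 : ℝ) ^ N) ^ (q + 1))⁻¹) ^ 2 * ∑ i, ‖G i‖ ^ 2 := by
  rw [← norm_neg, neg_sub, fullProj_eq_partialProj, Finset.mul_sum]
  refine (norm_sub_partialProj_sq_le k N _ v).trans (Finset.sum_le_sum fun i _ => ?_)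
  rw [← mul_pow]
  exact pow_le_pow_left₀ (norm_nonneg _)
    (norm_sub_lift_pwProj_le (Nat.succ_ne_zero q) (by omega) (h i) N) 2

/-- For `q = 1` the orders `e_j + q e_i` and `e_i + q e_j` agree; on either side of the diagonal the
orders are distinct. -/
theorem injOn_single_add_single {d q : ℕ} (hq : 1 ≤ q) (r : Fin d → Fin d → Prop)
    (hr : ∀ a b, r a b → ¬ r b a) :
    Set.InjOn (fun p : Fin d × Fin d => (Pi.single p.1 1 + Pi.single p.2 q : Fin d → ℕ))
      {p | r p.1 p.2} := by
  rintro ⟨a, b⟩ h ⟨a', b'⟩ h' e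
  change r a b at h
  change r a' b' at h'
  have hab : a ≠ b := fun hab => by subst hab; exact hr _ _ h h
  have hab' : a' ≠ b' := fun hab => by subst hab; exact hr _ _ h' h'
  -- The orders are equal only if the pairs agree up to the exchange of their entries.
  have hno : a = b' → a' ≠ b := fun h1 h2 => by
    subst h1 h2
    exact hr _ _ h h'
  have ea := congrFun e a
  have ea' := congrFun e a'
  have eb := congrFun e b
  simp only [Pi.add_apply, Pi.single_apply] at ea ea' eb
  have : a = a' ∧ b = b' := by grind
  rw [this.1, this.2]

theorem ofReal_max_le {x y : ℝ} {S : ℝ≥0∞} (hx : ENNReal.ofReal x ≤ S)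
    (hy : ENNReal.ofReal y ≤ S) : ENNReal.ofReal (max x y) ≤ S := by
  rcases max_choice x y with h | h <;> rwa [h]

theorem brokenSeminorm_fullProj_sub_zero_le {d k q : ℕ} (hqk : q ≤ k) {v : L2 d}
    (hv : ∀ α : Fin d → ℕ, ∑ i, α i = q + 1 → ∃ g, HasWeakDeriv (cube d) α v g) (N : ℕ) :
    brokenSeminorm N 0 (fullProj d k N v - v : L2 d) ≤
      ENNReal.ofReal (rate N q 0) * sobolevSeminorm (cube d) (q + 1) v := by
  have hsum : ∀ i : Fin d, ∑ x, (Pi.single i (q + 1) : Fin d → ℕ) x = q + 1 := fun i => by simp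
  choose G hG using fun i => exists_weakDeriv_L2 (hv _ (hsum i))
  have hX := le_sobolevSeminorm Finset.univ (fun i => Pi.single i (q + 1)) G (fun i _ => hsum i)
    (fun i _ i' _ h => by
      by_contra hne
      simpa [hne] using congrFun h i) fun i _ => hG i
  refine (brokenSeminorm_zero_le N _).trans (le_trans ?_ (mul_le_mul_right hX _))
  rw [← ENNReal.ofReal_mul (by rw [rate_zero]; positivity), rate_zero]
  refine ENNReal.ofReal_le_ofReal (abs_le_of_sq_le_sq' ?_ (by positivity)).2
  rw [mul_pow, Real.sq_sqrt (by positivity)]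
  exact norm_fullProj_sub_sq_le hqk hG N

/-- The constant `3 (1 + δ)` with `δ = ‖polDeriv k‖` is due to `2 (1 + δ)² + 4 δ² ≤ 9 (1 + δ)²`: the
terms `2 (1 + δ)²` and `2 δ²` come from `(a + b)² ≤ 2 a² + 2 b²`, and the mixed derivatives are
counted twice. -/
theorem brokenSeminorm_fullProj_sub_one_le {d k q : ℕ} (hq : 1 ≤ q) (hqk : q ≤ k) {v : L2 d}
    (hv : ∀ α : Fin d → ℕ, ∑ i, α i = q + 1 → ∃ g, HasWeakDeriv (cube d) α v g) (N : ℕ) :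
    brokenSeminorm N 1 (fullProj d k N v - v : L2 d) ≤
      ENNReal.ofReal (3 * (1 + ‖polDeriv k‖) * rate N q 1) *
        sobolevSeminorm (cube d) (q + 1) v := by
  have hsum : ∀ i : Fin d, ∑ x, (Pi.single i (q + 1) : Fin d → ℕ) x = q + 1 := fun i => by simp
  have hsum2 : ∀ p : Fin d × Fin d,
      ∑ x, (Pi.single p.1 1 + Pi.single p.2 q : Fin d → ℕ) x = q + 1 := fun p => by
    simp [Finset.sum_add_distrib, add_comm]
  choose G hG using fun i => exists_weakDeriv_L2 (hv _ (hsum i))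
  choose G2 hG2 using fun p => exists_weakDeriv_L2 (hv _ (hsum2 p))
  choose b hb hbd using fun j => exists_weakDeriv_fullProj_sub hqk (hG j) N
  have hX := le_sobolevSeminorm Finset.univ (fun i => Pi.single i (q + 1)) G (fun i _ => hsum i)
    (fun i _ i' _ h => by
      by_contra hne
      simpa [hne] using congrFun h i) fun i _ => hG i
  have hY := le_sobolevSeminorm (Finset.univ.filter fun p : Fin d × Fin d => p.1 < p.2) _ G2
    (fun p _ => hsum2 p) (by
      simpa using injOn_single_add_single hq (· < ·) fun a b h => h.not_gt) fun p _ => hG2 p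
  have hZ := le_sobolevSeminorm (Finset.univ.filter fun p : Fin d × Fin d => p.2 < p.1) _ G2
    (fun p _ => hsum2 p) (by
      simpa using injOn_single_add_single hq (· > ·) fun a b h => h.not_gt) fun p _ => hG2 p
  -- The pairs `(j, i)` off the diagonal are split so that `le_sobolevSeminorm` applies to each half.
  have hpairs : ∑ j, ∑ i ∈ Finset.univ.erase j, ‖G2 (j, i)‖ ^ 2 =
      (∑ p ∈ Finset.univ.filter fun p : Fin d × Fin d => p.1 < p.2, ‖G2 p‖ ^ 2) +
        ∑ p ∈ Finset.univ.filter fun p : Fin d × Fin d => p.2 < p.1, ‖G2 p‖ ^ 2 := by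
    rw [← Finset.sum_union, ← Finset.sum_finset_product' (f := fun j i => ‖G2 (j, i)‖ ^ 2)]
    · intro p
      simp only [Finset.mem_union, Finset.mem_filter, Finset.mem_univ, true_and, Finset.mem_erase,
        and_true]
      exact ⟨fun h => h.elim ne_of_gt ne_of_lt, fun h => (lt_or_gt_of_ne h).symm⟩
    · exact Finset.disjoint_filter.2 fun p _ h => h.not_gt
  set X2 := ∑ i, ‖G i‖ ^ 2
  set Y2 := ∑ p ∈ Finset.univ.filter fun p : Fin d × Fin d => p.1 < p.2, ‖G2 p‖ ^ 2
  set Z2 := ∑ p ∈ Finset.univ.filter fun p : Fin d × Fin d => p.2 < p.1, ‖G2 p‖ ^ 2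
  have hX0 : 0 ≤ X2 := by positivity
  have hY0 : 0 ≤ Y2 := by positivity
  have hZ0 : 0 ≤ Z2 := by positivity
  have hM := ofReal_max_le hX (ofReal_max_le hY hZ)
  set M := max √X2 (max √Y2 √Z2) with hMdef
  have hXM : X2 ≤ M ^ 2 := (Real.sqrt_le_left (by positivity)).1 (le_max_left _ _)
  have hYM : Y2 ≤ M ^ 2 := (Real.sqrt_le_left (by positivity)).1
    ((le_max_left _ _).trans (le_max_right _ _))
  have hZM : Z2 ≤ M ^ 2 := (Real.sqrt_le_left (by positivity)).1
    ((le_max_right _ _).trans (le_max_right _ _))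
  refine (brokenSeminorm_one_le N _ _ fun c j => hbd j c).trans
    (le_trans ?_ (mul_le_mul_right hM _))
  rw [← ENNReal.ofReal_mul (by rw [rate_one]; positivity), rate_one]
  refine ENNReal.ofReal_le_ofReal ((Real.sqrt_le_left (by positivity)).2 ?_)
  set r := (((2 : ℝ) ^ N) ^ q)⁻¹
  set δ := ‖polDeriv k‖ with hδ
  have hδ0 : 0 ≤ δ := norm_nonneg _
  calc _ ≤ ∑ j, (2 * ((r * (1 + δ)) ^ 2 * ‖G j‖ ^ 2) +
          2 * ((r * δ) ^ 2 * ∑ i ∈ Finset.univ.erase j, ‖G2 (j, i)‖ ^ 2)) := by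
        refine Finset.sum_le_sum fun j _ => ?_
        have h1 : ‖b j‖ ^ 2 ≤ (r * (1 + δ)) ^ 2 * ‖G j‖ ^ 2 := by
          rw [← mul_pow]
          exact pow_le_pow_left₀ (norm_nonneg _) (hb j) 2
        have h2 := norm_lift_pwDeriv_partialProj_sub_sq_le hq hqk
          (G := fun i => G2 (j, i)) (fun i => hG2 (j, i)) N
        refine (pow_le_pow_left₀ (norm_nonneg _) (norm_add_le _ _) 2).trans ?_
        refine (add_sq_le (a := ‖b j‖)).trans ?_
        rw [mul_add]
        gcongr
    _ = 2 * (r * (1 + δ)) ^ 2 * X2 + 2 * (r * δ) ^ 2 * (Y2 + Z2) := by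
        rw [Finset.sum_add_distrib, ← Finset.mul_sum, ← Finset.mul_sum, ← Finset.mul_sum,
          ← Finset.mul_sum, hpairs]
        ring
    _ ≤ 2 * (r * (1 + δ)) ^ 2 * M ^ 2 + 2 * (r * δ) ^ 2 * (M ^ 2 + M ^ 2) := by gcongr
    _ = r ^ 2 * M ^ 2 * (2 * (1 + δ) ^ 2 + 4 * δ ^ 2) := by ring
    _ ≤ r ^ 2 * M ^ 2 * (3 * (1 + δ)) ^ 2 := by
        gcongr
        nlinarith
    _ = _ := by ring

/-! ### The increments of the sparse space -/

/-- `m` bounds the `L²` norms of the mixed derivatives `∏_{i ∈ L} ∂_i^{q+1} v`, `L ≠ ∅`. -/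
def HasMixedBound {d : ℕ} (q : ℕ) (v : L2 d) (m : ℝ) : Prop :=
  ∀ L : Finset (Fin d), L.Nonempty →
    ∃ G : L2 d, HasWeakDeriv (cube d) (fun i => if i ∈ L then q + 1 else 0) v G ∧ ‖G‖ ≤ m

theorem exists_hasMixedBound {d p q : ℕ} (hd : 1 ≤ d) (hqp : q ≤ p) {v : L2 d}
    (hv : MemMixedSobolev (cube d) (p + 1) v) :
    ∃ m : ℝ, 0 ≤ m ∧ HasMixedBound q v m ∧
      ENNReal.ofReal m ≤ mixedSeminorm (cube d) (q + 1) v := by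
  classical
  have hex : ∀ L : Finset (Fin d), ∃ G : L2 d,
      HasWeakDeriv (cube d) (fun i => if i ∈ L then q + 1 else 0) v G := fun L =>
    exists_weakDeriv_L2 (hv _ fun i => by split_ifs <;> omega)
  choose G hG using hex
  have hne : (Finset.univ.filter fun L : Finset (Fin d) => L.Nonempty).Nonempty :=
    ⟨{⟨0, hd⟩}, by simp⟩
  obtain ⟨L0, h0, hmax⟩ := Finset.exists_max_image _ (fun L => ‖G L‖) hne
  refine ⟨‖G L0‖, norm_nonneg _, fun L hL => ⟨G L, hG L, hmax L (by simpa using hL)⟩, ?_⟩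
  rw [← derivNorm_cube (hG L0)]
  exact le_iSup₂_of_le L0 (Finset.mem_filter.1 h0).2 le_rfl

theorem HasMixedBound.single {d q : ℕ} {v : L2 d} {m : ℝ} (h : HasMixedBound q v m) (i : Fin d) :
    ∃ G : L2 d, HasWeakDeriv (cube d) (Pi.single i (q + 1)) v G ∧ ‖G‖ ≤ m := by
  obtain ⟨G, hG, hm⟩ := h {i} (Finset.singleton_nonempty i)
  refine ⟨G, ?_, hm⟩
  convert hG using 1
  funext x
  simp [Pi.single_apply]

/-- The orthogonality argument would give `√d`; the factor `d` suffices here. -/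
theorem HasMixedBound.norm_sub_partialProj_le {d k q : ℕ} (hqk : q ≤ k) {v : L2 d} {m : ℝ}
    (hm0 : 0 ≤ m) (h : HasMixedBound q v m) (N : ℕ) (S : Finset (Fin d)) :
    ‖v - partialProj d k N S v‖ ≤ d * ((((2 : ℝ) ^ N) ^ (q + 1))⁻¹ * m) := by
  have h1 : ∀ i ∈ S, ‖v - lift i (pwProj k N) v‖ ^ 2 ≤ ((((2 : ℝ) ^ N) ^ (q + 1))⁻¹ * m) ^ 2 := by
    intro i _
    obtain ⟨G, hG, hGm⟩ := h.single i
    exact pow_le_pow_left₀ (norm_nonneg _) ((norm_sub_lift_pwProj_le (Nat.succ_ne_zero q)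
      (by omega) hG N).trans (mul_le_mul_of_nonneg_left hGm (by positivity))) 2
  have h2 := (norm_sub_partialProj_sq_le k N S v).trans (Finset.sum_le_sum h1)
  rw [Finset.sum_const, nsmul_eq_mul] at h2
  have hS : (S.card : ℝ) ≤ (d : ℝ) ^ 2 := by
    have h3 : S.card ≤ d := by simpa using S.card_le_univ
    exact_mod_cast h3.trans (Nat.le_self_pow two_ne_zero d)
  refine (abs_le_of_sq_le_sq' ?_ (by positivity)).2
  rw [mul_pow (d : ℝ)]
  exact h2.trans (mul_le_mul_of_nonneg_right hS (sq_nonneg _))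

theorem pwDiff_succ (k n : ℕ) : pwDiff k (n + 1) = pwProj k (n + 1) * (1 - pwProj k n) := by
  rw [mul_sub, mul_one, pwProj_mul_of_le k n.le_succ, pwDiff]

theorem pwProj_mul_pwDiff (k n : ℕ) : pwProj k n * pwDiff k n = pwDiff k n := by
  cases n with
  | zero => exact pwProj_mul_self k 0
  | succ n => rw [pwDiff_succ, ← mul_assoc, pwProj_mul_self]

/-- The increment of level `l` is of size `2^{-(q+1)|l|}`: each variable `x_i` with `l_i ≥ 1`
contributes a projection error of level `l_i - 1`. -/
theorem HasMixedBound.norm_tmap_pwDiff_le {d k q : ℕ} (hqk : q ≤ k) {v : L2 d} {m : ℝ}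
    (h : HasMixedBound q v m) {l : Fin d → ℕ} (hl : ∑ i, l i ≠ 0) :
    ‖tmap (fun i => pwDiff k (l i)) v‖ ≤
      ((2 : ℝ) ^ (q + 1)) ^ d * (((2 : ℝ) ^ (q + 1)) ^ ∑ i, l i)⁻¹ * m := by
  obtain ⟨i0, -, hi0⟩ : ∃ i ∈ Finset.univ, l i ≠ 0 := by
    by_contra hcon
    push Not at hcon
    exact hl (Finset.sum_eq_zero hcon)
  obtain ⟨G, hG, hGm⟩ := h (Finset.univ.filter fun i => l i ≠ 0) ⟨i0, by simpa using hi0⟩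
  simp only [Finset.mem_filter, Finset.mem_univ, true_and] at hG
  have key := norm_tmap_one_sub_pwProj_le hG (fun _ => k) (fun i => l i - 1) fun i => by
    split_ifs <;> omega
  -- `P_{n+1} - P_n = P_{n+1} (1 - P_n)`, where `P_{n+1}` is a contraction.
  have e : (fun i => pwDiff k (l i)) = (fun i => pwProj k (l i)) *
      fun i => if (if l i ≠ 0 then q + 1 else 0) = 0 then 1 else 1 - pwProj k (l i - 1) := by
    funext i
    rw [Pi.mul_apply]
    rcases Nat.eq_zero_or_pos (l i) with hi | hi
    · simp [hi, pwDiff]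
    · obtain ⟨n, hn⟩ := Nat.exists_eq_succ_of_ne_zero hi.ne'
      simp [hn, pwDiff_succ]
  have hP : ‖tmap fun i => pwProj k (l i)‖ ≤ 1 :=
    (norm_tmap_le _).trans (Finset.prod_le_one (fun _ _ => norm_nonneg _)
      fun i _ => norm_pwProj_le k (l i))
  rw [e, ← tmap_mul, mul_apply_eq_comp]
  refine (norm_clm_apply_le hP _).trans ?_
  rw [one_mul]
  refine key.trans (mul_le_mul ?_ hGm (norm_nonneg _) (by positivity))
  rw [← Finset.prod_pow_eq_pow_sum, ← Finset.prod_inv_distrib]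
  have hd : ((2 : ℝ) ^ (q + 1)) ^ d = ∏ _i : Fin d, (2 : ℝ) ^ (q + 1) := by simp
  rw [hd, ← Finset.prod_mul_distrib]
  refine Finset.prod_le_prod (fun _ _ => by positivity) fun i _ => ?_
  rcases Nat.eq_zero_or_pos (l i) with hi | hi
  · simp only [hi, ne_eq, not_true_eq_false, if_false, pow_zero, inv_one, mul_one]
    exact one_le_pow₀ one_le_two
  · obtain ⟨n, hn⟩ := Nat.exists_eq_succ_of_ne_zero hi.ne'
    refine le_of_eq ?_
    simp only [hn, Nat.succ_ne_zero, ne_eq, not_false_eq_true, if_true, Nat.succ_eq_add_one,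
      Nat.add_sub_cancel]
    rw [pow_succ ((2 : ℝ) ^ (q + 1)) n, mul_inv, mul_comm _ ((2 : ℝ) ^ (q + 1))⁻¹, ← mul_assoc,
      mul_inv_cancel₀ (by positivity), one_mul, ← pow_mul, ← pow_mul, mul_comm n]

theorem exists_dyadic_supset {n N : ℕ} (h : n ≤ N) (c : Fin (2 ^ N)) :
    ∃ i : Fin (2 ^ n), dyadic N c ⊆ dyadic n i := by
  have key : ∃ i : Fin (2 ^ n), Set.Ioc (((c : ℕ) : ℝ) / 2 ^ N) ((((c : ℕ) : ℝ) + 1) / 2 ^ N) ⊆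
      Set.Ioc (((i : ℕ) : ℝ) / 2 ^ n) ((((i : ℕ) : ℝ) + 1) / 2 ^ n) := by
    induction N, h using Nat.le_induction with
    | base => exact ⟨c, subset_rfl⟩
    | succ N _ ih =>
      obtain ⟨c', hc'⟩ := halfOpen_subset c
      obtain ⟨i, hi⟩ := ih c'
      exact ⟨i, hc'.trans hi⟩
  obtain ⟨i, hi⟩ := key
  refine ⟨i, ?_⟩
  have := interior_mono hi
  rwa [interior_Ioc, interior_Ioc] at this

/-- An increment of level `l` is piecewise polynomial in `x_j` on the coarser grid of level `l_j`, so
that its broken derivative costs only `2^{l_j}`. -/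
theorem hasWeakDeriv_tmap_pwDiff {d k N : ℕ} {l : Fin d → ℕ} {j : Fin d} (hl : l j ≤ N)
    (c : Fin d → Fin (2 ^ N)) (v : L2 d) :
    HasWeakDeriv (cell N c) (Pi.single j 1) (tmap (fun i => pwDiff k (l i)) v)
      (lift j (pwDeriv k (l j)) (tmap (fun i => pwDiff k (l i)) v)) := by
  obtain ⟨i, hi⟩ := exists_dyadic_supset hl (c j)
  have e : lift j (pwProj k (l j)) * tmap (fun i => pwDiff k (l i)) =
      tmap fun i => pwDiff k (l i) := by
    rw [lift_eq_tmap, tmap_mul]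
    congr 1
    funext x
    rcases eq_or_ne x j with rfl | hx
    · simp [pwProj_mul_pwDiff]
    · simp [hx]
  have key := hasWeakDeriv_lift ((isDerivOn_pwProj k (l j) i).mono hi)
    (isOpen_cell N c).measurableSet (cell_subset_cube N c) j (fun x hx => hx j)
    (tmap (fun i => pwDiff k (l i)) v)
  rwa [← mul_apply_eq_comp, e] at key

/-- In the sum over the missing levels, the weight `2^{l_j}` lost by the derivative is compensated:
for a given `|l|`, the levels other than `l_j` are summed with weights `2^{-l_i}`, and the sum over
`|l| > N` is geometric. -/
theorem sum_levels_le {d q : ℕ} (hq : 1 ≤ q) (N : ℕ) (j : Fin d) :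
    ∑ l ∈ (levels d N).filter (fun l => N < ∑ i, l i),
      (2 : ℝ) ^ l j * (((2 : ℝ) ^ (q + 1)) ^ ∑ i, l i)⁻¹ ≤ 2 ^ d * (((2 : ℝ) ^ N) ^ q)⁻¹ := by
  classical
  set x : ℝ := ((2 : ℝ) ^ q)⁻¹ with hx
  have hx0 : 0 < x := by positivity
  have hx2 : x ≤ 1 / 2 := by
    rw [hx, one_div]
    exact inv_anti₀ two_pos (le_self_pow₀ one_le_two (by omega))
  let f : ℕ × (Fin d → ℕ) → ℝ := fun p => x ^ p.1 * ∏ i, (1 / 2 : ℝ) ^ p.2 i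
  -- `|l|` and the components of `l` other than `l_j` determine `l`.
  let φ : (Fin d → ℕ) → ℕ × (Fin d → ℕ) := fun l => (∑ i, l i, Function.update l j 0)
  have hsum : ∀ l : Fin d → ℕ, ∑ i, l i = l j + ∑ i, Function.update l j 0 i := fun l => by
    rw [← Finset.add_sum_erase _ _ (Finset.mem_univ j), ← Finset.add_sum_erase _
      (Function.update l j 0) (Finset.mem_univ j), Function.update_self, zero_add]
    congr 1
    exact Finset.sum_congr rfl fun i hi => by rw [Function.update_of_ne (Finset.ne_of_mem_erase hi)]
  have hterm : ∀ l : Fin d → ℕ, (2 : ℝ) ^ l j * (((2 : ℝ) ^ (q + 1)) ^ ∑ i, l i)⁻¹ = f (φ l) := by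
    intro l
    simp only [f, φ]
    rw [Finset.prod_pow_eq_pow_sum, pow_succ, mul_pow, mul_inv, hx, inv_pow, one_div, inv_pow]
    have h2 : (2 : ℝ) ^ ∑ i, l i = 2 ^ l j * 2 ^ ∑ i, Function.update l j 0 i := by
      rw [← pow_add, ← hsum]
    rw [h2]
    field_simp
  have hinj : Set.InjOn φ ((levels d N).filter fun l => N < ∑ i, l i) := by
    intro l _ l' _ h
    have h1 : ∑ i, l i = ∑ i, l' i := congrArg Prod.fst h
    have h2 : Function.update l j 0 = Function.update l' j 0 := congrArg Prod.snd h
    rw [hsum l, hsum l', h2] at h1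
    funext i
    rcases eq_or_ne i j with rfl | hi
    · omega
    · have := congrFun h2 i
      rwa [Function.update_of_ne hi, Function.update_of_ne hi] at this
  have hsub : ((levels d N).filter fun l => N < ∑ i, l i).image φ ⊆
      Finset.Ico (N + 1) (d * N + 1) ×ˢ levels d N := by
    intro p hp
    obtain ⟨l, hl, rfl⟩ := Finset.mem_image.1 hp
    obtain ⟨hl1, hl2⟩ := Finset.mem_filter.1 hl
    rw [mem_levels] at hl1
    refine Finset.mem_product.2 ⟨Finset.mem_Ico.2 ⟨hl2, Nat.lt_succ_of_le ?_⟩,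
      mem_levels.2 fun i => ?_⟩
    · simpa using Finset.sum_le_sum fun i (_ : i ∈ Finset.univ) => hl1 i
    · rcases eq_or_ne i j with rfl | hi
      · simp [φ]
      · simpa [φ, hi] using hl1 i
  have hs : ∑ s ∈ Finset.Ico (N + 1) (d * N + 1), x ^ s ≤ x ^ N := by
    refine (geom_sum_Ico_le_of_lt_one hx0.le (by linarith)).trans ?_
    rw [div_le_iff₀ (by linarith), pow_succ]
    exact mul_le_mul_of_nonneg_left (by linarith) (by positivity)
  have ht : ∑ l ∈ levels d N, ∏ i, (1 / 2 : ℝ) ^ l i ≤ 2 ^ d := by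
    rw [levels, ← Finset.prod_univ_sum (fun _ => Finset.range (N + 1)) fun _ n => (1 / 2 : ℝ) ^ n,
      Finset.prod_const, Finset.card_univ, Fintype.card_fin]
    refine pow_le_pow_left₀ (Finset.sum_nonneg fun _ _ => by positivity) ?_ d
    have := geom_sum_Ico_le_of_lt_one (m := 0) (n := N + 1) (x := (1 / 2 : ℝ)) (by norm_num)
      (by norm_num)
    rw [Finset.range_eq_Ico]
    exact this.trans (by norm_num)
  rw [Finset.sum_congr rfl fun l _ => hterm l, ← Finset.sum_image hinj]
  refine (Finset.sum_le_sum_of_subset_of_nonneg hsub fun p _ _ => by positivity).trans ?_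
  have hxN : x ^ N = (((2 : ℝ) ^ N) ^ q)⁻¹ := by rw [hx, inv_pow, ← pow_mul, ← pow_mul, mul_comm]
  rw [Finset.sum_product, ← hxN, mul_comm ((2 : ℝ) ^ d)]
  simp only [f, ← Finset.mul_sum, ← Finset.sum_mul]
  exact mul_le_mul hs ht (Finset.sum_nonneg fun _ _ => by positivity) (by positivity)

/-! ### The sparse space -/

theorem HasMixedBound.brokenSeminorm_sparseProj_sub_zero_le {d k q : ℕ} (hqk : q ≤ k) {v : L2 d}
    {m : ℝ} (hm0 : 0 ≤ m) (h : HasMixedBound q v m) (N : ℕ) :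
    brokenSeminorm N 0 (sparseProj d k N v - v : L2 d) ≤
      ENNReal.ofReal ((d + ((N : ℝ) + 1) ^ d * ((2 : ℝ) ^ (q + 1)) ^ d * ((2 : ℝ) ^ (q + 1))⁻¹) *
        rate N q 0 * m) := by
  refine (brokenSeminorm_zero_le N _).trans (ENNReal.ofReal_le_ofReal ?_)
  set F := (levels d N).filter fun l => N < ∑ i, l i with hF
  have e : sparseProj d k N v - v = -(v - partialProj d k N Finset.univ v) -
      ∑ l ∈ F, tmap (fun i => pwDiff k (l i)) v := by
    rw [← sum_apply, ← fullProj_sub_sparseProj, sub_apply, fullProj_eq_partialProj]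
    abel
  have hterm : ∀ l ∈ F, ‖tmap (fun i => pwDiff k (l i)) v‖ ≤
      ((2 : ℝ) ^ (q + 1)) ^ d * (((2 : ℝ) ^ (q + 1)) ^ (N + 1))⁻¹ * m := fun l hl => by
    have hl' := (Finset.mem_filter.1 hl).2
    refine (h.norm_tmap_pwDiff_le hqk (by omega)).trans ?_
    gcongr
    · exact one_le_pow₀ one_le_two
    · exact hl'
  have hcard : (F.card : ℝ) ≤ ((N : ℝ) + 1) ^ d := by
    have h1 : F.card ≤ (N + 1) ^ d := (Finset.card_filter_le _ _).trans (by simp [levels])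
    exact_mod_cast h1
  have hsum : ‖∑ l ∈ F, tmap (fun i => pwDiff k (l i)) v‖ ≤ ((N : ℝ) + 1) ^ d *
      (((2 : ℝ) ^ (q + 1)) ^ d * (((2 : ℝ) ^ (q + 1)) ^ (N + 1))⁻¹ * m) := by
    refine (norm_sum_le _ _).trans ((Finset.sum_le_sum hterm).trans ?_)
    rw [Finset.sum_const, nsmul_eq_mul]
    gcongr
  rw [e]
  refine (norm_sub_le _ _).trans ?_
  rw [norm_neg]
  refine (add_le_add (h.norm_sub_partialProj_le hqk hm0 N Finset.univ) hsum).trans (le_of_eq ?_)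
  rw [rate_zero, pow_succ ((2 : ℝ) ^ (q + 1)) N, mul_inv, pow_right_comm (2 : ℝ) (q + 1) N]
  ring

theorem HasMixedBound.brokenSeminorm_sparseProj_sub_one_le {d k q : ℕ} (hq : 1 ≤ q) (hqk : q ≤ k)
    {v : L2 d} {m : ℝ} (hm0 : 0 ≤ m) (h : HasMixedBound q v m) (N : ℕ) :
    brokenSeminorm N 1 (sparseProj d k N v - v : L2 d) ≤
      ENNReal.ofReal (√d * (1 + ‖polDeriv k‖ + d * ‖polDeriv k‖ +
        ‖polDeriv k‖ * ((2 : ℝ) ^ (q + 2)) ^ d) * rate N q 1 * m) := by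
  set F := (levels d N).filter fun l => N < ∑ i, l i with hF
  choose G hG hGm using h.single
  choose b hb hbd using fun j => exists_weakDeriv_fullProj_sub hqk (hG j) N
  set δ := ‖polDeriv k‖
  have hδ0 : 0 ≤ δ := norm_nonneg _
  let b1 : Fin d → L2 d := fun j =>
    lift j (pwDeriv k N) (partialProj d k N (Finset.univ.erase j) v - v)
  let b2 : Fin d → L2 d := fun j =>
    ∑ l ∈ F, lift j (pwDeriv k (l j)) (tmap (fun i => pwDiff k (l i)) v)
  have e : sparseProj d k N v - v = (fullProj d k N v - v) +
      (-1 : ℝ) • ∑ l ∈ F, tmap (fun i => pwDiff k (l i)) v := by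
    rw [← sum_apply, ← fullProj_sub_sparseProj, sub_apply, neg_one_smul]
    abel
  have hder : ∀ c j, HasWeakDeriv (cell N c) (Pi.single j 1) (sparseProj d k N v - v : L2 d)
      (b j + b1 j + (-1 : ℝ) • b2 j : L2 d) := fun c j => by
    have hsub := cell_subset_cube N c
    rw [e]
    refine hasWeakDeriv_L2_add hsub (hbd j c) (hasWeakDeriv_L2_smul hsub _
      (hasWeakDeriv_L2_sum hsub F fun l hl => ?_))
    exact hasWeakDeriv_tmap_pwDiff (mem_levels.1 (Finset.mem_filter.1 hl).1 j) c v
  set r := (((2 : ℝ) ^ N) ^ q)⁻¹ with hr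
  have hr0 : 0 < r := by positivity
  have hb1 : ∀ j, ‖b1 j‖ ≤ d * δ * r * m := fun j => by
    refine (norm_lift_apply_le j (norm_pwDeriv_le k N) _).trans ?_
    rw [norm_sub_rev]
    refine (mul_le_mul_of_nonneg_left (h.norm_sub_partialProj_le hqk hm0 N _)
      (by positivity)).trans (le_of_eq ?_)
    rw [pow_succ, mul_inv, ← hr]
    change 2 ^ N * δ * (d * (r * ((2 : ℝ) ^ N)⁻¹ * m)) = _
    field_simp
  have hb2 : ∀ j, ‖b2 j‖ ≤ δ * ((2 : ℝ) ^ (q + 2)) ^ d * r * m := fun j => by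
    have hterm : ∀ l ∈ F, ‖lift j (pwDeriv k (l j)) (tmap (fun i => pwDiff k (l i)) v)‖ ≤
        δ * ((2 : ℝ) ^ (q + 1)) ^ d * m * (2 ^ l j * (((2 : ℝ) ^ (q + 1)) ^ ∑ i, l i)⁻¹) := by
      intro l hl
      have hl' := (Finset.mem_filter.1 hl).2
      refine (norm_lift_apply_le j (norm_pwDeriv_le k (l j)) _).trans ?_
      refine (mul_le_mul_of_nonneg_left (h.norm_tmap_pwDiff_le hqk (by omega))
        (by positivity)).trans (le_of_eq ?_)
      ring
    refine (norm_sum_le _ _).trans ((Finset.sum_le_sum hterm).trans ?_)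
    rw [← Finset.mul_sum]
    refine (mul_le_mul_of_nonneg_left (sum_levels_le hq N j) (by positivity)).trans (le_of_eq ?_)
    rw [pow_succ (2 : ℝ) (q + 1), mul_pow]
    ring
  have hbj : ∀ j, ‖b j + b1 j + (-1 : ℝ) • b2 j‖ ≤
      (1 + δ + d * δ + δ * ((2 : ℝ) ^ (q + 2)) ^ d) * r * m := fun j => by
    refine (norm_add₃_le).trans ?_
    rw [norm_smul, norm_neg, norm_one, one_mul]
    have h1 := (hb j).trans (mul_le_mul_of_nonneg_left (hGm j) (by positivity))
    linarith [h1, hb1 j, hb2 j]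
  refine (brokenSeminorm_one_le N _ _ hder).trans (ENNReal.ofReal_le_ofReal ?_)
  rw [rate_one, ← hr, mul_assoc, mul_assoc, ← mul_assoc _ r m]
  refine (Real.sqrt_le_left (by positivity)).2 ?_
  rw [mul_pow, Real.sq_sqrt (Nat.cast_nonneg d)]
  refine (Finset.sum_le_sum fun j _ => pow_le_pow_left₀ (norm_nonneg _) (hbj j) 2).trans ?_
  simp

/-! ### The constants -/

theorem le_cTilde {c : ℕ → ℝ} {s : ℕ} (hc : 0 ≤ c s) (q : ℕ) : c s ≤ cTilde c q s :=
  le_mul_of_one_le_right hc (le_add_of_nonneg_right (by positivity))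

theorem one_le_bigC (c : ℕ → ℝ) (k q : ℕ) : 1 ≤ bigC c k q := by
  rw [bigC, cHat, if_pos rfl]
  exact le_max_right _ _

theorem le_bigC {c : ℕ → ℝ} (hc : 0 ≤ c 0) (k q : ℕ) : c 0 ≤ bigC c k q :=
  (le_cTilde hc q).trans (le_max_left _ _)

theorem le_sqrt_cBar {c : ℕ → ℝ} (hc : 0 ≤ c 1) (k q : ℕ) : c 1 ≤ √(cBar c k q) := by
  refine Real.le_sqrt_of_sq_le (le_trans ?_ (le_max_left _ _))
  rw [cHat, if_pos rfl, one_pow, mul_one]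
  exact pow_le_pow_left₀ hc (le_cTilde hc q) 2

theorem B_pos {c : ℕ → ℝ} {d : ℕ} (hc : 0 < c 1) (hd : 0 < d) (k q s : ℕ) :
    0 < B c k q d s := by
  rw [B]
  have h1 : 0 < √(cBar c k q) := hc.trans_le (le_sqrt_cBar hc.le k q)
  have h2 : 0 < bigC c k q := zero_lt_one.trans_le (one_le_bigC c k q)
  have h3 : (0 : ℝ) < d := Nat.cast_pos.2 hd
  split_ifs <;> positivity

theorem kappa_pos (c : ℕ → ℝ) (k q N s : ℕ) : 0 < kappa c k q N s := by
  rw [kappa]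
  have h2 : 0 < bigC c k q := zero_lt_one.trans_le (one_le_bigC c k q)
  split_ifs <;> positivity

theorem B_zero_mul_kappa (c : ℕ → ℝ) (k q d N : ℕ) : B c k q d 0 * kappa c k q N 0 ^ d =
    ((N : ℝ) + 1) ^ d * bigC c k q ^ d * ((2 : ℝ) ^ (q + 1))⁻¹ := by
  rw [B, kappa, if_pos rfl, if_pos rfl, zpow_neg, mul_pow, ← zpow_natCast (2 : ℝ) (q + 1)]
  push_cast
  ring

/-- The bound `2^{q+2}` for `c 0` makes `C_{k,q}` at least twice the factor `2^{q+1}` lost per variable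
in the increments. -/
theorem sparse_const_zero_le {c : ℕ → ℝ} {q : ℕ} (hc : (2 : ℝ) ^ (q + 2) ≤ c 0) {d : ℕ}
    (hd : 1 ≤ d) (k N : ℕ) :
    d + ((N : ℝ) + 1) ^ d * ((2 : ℝ) ^ (q + 1)) ^ d * ((2 : ℝ) ^ (q + 1))⁻¹ ≤
      1 + B c k q d 0 * kappa c k q N 0 ^ d := by
  have hC : (2 : ℝ) * 2 ^ (q + 1) ≤ bigC c k q := by
    refine le_trans (le_trans (le_of_eq ?_) hc) (le_bigC ((by positivity : (0 : ℝ) ≤ _).trans hc) k q)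
    ring
  have hCd : (2 : ℝ) ^ d * (2 ^ (q + 1)) ^ d ≤ bigC c k q ^ d := by
    rw [← mul_pow]
    exact pow_le_pow_left₀ (by positivity) hC d
  have hY : 1 ≤ ((N : ℝ) + 1) ^ d * ((2 : ℝ) ^ (q + 1)) ^ d * ((2 : ℝ) ^ (q + 1))⁻¹ := by
    rw [← div_eq_mul_inv, one_le_div (by positivity)]
    exact (le_self_pow₀ (one_le_pow₀ one_le_two) (by omega)).trans (le_mul_of_one_le_left
      (by positivity) (one_le_pow₀ (by linarith [Nat.cast_nonneg (α := ℝ) N])))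
  have h2d : (d : ℝ) + 1 ≤ 2 ^ d := by exact_mod_cast Nat.lt_two_pow_self
  rw [B_zero_mul_kappa]
  calc _ ≤ 1 + 2 ^ d * (((N : ℝ) + 1) ^ d * ((2 : ℝ) ^ (q + 1)) ^ d * ((2 : ℝ) ^ (q + 1))⁻¹) := by
        nlinarith
    _ = 1 + ((N : ℝ) + 1) ^ d * (2 ^ d * ((2 : ℝ) ^ (q + 1)) ^ d) * ((2 : ℝ) ^ (q + 1))⁻¹ := by
        ring
    _ ≤ _ := by gcongr

/-- The lower bound for `c 1` compensates the factor `C_{k,q}^{-2}` in `B_1`, as `2 C_{k,q}` is at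
least `2^{q+3}`. -/
theorem sparse_const_one_le {c : ℕ → ℝ} {q : ℕ} {δ : ℝ} (hδ : 0 ≤ δ)
    (hc : (2 : ℝ) ^ (q + 2) ≤ c 0) (hc1 : (1 + δ) * ((2 : ℝ) ^ (q + 3)) ^ 2 ≤ c 1) {d : ℕ}
    (hd : 2 ≤ d) (k N : ℕ) :
    √d * (1 + δ + d * δ + δ * ((2 : ℝ) ^ (q + 2)) ^ d) ≤
      B c k q d 1 * kappa c k q N 1 ^ d := by
  have hc0 : 0 ≤ c 0 := (by positivity : (0 : ℝ) ≤ _).trans hc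
  have hc10 : 0 ≤ c 1 := (by positivity : (0 : ℝ) ≤ _).trans hc1
  obtain ⟨e, rfl⟩ : ∃ e, d = e + 2 := ⟨d - 2, by omega⟩
  have hC0 : 0 < bigC c k q := zero_lt_one.trans_le (one_le_bigC c k q)
  have hC : (2 : ℝ) ^ (q + 3) ≤ 2 * bigC c k q := by
    have h1 := hc.trans (le_bigC hc0 k q)
    have h2 : (2 : ℝ) ^ (q + 3) = 2 * 2 ^ (q + 2) := by ring
    linarith
  have hd32 : (((e + 2 : ℕ) : ℝ)) ^ (3 / 2 : ℝ) = ((e + 2 : ℕ) : ℝ) * √((e + 2 : ℕ) : ℝ) := by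
    rw [Real.sqrt_eq_rpow, show (3 / 2 : ℝ) = 1 + 1 / 2 by norm_num,
      Real.rpow_add (by positivity), Real.rpow_one]
  set D : ℝ := ((e + 2 : ℕ) : ℝ) with hD
  have hD2 : 2 ≤ D := by rw [hD]; exact_mod_cast (by omega : 2 ≤ e + 2)
  have hrhs : B c k q (e + 2) 1 * kappa c k q N 1 ^ (e + 2) =
      √D * (2 * D * √(cBar c k q) * (2 * bigC c k q) ^ e) := by
    rw [B, kappa, if_neg one_ne_zero, if_neg one_ne_zero, hd32, pow_add, zpow_neg,
      show (2 : ℤ) = ((2 : ℕ) : ℤ) from rfl, zpow_natCast]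
    field_simp
  set X : ℝ := ((2 : ℝ) ^ (q + 3)) ^ (e + 2) with hX
  have hX1 : 1 ≤ X := one_le_pow₀ (one_le_pow₀ one_le_two)
  have hXle : ((2 : ℝ) ^ (q + 2)) ^ (e + 2) ≤ X :=
    pow_le_pow_left₀ (by positivity) (pow_le_pow_right₀ one_le_two (by omega)) _
  rw [hrhs]
  refine mul_le_mul_of_nonneg_left ?_ (Real.sqrt_nonneg _)
  calc _ ≤ (1 + δ) * (1 + D + X) := by nlinarith
    _ ≤ (1 + δ) * (2 * D * X) := by
        refine mul_le_mul_of_nonneg_left ?_ (by linarith)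
        nlinarith
    _ = 2 * D * ((1 + δ) * ((2 : ℝ) ^ (q + 3)) ^ 2) * ((2 : ℝ) ^ (q + 3)) ^ e := by
        rw [hX]; ring
    _ ≤ _ := by
        have := hc1.trans (le_sqrt_cBar hc10 k q)
        gcongr

end SparseDG

end

open SparseDG in
theorem mainTheorem2 (k q : ℕ) (hk : 1 ≤ k) (hq : 1 ≤ q) (hqk : q ≤ k) :
    ∃ c cbb : ℕ → ℝ,
      (∀ s ≤ 1, 0 < c s ∧ 0 < cbb s) ∧
      (∀ s ≤ 1, ∀ d, 2 ≤ d → ∀ N, 1 ≤ N → 0 < B c k q d s ∧ 0 < kappa c k q N s) ∧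
      -- `c s` is a constant of the one-dimensional cellwise estimate for the projection onto `V_n^k`
      (∀ s ≤ 1, ∀ p, q ≤ p → ∀ v : L2 1, MemSobolev (cube 1) (p + 1) v →
        ∀ (n : ℕ) (j : Fin 1 → Fin (2 ^ n)),
          sobolevSeminorm (cell n j) s (fullProj 1 k n v - v : L2 1) ≤
            ENNReal.ofReal (c s * rate n q s) * sobolevSeminorm (cell n j) (q + 1) v) ∧
      -- `cbb s` is a constant of the estimate for the projection onto the full tensor-product space
      (∀ s ≤ 1, ∀ d, 2 ≤ d → ∀ p, q ≤ p → ∀ v : L2 d, MemSobolev (cube d) (p + 1) v →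
        ∀ N, 1 ≤ N →
          brokenSeminorm N s (fullProj d k N v - v : L2 d) ≤
            ENNReal.ofReal (cbb s * rate N q s) * sobolevSeminorm (cube d) (q + 1) v) ∧
      -- the estimate for the projection onto the sparse space
      (∀ s ≤ 1, ∀ d, 2 ≤ d → ∀ p, q ≤ p → ∀ v : L2 d, MemMixedSobolev (cube d) (p + 1) v →
        ∀ N, 1 ≤ N →
          brokenSeminorm N s (sparseProj d k N v - v : L2 d) ≤
            ENNReal.ofReal ((cbb s + B c k q d s * kappa c k q N s ^ d) * rate N q s) *
              mixedSeminorm (cube d) (q + 1) v) ∧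
      -- the resulting orders in `N`
      (∀ d, 2 ≤ d → ∃ K : ℝ, 0 < K ∧
        ∀ p, q ≤ p → ∀ v : L2 d, MemMixedSobolev (cube d) (p + 1) v → ∀ N, 1 ≤ N →
          brokenSeminorm N 0 (sparseProj d k N v - v : L2 d) ≤
            ENNReal.ofReal (K * (N : ℝ) ^ d * (2 : ℝ) ^ (-((N : ℤ) * (q + 1)))) *
              mixedSeminorm (cube d) (q + 1) v ∧
          brokenSeminorm N 1 (sparseProj d k N v - v : L2 d) ≤
            ENNReal.ofReal (K * (2 : ℝ) ^ (-((N : ℤ) * q))) *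
              mixedSeminorm (cube d) (q + 1) v) := by
  set δ := ‖polDeriv k‖ with hδ
  have hδ0 : 0 ≤ δ := norm_nonneg _
  -- The one-dimensional estimate holds with the constants `1` and `1 + δ`; the larger ones are needed
  -- in `B` and `kappa` to dominate the contribution of the increments.
  let c : ℕ → ℝ := fun s =>
    if s = 0 then (2 : ℝ) ^ (q + 2) else (1 + δ) * ((2 : ℝ) ^ (q + 3)) ^ 2
  let cbb : ℕ → ℝ := fun s => if s = 0 then 1 else 3 * (1 + δ)
  have hc0 : c 0 = (2 : ℝ) ^ (q + 2) := rfl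
  have hc1 : c 1 = (1 + δ) * ((2 : ℝ) ^ (q + 3)) ^ 2 := rfl
  have hc1pos : 0 < c 1 := by rw [hc1]; positivity
  have hrate : ∀ n s, 0 < rate n q s := fun n s => by rw [rate]; positivity
  have hC0 : 0 < bigC c k q := zero_lt_one.trans_le (one_le_bigC c k q)
  have hsparse : ∀ s ≤ 1, ∀ d, 2 ≤ d → ∀ p, q ≤ p → ∀ v : L2 d,
      MemMixedSobolev (cube d) (p + 1) v → ∀ N, 1 ≤ N →
        brokenSeminorm N s (sparseProj d k N v - v : L2 d) ≤
          ENNReal.ofReal ((cbb s + B c k q d s * kappa c k q N s ^ d) * rate N q s) *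
            mixedSeminorm (cube d) (q + 1) v := by
    intro s hs d hd p hp v hv N _
    obtain ⟨m, hm0, hm, hle⟩ := exists_hasMixedBound (by omega) hp hv
    have hpos : 0 ≤ B c k q d s * kappa c k q N s ^ d :=
      mul_nonneg (B_pos hc1pos (by omega) k q s).le (pow_nonneg (kappa_pos c k q N s).le d)
    have hcbb : 0 ≤ cbb s := by simp only [cbb]; split_ifs <;> positivity
    refine le_trans ?_ (mul_le_mul_right hle _)
    rw [← ENNReal.ofReal_mul (mul_nonneg (add_nonneg hcbb hpos) (hrate N s).le)]
    rcases Nat.le_one_iff_eq_zero_or_eq_one.1 hs with rfl | rfl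
    · refine (hm.brokenSeminorm_sparseProj_sub_zero_le hqk hm0 N).trans
        (ENNReal.ofReal_le_ofReal ?_)
      have := sparse_const_zero_le hc0.ge (by omega : 1 ≤ d) k N
      exact mul_le_mul_of_nonneg_right (mul_le_mul_of_nonneg_right this (hrate N 0).le) hm0
    · refine (hm.brokenSeminorm_sparseProj_sub_one_le hq hqk hm0 N).trans
        (ENNReal.ofReal_le_ofReal ?_)
      have := (sparse_const_one_le hδ0 hc0.ge hc1.ge hd k N).trans (le_add_of_nonneg_left hcbb)
      exact mul_le_mul_of_nonneg_right (mul_le_mul_of_nonneg_right this (hrate N 1).le) hm0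
  refine ⟨c, cbb, ?_, ?_, ?_, ?_, hsparse, ?_⟩
  · intro s _
    simp only [c, cbb]
    constructor <;> split_ifs <;> positivity
  · exact fun s _ d hd N _ => ⟨B_pos hc1pos (by omega) k q s, kappa_pos c k q N s⟩
  · intro s hs p hp v hv n j
    refine sobolevSeminorm_cell_le hqk hs (hv _ ?_) j ?_ ?_
    · simpa using hp
    · rintro rfl
      exact one_le_pow₀ one_le_two
    · rintro rfl
      exact le_mul_of_one_le_right (by positivity) (one_le_pow₀ (one_le_pow₀ one_le_two))
  · intro s hs d _ p hp v hv N _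
    have hv' : ∀ α : Fin d → ℕ, ∑ i, α i = q + 1 → ∃ g, HasWeakDeriv (cube d) α v g :=
      fun α hα => hv α (by omega)
    rcases Nat.le_one_iff_eq_zero_or_eq_one.1 hs with rfl | rfl
    · have h := brokenSeminorm_fullProj_sub_zero_le hqk hv' N
      rwa [← one_mul (rate N q 0)] at h
    · exact brokenSeminorm_fullProj_sub_one_le hq hqk hv' N
  · intro d hd
    have hB : ∀ s, 0 < B c k q d s := B_pos hc1pos (by omega) k q
    set K0 := 1 + 2 ^ d * bigC c k q ^ d * ((2 : ℝ) ^ (q + 1))⁻¹ with hK0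
    set K1 := 3 * (1 + δ) + B c k q d 1 * (2 * bigC c k q) ^ d with hK1
    have hK0pos : 0 < K0 := by positivity
    have hK1pos : 0 < K1 := by have := hB 1; positivity
    refine ⟨K0 + K1, add_pos hK0pos hK1pos, fun p hp v hv N hN => ⟨?_, ?_⟩⟩
    · refine (hsparse 0 zero_le_one d hd p hp v hv N hN).trans
        (mul_le_mul_left (ENNReal.ofReal_le_ofReal ?_) _)
      have hr : rate N q 0 = (2 : ℝ) ^ (-((N : ℤ) * (q + 1))) := by simp [rate]
      rw [← hr, B_zero_mul_kappa]
      refine mul_le_mul_of_nonneg_right ?_ (hrate N 0).le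
      have hN1 : (1 : ℝ) ≤ N := by exact_mod_cast hN
      have hNd : ((N : ℝ) + 1) ^ d ≤ 2 ^ d * (N : ℝ) ^ d := by
        rw [← mul_pow]
        exact pow_le_pow_left₀ (by positivity) (by linarith) d
      calc 1 + ((N : ℝ) + 1) ^ d * bigC c k q ^ d * ((2 : ℝ) ^ (q + 1))⁻¹
          ≤ (N : ℝ) ^ d + 2 ^ d * (N : ℝ) ^ d * bigC c k q ^ d * ((2 : ℝ) ^ (q + 1))⁻¹ := by
            gcongr
            exact one_le_pow₀ hN1
        _ = K0 * (N : ℝ) ^ d := by rw [hK0]; ring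
        _ ≤ (K0 + K1) * (N : ℝ) ^ d := by gcongr; linarith
    · refine (hsparse 1 le_rfl d hd p hp v hv N hN).trans
        (mul_le_mul_left (ENNReal.ofReal_le_ofReal ?_) _)
      have hr : rate N q 1 = (2 : ℝ) ^ (-((N : ℤ) * q)) := by simp [rate]
      rw [← hr]
      refine mul_le_mul_of_nonneg_right ?_ (hrate N 1).le
      have hk1 : kappa c k q N 1 = 2 * bigC c k q := by rw [kappa, if_neg one_ne_zero]
      have hcbb1 : cbb 1 = 3 * (1 + δ) := rfl
      rw [hk1, hcbb1]
      linarith
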